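/- \textbf{Theorem (convergence of characteristics).} Let $T, q_{\max}, \mathcal C_{\mathcal V}, \mathcal C_\Gamma, \bar R, \varepsilon > 0$ and put \begin{align*} \mathcal Q &:= \{ q_0 \in L^2(\mathbb R) : 0 \le q_0 \le q_{\max} \text{ a.e.} \},\\ \mathcal V &:= \{ V \in W^{1,\infty}([0,q_{\max}];\mathbb R_{\ge 0}) : V' \le 0 \text{ a.e.},\ \|V\|_{L^\infty} + \|V'\|_{L^\infty} \le \mathcal C_{\mathcal V} \},\\ \Gamma &:= \{ \gamma \in L^1(\mathbb R_{\ge 0};\mathbb R_{\ge 0}) : \gamma \text{ nonincreasing a.e.},\ \|\gamma\|_{L^\infty} \le \mathcal C_\Gamma,\ \|\gamma\|_{L^1} = 1,\ \gamma(x) \le x^{-(1+\varepsilon)} \text{ for a.e. } x > \bar R \}. \end{align*} For a kernel $\gamma$ and a function $q$ let $W[q](t,x) := \int_x^\infty \gamma(y-x)\, q(t,y)\, dy$. For $q_0 \in L^\infty(\mathbb R)$ with $0 \le q_0 \le q_{\max}$ a.e., $V \in \mathcal V$ and $\gamma \in \Gamma$, a weak solution of \[ \partial_t q + \partial_x\big(q\,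 V(W[q])\big) = 0 \ \text{ on } (0,T)\times\mathbb R, \qquad q(0,\cdot) = q_0, \] is a function $q \in C([0,T];L^1_{\mathrm{loc}}(\mathbb R)) \cap L^\infty((0,T);L^\infty(\mathbb R))$ such that $W[q]$ takes values in $[0,q_{\max}]$ on $[0,T]\times\mathbb R$ and \[ \int_0^T\!\!\int_{\mathbb R} q\,\big(\partial_t\varphi + V(W[q])\,\partial_x\varphi\big)\,dx\,dt + \int_{\mathbb R} q_0(x)\,\varphi(0,x)\,dx = 0 \] for every compactly supported $C^1$ function $\varphi$ on $\mathbb R\times\mathbb R$ with support in $(-\infty,T)\times\mathbb R$. For $V\in\mathcal V$ and $W : [0,T]\times\mathbb R \to [0,q_{\max}]$, the characteristics $\xi$ of $(V,W)$ are the solution of \[ \partial_3 \xi(t,x;s) = V\big(W(s,\xi(t,x;s))\big), \quad \xi(t,x;t) = x, \qquad (t,x,s) \in [0,T]\times\mathbb R\times[0,T]. \] Let $(q_{0,k},V_k,\gamma_k)_{k\in\mathbb N} \subseteq \mathcal Q\times\mathcal V\times\Gamma$ be any sequence. For every $k$ there is a unique weak solution $q_k$ for the data $(q_{0,k},V_k,\gamma_k)$,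 it lies in $C([0,T];L^2(\mathbb R))$, and with $W_k := W[q_k]$ (kernel $\gamma_k$) there are unique characteristics $\xi_k$ of $(V_k,W_k)$. Moreover, there are a subsequence (not relabelled), $q_0^* \in L^\infty(\mathbb R)$ with $0 \le q_0^* \le q_{\max}$ a.e., $V^* \in \mathcal V$, $\gamma^* \in \Gamma$ and $\hat W \in W^{1,\infty}([0,T]\times\mathbb R)$ such that \begin{enumerate} \item $q_{0,k} \to q_0^*$ weakly-$*$ in $L^\infty(\mathbb R)$; \item $V_k \to V^*$ uniformly on $[0,q_{\max}]$; \item $\gamma_k \to \gamma^*$ in $L^1(\mathbb R_{\ge 0})$; \item $W_k \to \hat W$ in $C([0,T]\times\mathbb R)$, that is, locally uniformly; \item $\xi_k \to \hat\xi$ in $C([0,T]\times\mathbb R\times[0,T])$, that is, locally uniformly, where $\hat\xi$ are the unique characteristics of $(V^*,\hat W)$; \item there is a unique weak solution $q^*$ for the data $(q_0^*,V^*,\gamma^*)$, and $\hat W = W[q^*]$ (kernel $\gamma^*$) on $[0,T]\times\mathbb R$. \end{enumerate} If, in addition, $(q_{0,k})_{k}$ is bounded in $L^2(\mathbb R)$,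 then $q_0^* \in \mathcal Q$ (so $(q_0^*,V^*,\gamma^*) \in \mathcal Q\times\mathcal V\times\Gamma$) and $q^* \in C([0,T];L^2(\mathbb R))$. -/

import Mathlib

open MeasureTheory Set Filter Topology
open scoped ENNReal NNReal

namespace NonlocalControl

noncomputable section

/-- Admissible initial data: `L²` functions with values in `[0, qmax]` almost everywhere. -/
structure IsInitialDatum (qmax : ℝ) (q₀ : ℝ → ℝ) : Prop where
  memLp_two : MemLp q₀ 2 volume
  bounds : ∀ᵐ x, 0 ≤ q₀ x ∧ q₀ x ≤ qmax

/-- Admissible velocities: the nonnegative `V ∈ W^{1,∞}([0, qmax])` with `V' ≤ 0` a.e. and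
`‖V‖_{L^∞} + ‖V'‖_{L^∞} ≤ C`. A (continuous representative of a) `W^{1,∞}` function of one variable
is a primitive of its weak derivative `V' ∈ L^∞`. Only the values of `V` on `[0, qmax]` matter. -/
structure IsVelocity (qmax C : ℝ) (V : ℝ → ℝ) : Prop where
  nonneg : ∀ u ∈ Icc 0 qmax, 0 ≤ V u
  exists_weak_deriv : ∃ V' : ℝ → ℝ,
    MemLp V' ∞ (volume.restrict (Icc 0 qmax)) ∧
    (∀ u ∈ Icc 0 qmax, V u = V 0 + ∫ s in (0 : ℝ)..u, V' s) ∧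
    (∀ᵐ u ∂(volume.restrict (Icc 0 qmax)), V' u ≤ 0) ∧
    eLpNorm V ∞ (volume.restrict (Icc 0 qmax)) + eLpNorm V' ∞ (volume.restrict (Icc 0 qmax))
      ≤ ENNReal.ofReal C

/-- Admissible kernels: nonnegative, a.e. nonincreasing `γ ∈ L¹(0, ∞)` with `‖γ‖_{L^∞} ≤ C`,
`‖γ‖_{L¹} = 1` and `γ(x) ≤ x^{-(1+ε)}` for a.e. `x > R`. Only the values on `(0, ∞)` matter. -/
structure IsKernel (C R ε : ℝ) (γ : ℝ → ℝ) : Prop where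
  integrable : IntegrableOn γ (Ioi 0)
  nonneg : ∀ᵐ x ∂(volume.restrict (Ioi 0)), 0 ≤ γ x
  nonincreasing : ∃ g : ℝ → ℝ, AntitoneOn g (Ioi 0) ∧ γ =ᵐ[volume.restrict (Ioi 0)] g
  norm_top : eLpNorm γ ∞ (volume.restrict (Ioi 0)) ≤ ENNReal.ofReal C
  norm_one : eLpNorm γ 1 (volume.restrict (Ioi 0)) = 1
  decay : ∀ᵐ x ∂(volume.restrict (Ioi R)), γ x ≤ x ^ (-(1 + ε))

/-- The nonlocal term `W[q](t, x) = ∫_x^∞ γ(y - x) q(t, y) dy`. -/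
def nonlocalTerm (γ : ℝ → ℝ) (q : ℝ → ℝ → ℝ) (t x : ℝ) : ℝ :=
  ∫ y in Ioi x, γ (y - x) * q t y

/-- `q ∈ C([0, T]; L^p(μ))`. -/
def IsContinuousInLp (T : ℝ) (p : ℝ≥0∞) (μ : Measure ℝ) (q : ℝ → ℝ → ℝ) : Prop :=
  ∀ t ∈ Icc 0 T, MemLp (q t) p μ ∧
    Tendsto (fun s => eLpNorm (fun x => q s x - q t x) p μ) (𝓝[Icc 0 T] t) (𝓝 0)

/-- `q ∈ C([0, T]; L¹_loc(ℝ)) ∩ L^∞((0, T); L^∞(ℝ))` is a weak solution of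
`∂ₜ q + ∂ₓ (q V(W[q])) = 0` on `(0, T) × ℝ`, `q(0, ·) = q₀`. As `V` is a function on `[0, qmax]`, the
equation has a meaning only if `W[q]` takes its values there. -/
structure IsWeakSolution (T qmax : ℝ) (q₀ V γ : ℝ → ℝ) (q : ℝ → ℝ → ℝ) : Prop where
  continuous_L1_loc : ∀ r : ℝ, IsContinuousInLp T 1 (volume.restrict (Icc (-r) r)) q
  bounded : ∃ M : ℝ, ∀ t ∈ Icc 0 T, ∀ᵐ x, |q t x| ≤ M
  range_nonlocal : ∀ t ∈ Icc 0 T, ∀ x, nonlocalTerm γ q t x ∈ Icc 0 qmax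
  weak_form : ∀ φ : ℝ × ℝ → ℝ, ContDiff ℝ 1 φ → HasCompactSupport φ →
    tsupport φ ⊆ Iio T ×ˢ univ →
    (∫ t in (0 : ℝ)..T, ∫ x, q t x * (deriv (fun s => φ (s, x)) t +
        V (nonlocalTerm γ q t x) * deriv (fun y => φ (t, y)) x))
      + ∫ x, q₀ x * φ (0, x) = 0

/-- `q` is the weak solution `q[q₀, V, γ]`: it is a weak solution, and every weak solution agrees
with it almost everywhere at all times. -/
def IsTheWeakSolution (T qmax : ℝ) (q₀ V γ : ℝ → ℝ) (q : ℝ → ℝ → ℝ) : Prop :=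
  IsWeakSolution T qmax q₀ V γ q ∧
    ∀ p : ℝ → ℝ → ℝ, IsWeakSolution T qmax q₀ V γ p → ∀ t ∈ Icc 0 T, p t =ᵐ[volume] q t

/-- `ξ(t, x; ·)` solves `∂₃ ξ(t, x; s) = V(W(s, ξ(t, x; s)))` on `[0, T]`, `ξ(t, x; t) = x`, for all
`(t, x) ∈ [0, T] × ℝ`. -/
def SolvesCharacteristics (T : ℝ) (V : ℝ → ℝ) (W : ℝ → ℝ → ℝ) (ξ : ℝ → ℝ → ℝ → ℝ) : Prop :=
  ∀ t ∈ Icc 0 T, ∀ x, ξ t x t = x ∧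
    ∀ s ∈ Icc 0 T, HasDerivWithinAt (ξ t x) (V (W s (ξ t x s))) (Icc 0 T) s

/-- `ξ` is the family of characteristics `ξ_W`: the unique solution of the characteristic initial
value problems. -/
def IsTheCharacteristics (T : ℝ) (V : ℝ → ℝ) (W : ℝ → ℝ → ℝ) (ξ : ℝ → ℝ → ℝ → ℝ) : Prop :=
  SolvesCharacteristics T V W ξ ∧
    ∀ ζ : ℝ → ℝ → ℝ → ℝ, SolvesCharacteristics T V W ζ →
      ∀ t ∈ Icc 0 T, ∀ x, ∀ s ∈ Icc 0 T, ζ t x s = ξ t x s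

/-- `W ∈ W^{1,∞}([0, T] × ℝ)`: on this convex set, the continuous representatives of `W^{1,∞}`
functions are the bounded Lipschitz functions. -/
def IsBoundedLipschitz (T : ℝ) (W : ℝ → ℝ → ℝ) : Prop :=
  (∃ M : ℝ, ∀ t ∈ Icc 0 T, ∀ x, |W t x| ≤ M) ∧
    ∃ K : ℝ≥0, LipschitzOnWith K (fun p : ℝ × ℝ => W p.1 p.2) (Icc 0 T ×ˢ univ)

end

end NonlocalControl

namespace NonlocalControl

/-- Nonnegative antitone functions on `ℝ` bounded by `C`, with unit mass on `(0, ∞)`. -/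
structure IsMonotoneKernel (C : ℝ) (g : ℝ → ℝ) : Prop where
  antitone : Antitone g
  nonneg : ∀ x, 0 ≤ g x
  le : ∀ x, g x ≤ C
  integrableOn : IntegrableOn g (Ioi 0)
  integral_eq : ∫ x in Ioi 0, g x = 1

/-- The restriction of a kernel to `(0, ∞)`, extended by zero. -/
noncomputable def forward (g : ℝ → ℝ) : ℝ → ℝ := (Ioi 0).indicator g

/-- Measurable functions with values in `[0, M]`. -/
structure IsDensity (M : ℝ) (q : ℝ → ℝ) : Prop where
  measurable : Measurable q
  nonneg : ∀ x, 0 ≤ q x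
  le : ∀ x, q x ≤ M

/-- The measure with Lebesgue density `q`. -/
noncomputable def densityMeasure (q : ℝ → ℝ) : Measure ℝ :=
  volume.withDensity fun x => ENNReal.ofReal (q x)

/-- The Lebesgue density of a measure, truncated at height `K`. -/
noncomputable def densityOf (K : ℝ) (ν : Measure ℝ) (x : ℝ) : ℝ :=
  min K (ν.rnDeriv volume x).toReal

theorem le_smul_volume_of_Ioc {ν : Measure ℝ} {G : ℝ → ℝ} {M : ℝ} (hM : 0 ≤ M)
    (hν : ∀ a b, a ≤ b → ν (Ioc a b) = ENNReal.ofReal (G b - G a))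
    (hG : Monotone G) (hGM : ∀ a b, a ≤ b → G b - G a ≤ M * (b - a)) :
    ν ≤ ENNReal.ofReal M • volume := by
  have hlip : ∀ a b, |G a - G b| ≤ M * |a - b| := by
    intro a b
    rcases le_total a b with h | h
    · rw [abs_sub_comm, abs_of_nonneg (sub_nonneg.2 (hG h)), abs_sub_comm,
        abs_of_nonneg (sub_nonneg.2 h)]
      exact hGM a b h
    · rw [abs_of_nonneg (sub_nonneg.2 (hG h)), abs_of_nonneg (sub_nonneg.2 h)]
      exact hGM b a h
  have hcont : Continuous G := by
    have : LipschitzWith M.toNNReal G := by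
      refine LipschitzWith.of_dist_le_mul fun a b => ?_
      rw [Real.dist_eq, Real.dist_eq, Real.coe_toNNReal _ hM]
      exact hlip a b
    exact this.continuous
  let F₁ : StieltjesFunction ℝ := ⟨G, hG, fun x => hcont.continuousWithinAt⟩
  let F₂ : StieltjesFunction ℝ := ⟨fun x => M * x - G x, fun a b h => by
    have := hGM a b h
    simp only
    linarith, fun x => by
      have : Continuous fun x => M * x - G x := by fun_prop
      exact this.continuousWithinAt⟩
  have h1 : F₁.measure = ν := by
    refine Measure.ext_of_Ioc _ _ fun a b hab => ?_
    rw [StieltjesFunction.measure_Ioc, hν a b hab.le]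
  have h2 : (F₁ + F₂).measure = ENNReal.ofReal M • volume := by
    refine Measure.ext_of_Ioc _ _ fun a b hab => ?_
    rw [StieltjesFunction.measure_Ioc, Measure.smul_apply, Real.volume_Ioc, smul_eq_mul,
      ← ENNReal.ofReal_mul hM]
    congr 1
    simp only [StieltjesFunction.add_apply]
    change (G b + (M * b - G b)) - (G a + (M * a - G a)) = _
    ring
  rw [← h2, StieltjesFunction.measure_add, h1]
  exact Measure.le_add_right le_rfl

section density

variable {M : ℝ} {q : ℝ → ℝ}

theorem IsDensity.intervalIntegrable (hq : IsDensity M q) (a b : ℝ) :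
    IntervalIntegrable q volume a b := by
  refine (intervalIntegrable_const (c := M)).mono_fun hq.measurable.aestronglyMeasurable ?_
  refine Eventually.of_forall fun x => ?_
  change ‖q x‖ ≤ ‖M‖
  rw [Real.norm_of_nonneg (hq.nonneg x)]
  exact (hq.le x).trans (le_abs_self M)

theorem IsDensity.bound_nonneg (hq : IsDensity M q) : 0 ≤ M := (hq.nonneg 0).trans (hq.le 0)

theorem IsDensity.integral_nonneg (hq : IsDensity M q) {a b : ℝ} (h : a ≤ b) :
    0 ≤ ∫ x in a..b, q x :=
  intervalIntegral.integral_nonneg h fun x _ => hq.nonneg x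

theorem IsDensity.integral_le (hq : IsDensity M q) {a b : ℝ} (h : a ≤ b) :
    ∫ x in a..b, q x ≤ M * (b - a) := by
  have := intervalIntegral.integral_mono_on h (hq.intervalIntegrable a b)
    (intervalIntegrable_const (c := M)) fun x _ => hq.le x
  simpa [mul_comm] using this

theorem IsDensity.densityMeasure_Ioc (hq : IsDensity M q) {a b : ℝ} (h : a ≤ b) :
    densityMeasure q (Ioc a b) = ENNReal.ofReal (∫ x in a..b, q x) := by
  rw [densityMeasure, withDensity_apply _ measurableSet_Ioc, intervalIntegral.integral_of_le h,
    ofReal_integral_eq_lintegral_ofReal ((hq.intervalIntegrable a b).1)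
      (Eventually.of_forall hq.nonneg)]

theorem IsDensity.integral_densityMeasure (hq : IsDensity M q) (f : ℝ → ℝ) :
    ∫ x, f x ∂(densityMeasure q) = ∫ x, q x * f x := by
  rw [densityMeasure, integral_withDensity_eq_integral_toReal_smul
    (hq.measurable.ennreal_ofReal) (Eventually.of_forall fun x => ENNReal.ofReal_lt_top)]
  simp [ENNReal.toReal_ofReal (hq.nonneg _)]

theorem IsDensity.map_le (hq : IsDensity M q) {K : ℝ} (hK : 0 ≤ K) (X : ℝ ≃o ℝ)
    (h : ∀ a b, a ≤ b → ∫ x in a..b, q x ≤ K * (X b - X a)) :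
    (densityMeasure q).map X ≤ ENNReal.ofReal K • volume := by
  have hsub : ∀ a b, (∫ x in (0 : ℝ)..b, q x) - ∫ x in (0 : ℝ)..a, q x = ∫ x in a..b, q x :=
    fun a b => intervalIntegral.integral_interval_sub_left (hq.intervalIntegrable _ _)
      (hq.intervalIntegrable _ _)
  refine le_smul_volume_of_Ioc (G := fun u => ∫ x in (0 : ℝ)..X.symm u, q x) hK ?_ ?_ ?_
  · intro a b hab
    rw [Measure.map_apply X.continuous.measurable measurableSet_Ioc]
    change densityMeasure q (X ⁻¹' Ioc a b) = _
    rw [OrderIso.preimage_Ioc, hq.densityMeasure_Ioc (X.symm.monotone hab), hsub]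
  · intro a b hab
    rw [← sub_nonneg, hsub]
    exact hq.integral_nonneg (X.symm.monotone hab)
  · intro a b hab
    rw [hsub]
    simpa using h _ _ (X.symm.monotone hab)

/-- A measure dominated by `K` times Lebesgue measure has a density with values in `[0, K]`. -/
theorem densityOf_spec {ν : Measure ℝ} {K : ℝ} (hK : 0 ≤ K)
    (hν : ν ≤ ENNReal.ofReal K • volume) :
    IsDensity K (densityOf K ν) ∧ densityMeasure (densityOf K ν) = ν := by
  have hac : ν ≪ volume := (Measure.absolutelyContinuous_of_le hν).trans
    Measure.smul_absolutelyContinuous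
  have : SigmaFinite ν := by
    have : SigmaFinite (ENNReal.ofReal K • (volume : Measure ℝ)) := by
      change SigmaFinite (K.toNNReal • (volume : Measure ℝ))
      infer_instance
    exact Measure.sigmaFinite_of_le _ hν
  have hle : ∀ᵐ x, ν.rnDeriv volume x ≤ ENNReal.ofReal K := by
    refine ae_le_of_forall_setLIntegral_le_of_sigmaFinite (Measure.measurable_rnDeriv _ _)
      fun s hs _ => ?_
    rw [Measure.setLIntegral_rnDeriv hac]
    simpa using hν s
  refine ⟨⟨measurable_const.min (Measure.measurable_rnDeriv _ _).ennreal_toReal,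
    fun x => le_min hK ENNReal.toReal_nonneg, fun x => min_le_left _ _⟩, ?_⟩
  rw [densityMeasure]
  conv_rhs => rw [← Measure.withDensity_rnDeriv_eq ν volume hac]
  refine withDensity_congr_ae ?_
  filter_upwards [hle] with x hx
  rw [densityOf, min_eq_right (ENNReal.toReal_le_of_le_ofReal hK hx)]
  exact ENNReal.ofReal_toReal (ne_top_of_le_ne_top ENNReal.ofReal_ne_top hx)

end density


section kernel

variable {C : ℝ} {g : ℝ → ℝ}

theorem IsMonotoneKernel.bound_nonneg (hg : IsMonotoneKernel C g) : 0 ≤ C :=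
  (hg.nonneg 0).trans (hg.le 0)

theorem forward_of_pos {x : ℝ} (hx : 0 < x) : forward g x = g x :=
  indicator_of_mem (mem_Ioi.2 hx) g

theorem forward_of_nonpos {x : ℝ} (hx : x ≤ 0) : forward g x = 0 :=
  indicator_of_notMem (by simpa using hx) g

theorem IsMonotoneKernel.forward_nonneg (hg : IsMonotoneKernel C g) (x : ℝ) : 0 ≤ forward g x :=
  indicator_nonneg (fun x _ => hg.nonneg x) x

theorem IsMonotoneKernel.forward_le (hg : IsMonotoneKernel C g) (x : ℝ) : forward g x ≤ C := by
  rcases lt_or_ge 0 x with h | h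
  · rw [forward_of_pos h]; exact hg.le x
  · rw [forward_of_nonpos h]; exact hg.bound_nonneg

theorem IsMonotoneKernel.measurable_forward (hg : IsMonotoneKernel C g) :
    Measurable (forward g) :=
  hg.antitone.measurable.indicator measurableSet_Ioi

theorem IsMonotoneKernel.integrable_forward (hg : IsMonotoneKernel C g) :
    Integrable (forward g) :=
  (integrable_indicator_iff measurableSet_Ioi).2 hg.integrableOn

theorem IsMonotoneKernel.integral_forward (hg : IsMonotoneKernel C g) :
    ∫ x, forward g x = 1 := by
  rw [forward, integral_indicator measurableSet_Ioi, hg.integral_eq]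

theorem IsMonotoneKernel.lintegral_forward (hg : IsMonotoneKernel C g) :
    ∫⁻ x, ENNReal.ofReal (forward g x) = 1 := by
  rw [← ofReal_integral_eq_lintegral_ofReal hg.integrable_forward
    (Eventually.of_forall hg.forward_nonneg), hg.integral_forward, ENNReal.ofReal_one]

/-- A bound for the oscillation of `forward g` on `[a - η, a + η]`. -/
noncomputable def oscBound (C : ℝ) (g : ℝ → ℝ) (η a : ℝ) : ℝ :=
  (Icc (-η) η).indicator (fun _ => C) a + (Ioi η).indicator (fun a => g (a - η) - g (a + η)) a

theorem IsMonotoneKernel.abs_forward_sub_le (hg : IsMonotoneKernel C g) {η a b : ℝ}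
    (h : |a - b| ≤ η) : |forward g a - forward g b| ≤ oscBound C g η a := by
  rw [abs_le] at h
  have hη : 0 ≤ η := by linarith [h.1, h.2]
  rcases lt_or_ge η a with h1 | h1
  · have hb : 0 < b := by linarith
    rw [oscBound, indicator_of_notMem (by simp [h1]), indicator_of_mem (mem_Ioi.2 h1),
      forward_of_pos (hη.trans_lt h1), forward_of_pos hb, abs_le]
    have e1 := hg.antitone (show a - η ≤ a by linarith)
    have e2 := hg.antitone (show a - η ≤ b by linarith)
    have e3 := hg.antitone (show a ≤ a + η by linarith)
    have e4 := hg.antitone (show b ≤ a + η by linarith)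
    constructor <;> linarith
  · rw [oscBound, indicator_of_notMem (s := Ioi η) (by simp [h1]), add_zero]
    rcases lt_or_ge a (-η) with h2 | h2
    · rw [forward_of_nonpos (by linarith), forward_of_nonpos (by linarith)]
      simpa using indicator_nonneg (fun _ _ => hg.bound_nonneg) a
    · rw [indicator_of_mem (mem_Icc.2 ⟨h2, h1⟩), abs_le]
      have := hg.forward_nonneg a
      have := hg.forward_nonneg b
      have := hg.forward_le a
      have := hg.forward_le b
      constructor <;> linarith

theorem IsMonotoneKernel.measurable_oscBound (hg : IsMonotoneKernel C g) (η : ℝ) :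
    Measurable (oscBound C g η) := by
  have := hg.antitone.measurable
  refine (measurable_const.indicator measurableSet_Icc).add
    (Measurable.indicator ?_ measurableSet_Ioi)
  exact (this.comp (measurable_id.sub_const η)).sub (this.comp (measurable_id.add_const η))

theorem IsMonotoneKernel.oscBound_nonneg (hg : IsMonotoneKernel C g) {η : ℝ} (hη : 0 ≤ η) (a : ℝ) :
    0 ≤ oscBound C g η a :=
  (abs_nonneg _).trans (hg.abs_forward_sub_le (a := a) (b := a) (by simpa using hη))

theorem IsMonotoneKernel.integral_oscBound (hg : IsMonotoneKernel C g) {η : ℝ} (hη : 0 ≤ η) :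
    Integrable (oscBound C g η) ∧ ∫ a, oscBound C g η a ≤ 4 * C * η := by
  have hC := hg.bound_nonneg
  have e1 : (Ioi η).indicator (fun a => g (a - η)) = fun a => forward g (a - η) := by
    ext a
    simp [forward, indicator_apply]
  have e2 : (Ioi η).indicator (fun a => g (a + η)) =
      fun a => (Ioi (2 * η)).indicator g (a + η) := by
    ext a
    have : η < a ↔ 2 * η < a + η := by constructor <;> intro <;> linarith
    simp [indicator_apply, this]
  have i2 : Integrable ((Ioi (2 * η)).indicator g) :=
    (integrable_indicator_iff measurableSet_Ioi).2
      (hg.integrableOn.mono_set (Ioi_subset_Ioi (by linarith)))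
  have e3 : (Ioi η).indicator (fun a => g (a - η) - g (a + η)) =
      fun a => forward g (a - η) - (Ioi (2 * η)).indicator g (a + η) := by
    rw [indicator_sub, e1, e2]
  have i3 : Integrable ((Ioi η).indicator (fun a => g (a - η) - g (a + η))) := by
    rw [e3]
    exact (hg.integrable_forward.comp_sub_right η).sub (i2.comp_add_right η)
  have i4 : Integrable ((Icc (-η) η).indicator fun _ => C) :=
    (integrable_indicator_iff measurableSet_Icc).2 (integrableOn_const (by simp))
  have e4 : ∫ a, (Ioi η).indicator (fun a => g (a - η) - g (a + η)) a ≤ 2 * η * C := by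
    rw [e3, integral_sub (hg.integrable_forward.comp_sub_right η) (i2.comp_add_right η),
      integral_sub_right_eq_self (forward g), integral_add_right_eq_self
      ((Ioi (2 * η)).indicator g), ← integral_sub hg.integrable_forward i2]
    have e5 : (fun a => forward g a - (Ioi (2 * η)).indicator g a) =
        (Ioc 0 (2 * η)).indicator g := by
      ext a
      simp only [forward, indicator_apply, mem_Ioi, mem_Ioc]
      split_ifs <;> grind
    rw [e5, integral_indicator measurableSet_Ioc, ← intervalIntegral.integral_of_le (by linarith)]
    have := intervalIntegral.integral_mono_on (a := 0) (b := 2 * η) (by linarith)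
      (μ := volume) ((hg.antitone.antitoneOn _).intervalIntegrable) (intervalIntegrable_const (c := C))
      fun x _ => hg.le x
    simpa using this
  refine ⟨i4.add i3, ?_⟩
  have : ∫ a, oscBound C g η a = _ := integral_add i4 i3
  rw [this, integral_indicator measurableSet_Icc]
  simp only [integral_const, measureReal_restrict_apply_univ, Real.volume_real_Icc, smul_eq_mul]
  rw [max_eq_left (by linarith)]
  linarith

section comp

variable {α : Type*} [MeasurableSpace α] {μ : Measure α} {M : ℝ} {X Y : α → ℝ}

theorem map_sub_const_le (hX : Measurable X) (h : μ.map X ≤ ENNReal.ofReal M • volume) (x : ℝ) :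
    μ.map (fun y => X y - x) ≤ ENNReal.ofReal M • volume := by
  have : μ.map (fun y => X y - x) = (μ.map X).map (fun u => u - x) :=
    (Measure.map_map (measurable_id.sub_const x) hX).symm
  rw [this]
  refine (Measure.map_mono h (f := fun u => u - x) (by fun_prop)).trans ?_
  rw [Measure.map_smul, (measurePreserving_sub_right volume x).map_eq]

theorem lintegral_comp_le_of_map_le (hX : Measurable X)
    (h : μ.map X ≤ ENNReal.ofReal M • volume) {f : ℝ → ℝ≥0∞} (hf : Measurable f) :
    ∫⁻ y, f (X y) ∂μ ≤ ENNReal.ofReal M * ∫⁻ u, f u := by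
  rw [← lintegral_map hf hX]
  exact (lintegral_mono' h le_rfl).trans (by rw [lintegral_smul_measure, smul_eq_mul])

theorem integrable_comp_of_map_le (hX : Measurable X)
    (h : μ.map X ≤ ENNReal.ofReal M • volume) {f : ℝ → ℝ} (hf : Integrable f) :
    Integrable (fun y => f (X y)) μ := by
  have : Integrable f (μ.map X) :=
    (hf.smul_measure ENNReal.ofReal_ne_top).mono_measure h
  exact this.comp_measurable hX

theorem IsMonotoneKernel.integral_comp_nonneg (hg : IsMonotoneKernel C g) :
    0 ≤ ∫ y, forward g (X y) ∂μ := integral_nonneg fun _ => hg.forward_nonneg _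

theorem IsMonotoneKernel.integral_comp_le (hg : IsMonotoneKernel C g) (hM : 0 ≤ M)
    (hX : Measurable X) (h : μ.map X ≤ ENNReal.ofReal M • volume) :
    ∫ y, forward g (X y) ∂μ ≤ M := by
  rw [integral_eq_lintegral_of_nonneg_ae (Eventually.of_forall fun _ => hg.forward_nonneg _)
    (hg.measurable_forward.comp hX).aestronglyMeasurable]
  refine ENNReal.toReal_le_of_le_ofReal hM ?_
  refine (lintegral_comp_le_of_map_le hX h hg.measurable_forward.ennreal_ofReal).trans ?_
  rw [hg.lintegral_forward, mul_one]

theorem IsMonotoneKernel.integral_abs_sub_le (hg : IsMonotoneKernel C g) (hM : 0 ≤ M)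
    (hX : Measurable X) (hY : Measurable Y) (h : μ.map X ≤ ENNReal.ofReal M • volume) {η : ℝ}
    (hη : 0 ≤ η) (hXY : ∀ y, |X y - Y y| ≤ η) :
    Integrable (fun y => forward g (X y) - forward g (Y y)) μ ∧
      ∫ y, |forward g (X y) - forward g (Y y)| ∂μ ≤ M * (4 * C * η) := by
  obtain ⟨hi, hle⟩ := hg.integral_oscBound hη
  have hi' := integrable_comp_of_map_le hX h hi
  have hdom : ∀ᵐ y ∂μ, ‖forward g (X y) - forward g (Y y)‖ ≤ oscBound C g η (X y) :=
    Eventually.of_forall fun y => hg.abs_forward_sub_le (hXY y)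
  have hint : Integrable (fun y => forward g (X y) - forward g (Y y)) μ :=
    hi'.mono' ((hg.measurable_forward.comp hX).sub
      (hg.measurable_forward.comp hY)).aestronglyMeasurable hdom
  refine ⟨hint, (integral_mono_ae hint.abs hi' hdom).trans ?_⟩
  rw [integral_eq_lintegral_of_nonneg_ae
    (Eventually.of_forall fun _ => hg.oscBound_nonneg hη _) hi'.1]
  refine ENNReal.toReal_le_of_le_ofReal (by have := hg.bound_nonneg; positivity) ?_
  refine (lintegral_comp_le_of_map_le hX h (hg.measurable_oscBound η).ennreal_ofReal).trans ?_
  rw [← ofReal_integral_eq_lintegral_ofReal hi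
    (Eventually.of_forall fun _ => hg.oscBound_nonneg hη _), ← ENNReal.ofReal_mul hM]
  exact ENNReal.ofReal_le_ofReal (mul_le_mul_of_nonneg_left hle hM)

theorem IsMonotoneKernel.abs_integral_sub_le (hg : IsMonotoneKernel C g) (hM : 0 ≤ M)
    (hX : Measurable X) (hY : Measurable Y) (h : μ.map X ≤ ENNReal.ofReal M • volume) {η : ℝ}
    (hη : 0 ≤ η) (hXY : ∀ y, |X y - Y y| ≤ η) :
    |∫ y, forward g (X y) ∂μ - ∫ y, forward g (Y y) ∂μ| ≤ M * (4 * C * η) := by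
  obtain ⟨hi, hle⟩ := hg.integral_abs_sub_le hM hX hY h hη hXY
  have hiX := integrable_comp_of_map_le hX h hg.integrable_forward
  have hiY : Integrable (fun y => forward g (Y y)) μ := by
    refine (hiX.sub hi).congr (Eventually.of_forall fun y => ?_)
    simp
  rw [← integral_sub hiX hiY]
  exact abs_integral_le_integral_abs.trans hle

end comp

/-- The increment of the nonlocal term of a density `d ≤ M` is controlled by the deficit
`M - d`. -/
theorem IsMonotoneKernel.integral_sub_le_deficit (hg : IsMonotoneKernel C g) {d : ℝ → ℝ} {M : ℝ}
    (hd : IsDensity M d) {x₁ x₂ : ℝ} (h : x₁ ≤ x₂) :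
    (∫ u, d u * forward g (u - x₂)) - ∫ u, d u * forward g (u - x₁) ≤
      C * (M * (x₂ - x₁) - ∫ u in x₁..x₂, d u) := by
  have i0 : ∀ x, Integrable fun u => forward g (u - x) :=
    fun x => hg.integrable_forward.comp_sub_right x
  have hbd : ∀ᵐ x, ‖d x‖ ≤ M := Eventually.of_forall fun x => by
    rw [Real.norm_of_nonneg (hd.nonneg x)]
    exact hd.le x
  have i1 : ∀ x, Integrable fun u => d u * forward g (u - x) :=
    fun x => (i0 x).bdd_mul hd.measurable.aestronglyMeasurable hbd
  have e0 : ∀ x, ∫ u, forward g (u - x) = 1 := fun x => by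
    rw [integral_sub_right_eq_self (forward g), hg.integral_forward]
  have e1 : (∫ u, d u * forward g (u - x₂)) - ∫ u, d u * forward g (u - x₁) =
      ∫ u, (d u - M) * (forward g (u - x₂) - forward g (u - x₁)) := by
    have : (fun u => (d u - M) * (forward g (u - x₂) - forward g (u - x₁))) = fun u =>
        (d u * forward g (u - x₂) - d u * forward g (u - x₁)) -
          (M * forward g (u - x₂) - M * forward g (u - x₁)) := by
      ext u; ring
    have h2 := integral_sub ((i1 x₂).sub (i1 x₁))
      (((i0 x₂).const_mul M).sub ((i0 x₁).const_mul M))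
    simp only [Pi.sub_apply] at h2
    rw [this, h2, integral_sub (i1 _) (i1 _), integral_sub ((i0 _).const_mul M) ((i0 _).const_mul M),
      integral_const_mul, integral_const_mul, e0, e0]
    ring
  have hdi : IntegrableOn d (Ioc x₁ x₂) :=
    Measure.integrableOn_of_bounded (M := M) (by simp) hd.measurable.aestronglyMeasurable
      (ae_restrict_of_ae hbd)
  have hci : IntegrableOn (fun u => C * (M - d u)) (Ioc x₁ x₂) :=
    ((integrableOn_const (C := M) (by simp)).sub hdi).const_mul C
  have e2 : C * (M * (x₂ - x₁) - ∫ u in x₁..x₂, d u) =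
      ∫ u, (Ioc x₁ x₂).indicator (fun u => C * (M - d u)) u := by
    rw [integral_indicator measurableSet_Ioc, integral_const_mul,
      integral_sub (integrableOn_const (C := M) (by simp)) hdi, intervalIntegral.integral_of_le h]
    simp [h, mul_comm]
  rw [e1, e2]
  refine integral_mono_ae ?_ ((integrable_indicator_iff measurableSet_Ioc).2 hci) ?_
  · refine ((i0 x₂).sub (i0 x₁)).bdd_mul (c := |M| + |M|)
      (hd.measurable.sub_const M).aestronglyMeasurable ?_
    filter_upwards [hbd] with x hx
    exact (norm_sub_le _ _).trans (add_le_add (hx.trans (le_abs_self M)) le_rfl)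
  · refine Eventually.of_forall fun u => ?_
    have hu := hd.le u
    simp only
    by_cases h1 : x₂ < u
    · rw [indicator_of_notMem (by simp [h1]), forward_of_pos (by linarith),
        forward_of_pos (by linarith)]
      have := hg.antitone (show u - x₂ ≤ u - x₁ by linarith)
      exact mul_nonpos_of_nonpos_of_nonneg (by linarith) (by linarith)
    · rw [forward_of_nonpos (by linarith : u - x₂ ≤ 0)]
      by_cases h2 : x₁ < u
      · rw [indicator_of_mem (mem_Ioc.2 ⟨h2, not_lt.1 h1⟩)]
        have := mul_le_mul_of_nonneg_right (hg.forward_le (u - x₁)) (sub_nonneg.2 hu)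
        linarith
      · rw [forward_of_nonpos (by linarith), indicator_of_notMem (by simp [h2])]
        simp

end kernel


/-- Increasing bi-Lipschitz maps that push the measure with density `q` forward to a measure with
density at most `K`. -/
structure IsTransport (a b K : ℝ) (q X : ℝ → ℝ) : Prop where
  pos : 0 < a
  lower : ∀ z y, z ≤ y → a * (y - z) ≤ X y - X z
  upper : ∀ z y, z ≤ y → X y - X z ≤ b * (y - z)
  density_le : ∀ z y, z ≤ y → ∫ x in z..y, q x ≤ K * (X y - X z)

/-- Nonincreasing velocities with values in `[0, L]` and Lipschitz constant `L` on `[0, qmax]`. -/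
structure IsLipschitzVelocity (qmax L : ℝ) (V : ℝ → ℝ) : Prop where
  nonneg : ∀ u ∈ Icc 0 qmax, 0 ≤ V u
  le : ∀ u ∈ Icc 0 qmax, V u ≤ L
  antitone : AntitoneOn V (Icc 0 qmax)
  lipschitz : ∀ u ∈ Icc 0 qmax, ∀ w ∈ Icc 0 qmax, |V u - V w| ≤ L * |u - w|

/-- The nonlocal term in Lagrangian coordinates. -/
noncomputable def lagrangianTerm (g q X : ℝ → ℝ) (z : ℝ) : ℝ :=
  ∫ y, forward g (X y - X z) ∂(densityMeasure q)

section transport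

variable {a b K : ℝ} {q X : ℝ → ℝ}

theorem IsTransport.strictMono (hX : IsTransport a b K q X) : StrictMono X := fun z y h => by
  have := hX.lower z y h.le
  have := mul_pos hX.pos (sub_pos.2 h)
  linarith

theorem IsTransport.bound_pos (hX : IsTransport a b K q X) : 0 < b := by
  have h1 := hX.lower 0 1 zero_le_one
  have h2 := hX.upper 0 1 zero_le_one
  have := hX.pos
  linarith

theorem IsTransport.abs_sub_le (hX : IsTransport a b K q X) (z y : ℝ) :
    |X y - X z| ≤ b * |y - z| := by
  rcases le_total z y with h | h
  · rw [abs_of_nonneg (sub_nonneg.2 (hX.strictMono.monotone h)), abs_of_nonneg (sub_nonneg.2 h)]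
    exact hX.upper z y h
  · rw [abs_sub_comm, abs_of_nonneg (sub_nonneg.2 (hX.strictMono.monotone h)), abs_sub_comm,
      abs_of_nonneg (sub_nonneg.2 h)]
    exact hX.upper y z h

theorem IsTransport.le_abs_sub (hX : IsTransport a b K q X) (z y : ℝ) :
    a * |y - z| ≤ |X y - X z| := by
  rcases le_total z y with h | h
  · rw [abs_of_nonneg (sub_nonneg.2 (hX.strictMono.monotone h)), abs_of_nonneg (sub_nonneg.2 h)]
    exact hX.lower z y h
  · rw [abs_sub_comm (X y), abs_of_nonneg (sub_nonneg.2 (hX.strictMono.monotone h)),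
      abs_sub_comm, abs_of_nonneg (sub_nonneg.2 h)]
    exact hX.lower y z h

theorem IsTransport.continuous (hX : IsTransport a b K q X) : Continuous X := by
  have : LipschitzWith b.toNNReal X := by
    refine LipschitzWith.of_dist_le_mul fun y z => ?_
    rw [Real.dist_eq, Real.dist_eq, Real.coe_toNNReal _ hX.bound_pos.le]
    exact hX.abs_sub_le z y
  exact this.continuous

theorem IsTransport.measurable (hX : IsTransport a b K q X) : Measurable X :=
  hX.continuous.measurable

theorem IsTransport.surjective (hX : IsTransport a b K q X) : Function.Surjective X := by
  refine hX.continuous.surjective ?_ ?_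
  · refine tendsto_atTop_mono' atTop ?_
      (tendsto_atTop_add_const_right atTop (X 0) (tendsto_id.const_mul_atTop hX.pos))
    filter_upwards [eventually_ge_atTop 0] with z hz
    have := hX.lower 0 z hz
    simp only [id]
    linarith
  · refine tendsto_atBot_mono' atBot ?_
      (tendsto_atBot_add_const_right atBot (X 0) (tendsto_id.const_mul_atBot hX.pos))
    filter_upwards [eventually_le_atBot 0] with z hz
    have := hX.lower z 0 hz
    simp only [id]
    linarith

/-- A transport map as an order isomorphism. -/
noncomputable def IsTransport.orderIso (hX : IsTransport a b K q X) : ℝ ≃o ℝ :=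
  hX.strictMono.orderIsoOfSurjective X hX.surjective

@[simp]
theorem IsTransport.coe_orderIso (hX : IsTransport a b K q X) : ⇑hX.orderIso = X :=
  StrictMono.coe_orderIsoOfSurjective _ _ _

theorem IsTransport.map_le (hX : IsTransport a b K q X) (hq : IsDensity K q) :
    (densityMeasure q).map X ≤ ENNReal.ofReal K • volume := by
  have := hq.map_le hq.bound_nonneg hX.orderIso
  rw [hX.coe_orderIso] at this
  exact this hX.density_le

end transport

section speed

variable {a b C L K : ℝ} {q X V g : ℝ → ℝ}

theorem IsTransport.lagrangianTerm_mem (hX : IsTransport a b K q X) (hq : IsDensity K q)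
    (hg : IsMonotoneKernel C g) (z : ℝ) : lagrangianTerm g q X z ∈ Icc 0 K :=
  ⟨hg.integral_comp_nonneg, hg.integral_comp_le hq.bound_nonneg (hX.measurable.sub_const _)
    (map_sub_const_le hX.measurable (hX.map_le hq) _)⟩

theorem IsTransport.abs_lagrangianTerm_sub_le (hX : IsTransport a b K q X) (hq : IsDensity K q)
    (hg : IsMonotoneKernel C g) {Y : ℝ → ℝ} (hY : Measurable Y) {z z' η : ℝ} (hη : 0 ≤ η)
    (h : ∀ y, |(X y - X z) - (Y y - Y z')| ≤ η) :
    |lagrangianTerm g q X z - lagrangianTerm g q Y z'| ≤ K * (4 * C * η) :=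
  hg.abs_integral_sub_le hq.bound_nonneg (hX.measurable.sub_const _) (hY.sub_const _)
    (map_sub_const_le hX.measurable (hX.map_le hq) _) hη h

theorem IsTransport.lagrangianTerm_sub_le (hX : IsTransport a b K q X) (hq : IsDensity K q)
    (hg : IsMonotoneKernel C g) {z y : ℝ} (h : z ≤ y) :
    lagrangianTerm g q X y - lagrangianTerm g q X z ≤
      C * (K * (X y - X z) - ∫ x in z..y, q x) := by
  obtain ⟨hd, hdν⟩ := densityOf_spec hq.bound_nonneg (hX.map_le hq)
  set d := densityOf K ((densityMeasure q).map X)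
  have e1 : ∀ z, lagrangianTerm g q X z = ∫ u, d u * forward g (u - X z) := fun z => by
    have hm : Measurable fun u => forward g (u - X z) :=
      hg.measurable_forward.comp (measurable_id.sub_const _)
    rw [← hd.integral_densityMeasure (fun u => forward g (u - X z)), hdν, integral_map
      hX.measurable.aemeasurable hm.aestronglyMeasurable]
    rfl
  have hXzy := hX.strictMono.monotone h
  have e2 : ∫ u in X z..X y, d u = ∫ x in z..y, q x := by
    have h1 := hd.densityMeasure_Ioc hXzy
    have h2 : X ⁻¹' Ioc (X z) (X y) = Ioc z y := by
      ext x
      simp [hX.strictMono.lt_iff_lt, hX.strictMono.le_iff_le]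
    rw [hdν, Measure.map_apply hX.measurable measurableSet_Ioc, h2, hq.densityMeasure_Ioc h,
      ENNReal.ofReal_eq_ofReal_iff (hq.integral_nonneg h) (hd.integral_nonneg hXzy)] at h1
    exact h1.symm
  rw [e1, e1, ← e2]
  exact hg.integral_sub_le_deficit hd hXzy

theorem IsLipschitzVelocity.sub_le (hV : IsLipschitzVelocity K L V) (hL : 0 ≤ L) {u w η : ℝ}
    (hu : u ∈ Icc 0 K) (hw : w ∈ Icc 0 K) (h : u - w ≤ η) (hη : 0 ≤ η) : V w - V u ≤ L * η := by
  rcases le_total u w with h1 | h1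
  · have := hV.antitone hu hw h1
    have := mul_nonneg hL hη
    linarith
  · have := (le_abs_self _).trans (hV.lipschitz w hw u hu)
    rw [abs_sub_comm, abs_of_nonneg (sub_nonneg.2 h1)] at this
    exact this.trans (mul_le_mul_of_nonneg_left h hL)

theorem IsTransport.abs_speed_sub_le (hX : IsTransport a b K q X) (hq : IsDensity K q)
    (hg : IsMonotoneKernel C g) (hV : IsLipschitzVelocity K L V) (hL : 0 ≤ L) {Y : ℝ → ℝ}
    {a' b' : ℝ} (hY : IsTransport a' b' K q Y) {z z' η : ℝ} (hη : 0 ≤ η)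
    (h : ∀ y, |(X y - X z) - (Y y - Y z')| ≤ η) :
    |V (lagrangianTerm g q X z) - V (lagrangianTerm g q Y z')| ≤ 4 * K * C * L * η := by
  refine (hV.lipschitz _ (hX.lagrangianTerm_mem hq hg z) _ (hY.lagrangianTerm_mem hq hg z')).trans
    ((mul_le_mul_of_nonneg_left (hX.abs_lagrangianTerm_sub_le hq hg hY.measurable hη h)
      hL).trans (le_of_eq (by ring)))

theorem IsTransport.abs_speed_sub_le_self (hX : IsTransport a b K q X) (hq : IsDensity K q)
    (hg : IsMonotoneKernel C g) (hV : IsLipschitzVelocity K L V) (hL : 0 ≤ L) (z z' : ℝ) :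
    |V (lagrangianTerm g q X z) - V (lagrangianTerm g q X z')| ≤ 4 * K * C * L * |X z - X z'| := by
  refine hX.abs_speed_sub_le hq hg hV hL hX (abs_nonneg _) fun y => ?_
  rw [abs_sub_comm (X z)]
  exact (congrArg _ (by ring)).le

end speed


/-- The projection of `ℝ` onto `[0, T]`. -/
noncomputable def clamp (T t : ℝ) : ℝ := max 0 (min T t)

theorem clamp_mem {T : ℝ} (hT : 0 ≤ T) (t : ℝ) : clamp T t ∈ Icc 0 T :=
  ⟨le_max_left _ _, max_le hT (min_le_left _ _)⟩

theorem clamp_of_mem {T t : ℝ} (ht : t ∈ Icc 0 T) : clamp T t = t := by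
  rw [clamp, min_eq_right ht.2, max_eq_right ht.1]

theorem abs_clamp_sub_le (T s t : ℝ) : |clamp T s - clamp T t| ≤ |s - t| := by
  have h1 := abs_max_sub_max_le_abs (min T s) (min T t) 0
  have h2 := abs_min_sub_min_le_max T s T t
  rw [max_comm (min T s), max_comm (min T t)] at h1
  simp only [sub_self, abs_zero] at h2
  exact h1.trans (h2.trans (max_le (abs_nonneg _) le_rfl))

theorem continuous_clamp (T : ℝ) : Continuous (clamp T) := by
  unfold clamp
  fun_prop

/-- The Picard operator, in Duhamel form, of the Lagrangian equation. -/
noncomputable def picardStep (T l : ℝ) (V g q : ℝ → ℝ) (X : ℝ → ℝ → ℝ) (t z : ℝ) : ℝ :=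
  Real.exp (-l * t) * (z + ∫ s in (0 : ℝ)..t, Real.exp (l * s) *
    (l * X (clamp T s) z + V (lagrangianTerm g q (X (clamp T s)) z)))

/-- The properties preserved by the Picard operator. -/
structure IsPicardFlow (T L l K : ℝ) (q : ℝ → ℝ) (X : ℝ → ℝ → ℝ) : Prop where
  transport : ∀ t ∈ Icc 0 T, IsTransport (Real.exp (-l * t)) (Real.exp (l * t)) K q (X t)
  dist : ∀ t ∈ Icc 0 T, ∀ z, |X t z - z| ≤ L * t
  time : ∀ s ∈ Icc 0 T, ∀ t ∈ Icc 0 T, ∀ z, |X s z - X t z| ≤ (2 * l * L * T + L) * |s - t|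

theorem integral_mul_exp (k t : ℝ) :
    ∫ s in (0 : ℝ)..t, k * Real.exp (k * s) = Real.exp (k * t) - 1 := by
  rw [intervalIntegral.integral_eq_sub_of_hasDerivAt (f := fun s => Real.exp (k * s))
    (fun s _ => ?_) ((by fun_prop : Continuous fun s => k * Real.exp (k * s)).intervalIntegrable
      _ _)]
  · simp
  · have := ((hasDerivAt_id s).const_mul k).exp
    simpa [mul_comm] using this

section picard

variable {T C L K : ℝ} {q V g : ℝ → ℝ} {X : ℝ → ℝ → ℝ}

/-- The standing assumptions on the data. -/
structure IsData (T C L K : ℝ) (q V g : ℝ → ℝ) : Prop where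
  time_pos : 0 < T
  bound_pos : 0 ≤ L
  density : IsDensity K q
  velocity : IsLipschitzVelocity K L V
  kernel : IsMonotoneKernel C g

/-- The Lipschitz constant in space of the velocity field. -/
def rate (C L K : ℝ) : ℝ := 4 * K * C * L

theorem IsData.rate_nonneg (h : IsData T C L K q V g) : 0 ≤ rate C L K := by
  have := h.density.bound_nonneg
  have := h.kernel.bound_nonneg
  have := h.bound_pos
  unfold rate
  positivity

theorem IsData.isPicardFlow_id (h : IsData T C L K q V g) :
    IsPicardFlow T L (rate C L K) K q fun _ z => z := by
  have hl := h.rate_nonneg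
  have hL := h.bound_pos
  refine ⟨fun t ht => ⟨Real.exp_pos _, fun z y hzy => ?_, fun z y hzy => ?_, fun z y hzy => ?_⟩,
    fun t ht z => ?_, fun s hs t ht z => ?_⟩
  · refine mul_le_of_le_one_left (sub_nonneg.2 hzy) (Real.exp_le_one_iff.2 ?_)
    have := mul_nonneg hl ht.1
    linarith
  · exact le_mul_of_one_le_left (sub_nonneg.2 hzy) (Real.one_le_exp (mul_nonneg hl ht.1))
  · exact h.density.integral_le hzy
  · simpa using mul_nonneg hL ht.1
  · have := h.time_pos
    simp only [sub_self, abs_zero]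
    positivity

variable (h : IsData T C L K q V g) (hX : IsPicardFlow T L (rate C L K) K q X)

include h hX

theorem IsData.abs_picardSpeed_sub_le {Y : ℝ → ℝ → ℝ} (hY : IsPicardFlow T L (rate C L K) K q Y)
    {s t : ℝ} (hs : s ∈ Icc 0 T) (ht : t ∈ Icc 0 T) {η : ℝ} (hη : 0 ≤ η)
    (hXY : ∀ z, |X s z - Y t z| ≤ η) (z : ℝ) :
    |V (lagrangianTerm g q (X s) z) - V (lagrangianTerm g q (Y t) z)| ≤
      rate C L K * (2 * η) := by
  refine (hX.transport s hs).abs_speed_sub_le h.density h.kernel h.velocity h.bound_pos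
    (hY.transport t ht) (by positivity) fun y => ?_
  have h1 := abs_le.1 (hXY y)
  have h2 := abs_le.1 (hXY z)
  rw [abs_le]
  constructor <;> linarith [h1.1, h1.2, h2.1, h2.2]

theorem IsData.picardSpeed_mem {t : ℝ} (ht : t ∈ Icc 0 T) (z : ℝ) :
    V (lagrangianTerm g q (X t) z) ∈ Icc 0 L :=
  ⟨h.velocity.nonneg _ ((hX.transport t ht).lagrangianTerm_mem h.density h.kernel z),
    h.velocity.le _ ((hX.transport t ht).lagrangianTerm_mem h.density h.kernel z)⟩

theorem IsData.continuous_picard (z : ℝ) :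
    Continuous (fun s => X (clamp T s) z) ∧
      Continuous fun s => V (lagrangianTerm g q (X (clamp T s)) z) := by
  have hT := h.time_pos.le
  have hl := h.rate_nonneg
  have hL := h.bound_pos
  set B := 2 * rate C L K * L * T + L
  have hB : 0 ≤ B := by positivity
  have key : ∀ s t, ∀ z, |X (clamp T s) z - X (clamp T t) z| ≤ B * |s - t| := fun s t z =>
    (hX.time _ (clamp_mem hT s) _ (clamp_mem hT t) z).trans
      (mul_le_mul_of_nonneg_left (abs_clamp_sub_le T s t) hB)
  constructor
  · refine (LipschitzWith.of_dist_le_mul (K := B.toNNReal) fun s t => ?_).continuous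
    rw [Real.dist_eq, Real.dist_eq, Real.coe_toNNReal _ hB]
    exact key s t z
  · have hB' : 0 ≤ rate C L K * (2 * B) := by positivity
    refine (LipschitzWith.of_dist_le_mul (K := (rate C L K * (2 * B)).toNNReal)
      fun s t => ?_).continuous
    rw [Real.dist_eq, Real.dist_eq, Real.coe_toNNReal _ hB']
    refine (h.abs_picardSpeed_sub_le hX hX (clamp_mem hT s) (clamp_mem hT t)
      (by positivity) (key s t) z).trans (le_of_eq (by ring))

theorem IsData.continuous_picardIntegrand (z : ℝ) :
    Continuous fun s => Real.exp (rate C L K * s) *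
      (rate C L K * X (clamp T s) z + V (lagrangianTerm g q (X (clamp T s)) z)) := by
  obtain ⟨h1, h2⟩ := h.continuous_picard hX z
  exact (by fun_prop : Continuous fun s => Real.exp (rate C L K * s)).mul
    ((h1.const_mul _).add h2)

theorem IsData.hasDerivAt_picardStep (t z : ℝ) :
    HasDerivAt (fun t => picardStep T (rate C L K) V g q X t z)
      (rate C L K * (X (clamp T t) z - picardStep T (rate C L K) V g q X t z) +
        V (lagrangianTerm g q (X (clamp T t)) z)) t := by
  have h1 := (h.continuous_picardIntegrand hX z).integral_hasStrictDerivAt 0 t |>.hasDerivAt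
  have h2 := ((hasDerivAt_id t).const_mul (-rate C L K)).exp.mul (h1.const_add z)
  refine h2.congr_deriv ?_
  have h3 : Real.exp (-rate C L K * t) * Real.exp (rate C L K * t) = 1 := by
    rw [← Real.exp_add]; simp
  simp only [id, picardStep]
  linear_combination (rate C L K * X (clamp T t) z +
    V (lagrangianTerm g q (X (clamp T t)) z)) * h3

theorem IsData.picardStep_sub (t z y : ℝ) :
    picardStep T (rate C L K) V g q X t y - picardStep T (rate C L K) V g q X t z =
      Real.exp (-rate C L K * t) * ((y - z) + ∫ s in (0 : ℝ)..t, Real.exp (rate C L K * s) *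
        (rate C L K * (X (clamp T s) y - X (clamp T s) z) +
        (V (lagrangianTerm g q (X (clamp T s)) y) -
          V (lagrangianTerm g q (X (clamp T s)) z)))) := by
  have := intervalIntegral.integral_sub
    ((h.continuous_picardIntegrand hX y).intervalIntegrable (μ := volume) 0 t)
    ((h.continuous_picardIntegrand hX z).intervalIntegrable 0 t)
  rw [picardStep, picardStep, ← mul_sub, add_sub_add_comm, ← this]
  congr 3
  ext s
  ring

theorem IsData.isTransport_picardStep {t : ℝ} (ht : t ∈ Icc 0 T) :
    IsTransport (Real.exp (-rate C L K * t)) (Real.exp (rate C L K * t)) K q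
      (picardStep T (rate C L K) V g q X t) := by
  have hl := h.rate_nonneg
  have hK := h.density.bound_nonneg
  set l := rate C L K with hl_def
  have hcont : ∀ z y, Continuous fun s => Real.exp (l * s) *
        (l * (X (clamp T s) y - X (clamp T s) z) +
        (V (lagrangianTerm g q (X (clamp T s)) y) -
          V (lagrangianTerm g q (X (clamp T s)) z))) := fun z y => by
    obtain ⟨h1, h2⟩ := h.continuous_picard hX z
    obtain ⟨h3, h4⟩ := h.continuous_picard hX y
    exact (by fun_prop : Continuous fun s => Real.exp (l * s)).mul
      (((h3.sub h1).const_mul _).add (h4.sub h2))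
  have hdiff : ∀ s ∈ Icc 0 t, ∀ z y, z ≤ y →
      |V (lagrangianTerm g q (X (clamp T s)) y) - V (lagrangianTerm g q (X (clamp T s)) z)| ≤
        l * (X (clamp T s) y - X (clamp T s) z) := fun s hs z y hzy => by
    have hs' : s ∈ Icc 0 T := ⟨hs.1, hs.2.trans ht.2⟩
    rw [clamp_of_mem hs']
    have h1 := (hX.transport s hs').abs_speed_sub_le_self h.density h.kernel h.velocity
      h.bound_pos y z
    rwa [abs_of_nonneg (sub_nonneg.2 ((hX.transport s hs').strictMono.monotone hzy))] at h1
  have hexp : Real.exp (-l * t) * Real.exp (l * t) = 1 := by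
    rw [← Real.exp_add]; simp
  refine ⟨Real.exp_pos _, fun z y hzy => ?_, fun z y hzy => ?_, fun z y hzy => ?_⟩
  · rw [h.picardStep_sub hX]
    refine mul_le_mul_of_nonneg_left ?_ (Real.exp_pos _).le
    refine le_add_of_nonneg_right (intervalIntegral.integral_nonneg ht.1 fun s hs => ?_)
    have := abs_le.1 (hdiff s hs z y hzy)
    exact mul_nonneg (Real.exp_pos _).le (by linarith [this.1])
  · rw [h.picardStep_sub hX]
    have h1 : (∫ s in (0 : ℝ)..t, Real.exp (l * s) *
        (l * (X (clamp T s) y - X (clamp T s) z) +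
        (V (lagrangianTerm g q (X (clamp T s)) y) -
          V (lagrangianTerm g q (X (clamp T s)) z)))) ≤
        ∫ s in (0 : ℝ)..t, (2 * l * Real.exp (2 * l * s)) * (y - z) := by
      refine intervalIntegral.integral_mono_on ht.1 ((hcont z y).intervalIntegrable _ _)
        ((by fun_prop : Continuous fun s =>
          (2 * l * Real.exp (2 * l * s)) * (y - z)).intervalIntegrable _ _) fun s hs => ?_
      have h2 := abs_le.1 (hdiff s hs z y hzy)
      have hs' : s ∈ Icc 0 T := ⟨hs.1, hs.2.trans ht.2⟩
      have h3 := (hX.transport s hs').upper z y hzy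
      rw [clamp_of_mem hs'] at h2 ⊢
      have h4 : Real.exp (2 * l * s) = Real.exp (l * s) * Real.exp (l * s) := by
        rw [← Real.exp_add]; ring_nf
      rw [h4]
      calc _ ≤ Real.exp (l * s) * (2 * l * (Real.exp (l * s) * (y - z))) := by
            refine mul_le_mul_of_nonneg_left ?_ (Real.exp_pos _).le
            have := mul_le_mul_of_nonneg_left h3 hl
            linarith [h2.2]
        _ = _ := by ring
    rw [intervalIntegral.integral_mul_const, integral_mul_exp] at h1
    have h4 : Real.exp (2 * l * t) = Real.exp (l * t) * Real.exp (l * t) := by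
      rw [← Real.exp_add]; ring_nf
    calc _ ≤ Real.exp (-l * t) * ((y - z) + (Real.exp (2 * l * t) - 1) * (y - z)) := by
          gcongr
      _ = _ := by
          rw [h4]
          linear_combination Real.exp (l * t) * (y - z) * hexp
  · rw [h.picardStep_sub hX]
    have hm := h.density.integral_le hzy
    set m := ∫ x in z..y, q x
    have h1 : ∫ s in (0 : ℝ)..t, (l * Real.exp (l * s)) * m ≤
        ∫ s in (0 : ℝ)..t, K * (Real.exp (l * s) *
        (l * (X (clamp T s) y - X (clamp T s) z) +
        (V (lagrangianTerm g q (X (clamp T s)) y) -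
          V (lagrangianTerm g q (X (clamp T s)) z)))) := by
      refine intervalIntegral.integral_mono_on ht.1
        ((by fun_prop : Continuous fun s => (l * Real.exp (l * s)) * m).intervalIntegrable _ _)
        (((hcont z y).const_mul K).intervalIntegrable _ _) fun s hs => ?_
      have hs' : s ∈ Icc 0 T := ⟨hs.1, hs.2.trans ht.2⟩
      rw [clamp_of_mem hs']
      have hXs := hX.transport s hs'
      have h2 := hXs.density_le z y hzy
      have hC := h.kernel.bound_nonneg
      have hL := h.bound_pos
      have h3 := h.velocity.sub_le hL (hXs.lagrangianTerm_mem h.density h.kernel y)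
        (hXs.lagrangianTerm_mem h.density h.kernel z)
        (hXs.lagrangianTerm_sub_le h.density h.kernel hzy)
        (mul_nonneg hC (by linarith))
      have h5 : 0 ≤ K * (L * C) * (K * (X s y - X s z) - m) :=
        mul_nonneg (by positivity) (by linarith)
      have h6 : K * (V (lagrangianTerm g q (X s) z) - V (lagrangianTerm g q (X s) y)) ≤
          K * (L * C) * (K * (X s y - X s z) - m) :=
        (mul_le_mul_of_nonneg_left h3 hK).trans (le_of_eq (by ring))
      have h7 : l * m ≤ K * (l * (X s y - X s z) +
        (V (lagrangianTerm g q (X s) y) - V (lagrangianTerm g q (X s) z))) := by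
        have : l * (K * (X s y - X s z) - m) = 4 * (K * (L * C) * (K * (X s y - X s z) - m)) := by
          rw [hl_def, rate]; ring
        linarith
      calc _ = Real.exp (l * s) * (l * m) := by ring
        _ ≤ _ := mul_le_mul_of_nonneg_left h7 (Real.exp_pos _).le
        _ = _ := by ring
    rw [intervalIntegral.integral_mul_const, integral_mul_exp,
      intervalIntegral.integral_const_mul] at h1
    calc m = Real.exp (-l * t) * (m + (Real.exp (l * t) - 1) * m) := by
          linear_combination -m * hexp
      _ ≤ Real.exp (-l * t) * (K * (y - z) + K * _) := by gcongr
      _ = _ := by ring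

theorem IsData.isPicardFlow_picardStep :
    IsPicardFlow T L (rate C L K) K q (picardStep T (rate C L K) V g q X) := by
  have hl := h.rate_nonneg
  have hL := h.bound_pos
  have hT := h.time_pos
  have hdist : ∀ t ∈ Icc 0 T, ∀ z, |picardStep T (rate C L K) V g q X t z - z| ≤ L * t := by
    intro t ht z
    set l := rate C L K with hl_def
    have hexp : Real.exp (-l * t) * Real.exp (l * t) = 1 := by
      rw [← Real.exp_add]; simp
    have i1 := (h.continuous_picardIntegrand hX z).intervalIntegrable (μ := volume) 0 t
    have i2 := (by fun_prop : Continuous fun s =>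
      (l * Real.exp (l * s)) * z).intervalIntegrable (μ := volume) 0 t
    have e1 : picardStep T l V g q X t z - z = Real.exp (-l * t) *
        ((∫ s in (0 : ℝ)..t, Real.exp (l * s) *
          (l * X (clamp T s) z + V (lagrangianTerm g q (X (clamp T s)) z))) -
          ∫ s in (0 : ℝ)..t, (l * Real.exp (l * s)) * z) := by
      rw [intervalIntegral.integral_mul_const, integral_mul_exp, picardStep]
      linear_combination z * hexp
    have e2 : ∫ s in (0 : ℝ)..t, Real.exp (l * s) * (l * (L * s) + L) =
        L * (t * Real.exp (l * t)) := by
      rw [intervalIntegral.integral_eq_sub_of_hasDerivAt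
        (f := fun s => L * (s * Real.exp (l * s))) (fun s _ => ?_)
        ((by fun_prop : Continuous fun s =>
          Real.exp (l * s) * (l * (L * s) + L)).intervalIntegrable _ _)]
      · simp
      · have := ((hasDerivAt_id s).mul ((hasDerivAt_id s).const_mul l).exp).const_mul L
        refine this.congr_deriv ?_
        simp only [id]
        ring
    have h2 : ‖(∫ s in (0 : ℝ)..t, Real.exp (l * s) *
          (l * X (clamp T s) z + V (lagrangianTerm g q (X (clamp T s)) z))) -
          ∫ s in (0 : ℝ)..t, (l * Real.exp (l * s)) * z‖ ≤ L * (t * Real.exp (l * t)) := by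
      rw [← e2, ← intervalIntegral.integral_sub i1 i2]
      refine intervalIntegral.norm_integral_le_of_norm_le ht.1 ?_
        ((by fun_prop : Continuous fun s =>
          Real.exp (l * s) * (l * (L * s) + L)).intervalIntegrable _ _)
      refine Eventually.of_forall fun s hs => ?_
      have hs' : s ∈ Icc 0 T := ⟨hs.1.le, hs.2.trans ht.2⟩
      rw [clamp_of_mem hs', Real.norm_eq_abs]
      have h3 := abs_le.1 (hX.dist s hs' z)
      have h4 := h.picardSpeed_mem hX hs' z
      have e3 : Real.exp (l * s) * (l * X s z + V (lagrangianTerm g q (X s) z)) -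
          l * Real.exp (l * s) * z =
          Real.exp (l * s) * (l * (X s z - z) + V (lagrangianTerm g q (X s) z)) := by ring
      rw [e3, abs_mul, Real.abs_exp]
      refine mul_le_mul_of_nonneg_left ?_ (Real.exp_pos _).le
      have h5 := mul_le_mul_of_nonneg_left h3.1 hl
      have h6 := mul_le_mul_of_nonneg_left h3.2 hl
      rw [abs_le]
      constructor <;> linarith [h4.1, h4.2]
    rw [e1, abs_mul, Real.abs_exp]
    calc _ ≤ Real.exp (-l * t) * (L * (t * Real.exp (l * t))) :=
          mul_le_mul_of_nonneg_left h2 (Real.exp_pos _).le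
      _ = L * t := by linear_combination L * t * hexp
  refine ⟨fun t ht => h.isTransport_picardStep hX ht, hdist, fun s hs t ht z => ?_⟩
  refine (convex_Icc 0 T).norm_image_sub_le_of_norm_hasDerivWithin_le
    (f := fun t => picardStep T (rate C L K) V g q X t z)
    (fun r _ => (h.hasDerivAt_picardStep hX r z).hasDerivWithinAt) (fun r hr => ?_) ht hs
  rw [clamp_of_mem hr, Real.norm_eq_abs]
  have h1 := abs_le.1 (hdist r hr z)
  have h2 := abs_le.1 (hX.dist r hr z)
  have h3 := h.picardSpeed_mem hX hr z
  have h4 : L * r ≤ L * T := mul_le_mul_of_nonneg_left hr.2 hL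
  have h5 : |X r z - picardStep T (rate C L K) V g q X r z| ≤ 2 * L * T := by
    rw [abs_le]
    constructor <;> linarith [h1.1, h1.2, h2.1, h2.2]
  refine (abs_add_le _ _).trans (add_le_add ?_ ?_)
  · rw [abs_mul, abs_of_nonneg hl]
    exact (mul_le_mul_of_nonneg_left h5 hl).trans (le_of_eq (by ring))
  · rw [abs_of_nonneg h3.1]
    exact h3.2

theorem IsData.abs_picardStep_sub_le {Y : ℝ → ℝ → ℝ} (hY : IsPicardFlow T L (rate C L K) K q Y)
    {A : ℝ} (hA : 0 ≤ A)
    (hXY : ∀ t ∈ Icc 0 T, ∀ z, |X t z - Y t z| ≤ A * Real.exp ((6 * rate C L K + 1) * t))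
    {t : ℝ} (ht : t ∈ Icc 0 T) (z : ℝ) :
    |picardStep T (rate C L K) V g q X t z - picardStep T (rate C L K) V g q Y t z| ≤
      A / 2 * Real.exp ((6 * rate C L K + 1) * t) := by
  have hl := h.rate_nonneg
  set l := rate C L K with hl_def
  set k := 6 * l + 1 with hk
  have e1 : picardStep T l V g q X t z - picardStep T l V g q Y t z =
      Real.exp (-l * t) * ∫ s in (0 : ℝ)..t, (Real.exp (l * s) *
        (l * X (clamp T s) z + V (lagrangianTerm g q (X (clamp T s)) z)) - Real.exp (l * s) *
        (l * Y (clamp T s) z + V (lagrangianTerm g q (Y (clamp T s)) z))) := by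
    rw [intervalIntegral.integral_sub ((h.continuous_picardIntegrand hX z).intervalIntegrable _ _)
      ((h.continuous_picardIntegrand hY z).intervalIntegrable _ _), picardStep, picardStep]
    ring
  have h2 : ‖∫ s in (0 : ℝ)..t, (Real.exp (l * s) *
        (l * X (clamp T s) z + V (lagrangianTerm g q (X (clamp T s)) z)) - Real.exp (l * s) *
        (l * Y (clamp T s) z + V (lagrangianTerm g q (Y (clamp T s)) z)))‖ ≤
      ∫ s in (0 : ℝ)..t, (Real.exp (l * t) * (A / 2)) * (k * Real.exp (k * s)) := by
    refine intervalIntegral.norm_integral_le_of_norm_le ht.1 ?_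
        ((by fun_prop : Continuous fun s =>
          (Real.exp (l * t) * (A / 2)) * (k * Real.exp (k * s))).intervalIntegrable _ _)
    refine Eventually.of_forall fun s hs => ?_
    have hs' : s ∈ Icc 0 T := ⟨hs.1.le, hs.2.trans ht.2⟩
    rw [clamp_of_mem hs', Real.norm_eq_abs, ← mul_sub, abs_mul, Real.abs_exp]
    have h3 := h.abs_picardSpeed_sub_le hX hY hs' hs' (by positivity) (hXY s hs') z
    have h4 := mul_le_mul_of_nonneg_left (hXY s hs' z) hl
    rw [← abs_of_nonneg hl, ← abs_mul, abs_of_nonneg hl] at h4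
    have h5 : |l * X s z + V (lagrangianTerm g q (X s) z) -
        (l * Y s z + V (lagrangianTerm g q (Y s) z))| ≤ A / 2 * (k * Real.exp (k * s)) := by
      rw [add_sub_add_comm, ← mul_sub]
      refine (abs_add_le _ _).trans ((add_le_add h4 h3).trans ?_)
      have : 0 ≤ A * Real.exp (k * s) := by positivity
      have e : A / 2 * (k * Real.exp (k * s)) = 3 * l * (A * Real.exp (k * s)) +
        (A * Real.exp (k * s)) / 2 := by rw [hk]; ring
      rw [e]
      linarith
    calc _ ≤ Real.exp (l * t) * (A / 2 * (k * Real.exp (k * s))) := by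
          refine mul_le_mul ?_ h5 (abs_nonneg _) (Real.exp_pos _).le
          exact Real.exp_le_exp.2 (mul_le_mul_of_nonneg_left hs.2 hl)
      _ = _ := by ring
  rw [intervalIntegral.integral_const_mul, integral_mul_exp] at h2
  have hexp : Real.exp (-l * t) * Real.exp (l * t) = 1 := by
    rw [← Real.exp_add]; simp
  rw [e1, abs_mul, Real.abs_exp]
  calc _ ≤ Real.exp (-l * t) * (Real.exp (l * t) * (A / 2) * (Real.exp (k * t) - 1)) :=
        mul_le_mul_of_nonneg_left h2 (Real.exp_pos _).le
    _ = A / 2 * (Real.exp (k * t) - 1) := by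
        linear_combination A / 2 * (Real.exp (k * t) - 1) * hexp
    _ ≤ _ := by linarith

end picard


section gronwall

variable {T L : ℝ} {d d' : ℝ → ℝ}

theorem abs_le_exp_mul_abs (hd : ∀ t ∈ Icc 0 T, HasDerivWithinAt d (d' t) (Icc 0 T) t)
    (hd' : ∀ t ∈ Icc 0 T, |d' t| ≤ L * |d t|) {s t : ℝ} (hs : s ∈ Icc 0 T) (ht : t ∈ Icc 0 T) :
    |d s| ≤ Real.exp (L * |s - t|) * |d t| := by
  have hder : ∀ c, ∀ t ∈ Icc 0 T, HasDerivWithinAt (fun t => d t ^ 2 * Real.exp (c * t))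
      ((2 * (d t * d' t) + c * d t ^ 2) * Real.exp (c * t)) (Icc 0 T) t := fun c t ht => by
    have := ((hd t ht).pow 2).mul ((hasDerivAt_id t).const_mul c).exp.hasDerivWithinAt
    refine this.congr_deriv ?_
    simp only [id, Nat.cast_ofNat, Pi.pow_apply]
    ring
  have hprod : ∀ t ∈ Icc 0 T, |d t * d' t| ≤ L * d t ^ 2 := fun t ht => by
    rw [abs_mul, ← sq_abs (d t)]
    have := mul_le_mul_of_nonneg_left (hd' t ht) (abs_nonneg (d t))
    linarith
  have hcont : ∀ c, ContinuousOn (fun t => d t ^ 2 * Real.exp (c * t)) (Icc 0 T) :=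
    fun c t ht => (hder c t ht).continuousWithinAt
  have hmono : MonotoneOn (fun t => d t ^ 2 * Real.exp (2 * L * t)) (Icc 0 T) :=
    monotoneOn_of_hasDerivWithinAt_nonneg (convex_Icc 0 T) (hcont _)
      (fun t ht => (hder _ t (interior_subset ht)).mono interior_subset) fun t ht => by
        have := abs_le.1 (hprod t (interior_subset ht))
        exact mul_nonneg (by linarith [this.1]) (Real.exp_pos _).le
  have hanti : AntitoneOn (fun t => d t ^ 2 * Real.exp (-(2 * L) * t)) (Icc 0 T) :=
    antitoneOn_of_hasDerivWithinAt_nonpos (convex_Icc 0 T) (hcont _)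
      (fun t ht => (hder _ t (interior_subset ht)).mono interior_subset) fun t ht => by
        have := abs_le.1 (hprod t (interior_subset ht))
        exact mul_nonpos_of_nonpos_of_nonneg (by linarith [this.2]) (Real.exp_pos _).le
  rw [← abs_of_pos (Real.exp_pos (L * |s - t|)), ← abs_mul]
  refine sq_le_sq.1 ?_
  rw [mul_pow, ← Real.exp_nat_mul]
  push_cast
  rcases le_total s t with h | h
  · have h1 := hmono hs ht h
    simp only at h1
    rw [abs_sub_comm, abs_of_nonneg (sub_nonneg.2 h)]
    have e : Real.exp (2 * (L * (t - s))) * Real.exp (2 * L * s) = Real.exp (2 * L * t) := by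
      rw [← Real.exp_add]; ring_nf
    refine le_of_mul_le_mul_right ?_ (Real.exp_pos (2 * L * s))
    calc _ ≤ _ := h1
      _ = _ := by rw [← e]; ring
  · have h1 := hanti ht hs h
    simp only at h1
    rw [abs_of_nonneg (sub_nonneg.2 h)]
    have e : Real.exp (2 * (L * (s - t))) * Real.exp (-(2 * L) * s) =
        Real.exp (-(2 * L) * t) := by
      rw [← Real.exp_add]; ring_nf
    refine le_of_mul_le_mul_right ?_ (Real.exp_pos (-(2 * L) * s))
    calc _ ≤ _ := h1
      _ = _ := by rw [← e]; ring

theorem nonneg_of_abs_deriv_le (hd : ∀ t ∈ Icc 0 T, HasDerivWithinAt d (d' t) (Icc 0 T) t)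
    (hd' : ∀ t ∈ Icc 0 T, |d' t| ≤ L * |d t|) (h0 : 0 ≤ d 0) {t : ℝ} (ht : t ∈ Icc 0 T) :
    0 ≤ d t := by
  by_contra! hneg
  have h0' : (0 : ℝ) ∈ Icc 0 T := ⟨le_rfl, ht.1.trans ht.2⟩
  have hsub : Icc 0 t ⊆ Icc 0 T := Icc_subset_Icc_right ht.2
  have hcont : ContinuousOn d (Icc 0 t) :=
    fun s hs => ((hd s (hsub hs)).continuousWithinAt).mono hsub
  obtain ⟨c, hc, hdc⟩ := intermediate_value_Icc' ht.1 hcont ⟨hneg.le, h0⟩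
  have := abs_le_exp_mul_abs hd hd' ht (hsub hc)
  rw [hdc, abs_zero, mul_zero] at this
  exact hneg.ne (abs_nonpos_iff.1 this)

end gronwall

/-- Flows of bi-Lipschitz maps of `ℝ`, Lipschitz in time with constant `L` and expanding or
contracting distances at most at the exponential rate `l`. -/
structure IsLipschitzFlow (T L l : ℝ) (X : ℝ → ℝ → ℝ) : Prop where
  init : ∀ z, X 0 z = z
  time : ∀ s ∈ Icc 0 T, ∀ t ∈ Icc 0 T, ∀ z, |X s z - X t z| ≤ L * |s - t|
  space : ∀ s ∈ Icc 0 T, ∀ t ∈ Icc 0 T, ∀ z y, z ≤ y →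
    X s y - X s z ≤ Real.exp (l * |s - t|) * (X t y - X t z)

/-- Flows solving the Lagrangian form of the conservation law with initial datum `q`. -/
structure IsLagrangianFlow (T L l K : ℝ) (q V g : ℝ → ℝ) (X : ℝ → ℝ → ℝ) : Prop extends
    IsLipschitzFlow T L l X where
  density_le : ∀ t ∈ Icc 0 T, ∀ z y, z ≤ y → ∫ x in z..y, q x ≤ K * (X t y - X t z)
  deriv : ∀ t ∈ Icc 0 T, ∀ z,
    HasDerivWithinAt (fun s => X s z) (V (lagrangianTerm g q (X t) z)) (Icc 0 T) t

theorem isLipschitzFlow_of_hasDerivWithinAt {T L l : ℝ} {X v : ℝ → ℝ → ℝ}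
    (h0 : ∀ z, X 0 z = z)
    (hX : ∀ t ∈ Icc 0 T, ∀ z, HasDerivWithinAt (fun s => X s z) (v t z) (Icc 0 T) t)
    (hv : ∀ t ∈ Icc 0 T, ∀ z, |v t z| ≤ L)
    (hv' : ∀ t ∈ Icc 0 T, ∀ z y, |v t y - v t z| ≤ l * |X t y - X t z|) :
    IsLipschitzFlow T L l X := by
  refine ⟨h0, fun s hs t ht z => ?_, fun s hs t ht z y hzy => ?_⟩
  · exact (convex_Icc 0 T).norm_image_sub_le_of_norm_hasDerivWithin_le
      (fun r hr => hX r hr z) (fun r hr => hv r hr z) ht hs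
  · have hd : ∀ t ∈ Icc 0 T, HasDerivWithinAt (fun t => X t y - X t z) (v t y - v t z)
        (Icc 0 T) t := fun t ht => (hX t ht y).sub (hX t ht z)
    have hd' := fun t ht => hv' t ht z y
    have hnn : 0 ≤ X t y - X t z :=
      nonneg_of_abs_deriv_le hd hd' (by rw [h0, h0]; exact sub_nonneg.2 hzy) ht
    have := abs_le_exp_mul_abs hd hd' hs ht
    rw [abs_of_nonneg hnn] at this
    exact (le_abs_self _).trans this

theorem IsData.exists_lagrangianFlow {T C L K : ℝ} {q V g : ℝ → ℝ} (h : IsData T C L K q V g) :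
    ∃ X, IsLagrangianFlow T L (rate C L K) K q V g X := by
  have hT := h.time_pos
  have hl := h.rate_nonneg
  have hL := h.bound_pos
  set l := rate C L K with hl_def
  set k := 6 * l + 1 with hk
  let Z : ℕ → ℝ → ℝ → ℝ := fun n => (picardStep T l V g q)^[n] fun _ z => z
  have hZs : ∀ n, Z (n + 1) = picardStep T l V g q (Z n) := fun n =>
    Function.iterate_succ_apply' _ _ _
  have hZ : ∀ n, IsPicardFlow T L l K q (Z n) := fun n => by
    induction n with
    | zero => exact h.isPicardFlow_id
    | succ n ih => rw [hZs]; exact h.isPicardFlow_picardStep ih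
  set A := L * T with hA
  have hA0 : 0 ≤ A := by positivity
  have hstep : ∀ n, ∀ t ∈ Icc 0 T, ∀ z,
      |Z n t z - Z (n + 1) t z| ≤ A / 2 ^ n * Real.exp (k * t) := fun n => by
    induction n with
    | zero =>
      intro t ht z
      have h1 := (hZ 1).dist t ht z
      have h2 : L * t ≤ A := mul_le_mul_of_nonneg_left ht.2 hL
      have h3 : 1 ≤ Real.exp (k * t) := Real.one_le_exp (mul_nonneg (by positivity) ht.1)
      change |z - Z 1 t z| ≤ _
      rw [abs_sub_comm, pow_zero, div_one]
      exact h1.trans (h2.trans (le_mul_of_one_le_right hA0 h3))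
    | succ n ih =>
      intro t ht z
      have := h.abs_picardStep_sub_le (hZ n) (hZ (n + 1)) (by positivity) ih ht z
      rwa [← hl_def, ← hZs n, ← hZs (n + 1), div_div, ← pow_succ] at this
  have hbd : ∀ t ∈ Icc 0 T, Real.exp (k * t) ≤ Real.exp (k * T) := fun t ht =>
    Real.exp_le_exp.2 (mul_le_mul_of_nonneg_left ht.2 (by positivity))
  have hstep' : ∀ t ∈ Icc 0 T, ∀ z n,
      dist (Z n t z) (Z (n + 1) t z) ≤ A * Real.exp (k * T) * (1 / 2) ^ n := fun t ht z n => by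
    refine (hstep n t ht z).trans ?_
    calc _ ≤ A / 2 ^ n * Real.exp (k * T) := by have := hbd t ht; gcongr
      _ = _ := by rw [one_div, inv_pow]; ring
  have hlim : ∀ t z, ∃ x, t ∈ Icc 0 T → Tendsto (fun n => Z n t z) atTop (𝓝 x) := fun t z => by
    by_cases ht : t ∈ Icc 0 T
    · obtain ⟨x, hx⟩ := cauchySeq_tendsto_of_complete
        (cauchySeq_of_le_geometric (1 / 2) _ (by norm_num) (hstep' t ht z))
      exact ⟨x, fun _ => hx⟩
    · exact ⟨0, fun h => absurd h ht⟩
  choose X hX using hlim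
  have hXlim : ∀ t ∈ Icc 0 T, ∀ z, Tendsto (fun n => Z n t z) atTop (𝓝 (X t z)) :=
    fun t ht z => hX t z ht
  have hdist : ∀ n, ∀ t ∈ Icc 0 T, ∀ z,
      |Z n t z - X t z| ≤ 2 * (A * Real.exp (k * T)) * (1 / 2) ^ n := fun n t ht z => by
    have := dist_le_of_le_geometric_of_tendsto (1 / 2) _ (by norm_num) (hstep' t ht z)
      (hXlim t ht z) n
    refine this.trans (le_of_eq ?_)
    ring
  have hXP : IsPicardFlow T L l K q X := by
    refine ⟨fun t ht => ⟨Real.exp_pos _, fun z y hzy => ?_, fun z y hzy => ?_, fun z y hzy => ?_⟩,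
      fun t ht z => ?_, fun s hs t ht z => ?_⟩
    · exact ge_of_tendsto' ((hXlim t ht y).sub (hXlim t ht z))
        fun n => ((hZ n).transport t ht).lower z y hzy
    · exact le_of_tendsto' ((hXlim t ht y).sub (hXlim t ht z))
        fun n => ((hZ n).transport t ht).upper z y hzy
    · exact ge_of_tendsto' (((hXlim t ht y).sub (hXlim t ht z)).const_mul K)
        fun n => ((hZ n).transport t ht).density_le z y hzy
    · exact le_of_tendsto' ((hXlim t ht z).sub_const z).abs fun n => (hZ n).dist t ht z
    · exact le_of_tendsto' ((hXlim s hs z).sub (hXlim t ht z)).abs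
        fun n => (hZ n).time s hs t ht z
  have hfix : ∀ t ∈ Icc 0 T, ∀ z, X t z = picardStep T l V g q X t z := fun t ht z => by
    have hAn : Tendsto (fun n : ℕ => 2 * (A * Real.exp (k * T)) * (1 / 2 : ℝ) ^ n) atTop
        (𝓝 0) := by
      have := (tendsto_pow_atTop_nhds_zero_of_lt_one (r := (1 / 2 : ℝ)) (by norm_num)
        (by norm_num)).const_mul (2 * (A * Real.exp (k * T)))
      simpa using this
    have h1 : ∀ n, |Z (n + 1) t z - picardStep T l V g q X t z| ≤
        2 * (A * Real.exp (k * T)) * (1 / 2) ^ n / 2 * Real.exp (k * t) := fun n => by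
      rw [hZs]
      refine h.abs_picardStep_sub_le (hZ n) hXP (by positivity) (fun s hs y => ?_) ht z
      exact (hdist n s hs y).trans (le_mul_of_one_le_right (by positivity)
        (Real.one_le_exp (mul_nonneg (by positivity) hs.1)))
    have h2 : Tendsto (fun n => Z (n + 1) t z) atTop (𝓝 (picardStep T l V g q X t z)) := by
      refine tendsto_iff_dist_tendsto_zero.2 (squeeze_zero (fun _ => dist_nonneg) h1 ?_)
      have := (hAn.div_const 2).mul_const (Real.exp (k * t))
      simpa using this
    exact tendsto_nhds_unique ((tendsto_add_atTop_iff_nat 1).2 (hXlim t ht z)) h2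
  have h0 : ∀ z, X 0 z = z := fun z => by
    rw [hfix 0 ⟨le_rfl, hT.le⟩ z, picardStep]
    simp
  have hderiv : ∀ t ∈ Icc 0 T, ∀ z,
      HasDerivWithinAt (fun s => X s z) (V (lagrangianTerm g q (X t) z)) (Icc 0 T) t := by
    intro t ht z
    have h1 := (h.hasDerivAt_picardStep hXP t z).hasDerivWithinAt (s := Icc 0 T)
    rw [clamp_of_mem ht, ← hfix t ht z, sub_self, mul_zero, zero_add] at h1
    exact h1.congr (fun s hs => hfix s hs z) (hfix t ht z)
  refine ⟨X, isLipschitzFlow_of_hasDerivWithinAt h0 hderiv (fun t ht z => ?_)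
    (fun t ht z y => ?_), fun t ht => (hXP.transport t ht).density_le, hderiv⟩
  · have := h.picardSpeed_mem hXP ht z
    rw [abs_of_nonneg this.1]
    exact this.2
  · exact (hXP.transport t ht).abs_speed_sub_le_self h.density h.kernel h.velocity hL y z

section flow

variable {T L l K : ℝ} {q V g : ℝ → ℝ} {X : ℝ → ℝ → ℝ}

theorem IsLipschitzFlow.isTransport (hX : IsLipschitzFlow T L l X) (hl : 0 ≤ l) {t : ℝ}
    (ht : t ∈ Icc 0 T)
    (hd : ∀ z y, z ≤ y → ∫ x in z..y, q x ≤ K * (X t y - X t z)) :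
    IsTransport (Real.exp (-(l * T))) (Real.exp (l * T)) K q (X t) := by
  have h0 : (0 : ℝ) ∈ Icc 0 T := ⟨le_rfl, ht.1.trans ht.2⟩
  have hlt : l * t ≤ l * T := mul_le_mul_of_nonneg_left ht.2 hl
  refine ⟨Real.exp_pos _, fun z y hzy => ?_, fun z y hzy => ?_, hd⟩
  · have h1 := hX.space 0 h0 t ht z y hzy
    rw [zero_sub, abs_neg, abs_of_nonneg ht.1, hX.init, hX.init] at h1
    have h2 : Real.exp (-(l * T)) ≤ Real.exp (-(l * t)) := Real.exp_le_exp.2 (by linarith)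
    refine (mul_le_mul_of_nonneg_right h2 (sub_nonneg.2 hzy)).trans ?_
    calc _ ≤ Real.exp (-(l * t)) * (Real.exp (l * t) * (X t y - X t z)) :=
          mul_le_mul_of_nonneg_left h1 (Real.exp_pos _).le
      _ = _ := by rw [← mul_assoc, ← Real.exp_add, neg_add_cancel, Real.exp_zero, one_mul]
  · have h1 := hX.space t ht 0 h0 z y hzy
    rw [sub_zero, abs_of_nonneg ht.1, hX.init, hX.init] at h1
    exact h1.trans (mul_le_mul_of_nonneg_right (Real.exp_le_exp.2 hlt) (sub_nonneg.2 hzy))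

theorem IsLagrangianFlow.isTransport (hX : IsLagrangianFlow T L l K q V g X) (hl : 0 ≤ l) {t : ℝ}
    (ht : t ∈ Icc 0 T) : IsTransport (Real.exp (-(l * T))) (Real.exp (l * T)) K q (X t) :=
  hX.toIsLipschitzFlow.isTransport hl ht (hX.density_le t ht)

end flow


theorem densityMeasure_one : densityMeasure (fun _ => 1) = volume := by
  simp [densityMeasure]

theorem IsDensity.ae_eq {K K' : ℝ} {f h : ℝ → ℝ} (hf : IsDensity K f) (hh : IsDensity K' h)
    (e : densityMeasure f = densityMeasure h) : f =ᵐ[volume] h := by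
  have := (withDensity_eq_iff_of_sigmaFinite hf.measurable.ennreal_ofReal.aemeasurable
    hh.measurable.ennreal_ofReal.aemeasurable).1 e
  filter_upwards [this] with x hx
  exact (ENNReal.ofReal_eq_ofReal_iff (hf.nonneg x) (hh.nonneg x)).1 hx

section change

variable {c K K' : ℝ} {f h : ℝ → ℝ}

theorem map_volume_le (Y : ℝ ≃o ℝ) (hc : 0 ≤ c)
    (hY : ∀ a b, a ≤ b → b - a ≤ c * (Y b - Y a)) :
    volume.map Y ≤ ENNReal.ofReal c • volume := by
  have h1 : IsDensity 1 fun _ => 1 := ⟨measurable_const, fun _ => zero_le_one, fun _ => le_rfl⟩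
  have := h1.map_le hc Y (fun a b hab => by simpa using hY a b hab)
  rwa [densityMeasure_one] at this

theorem IsDensity.ae_le_of_map (hf : IsDensity K f) (hh : IsDensity K' h) (Y : ℝ ≃o ℝ)
    (hc : 0 ≤ c) (hY : ∀ a b, a ≤ b → b - a ≤ c * (Y b - Y a))
    (e : (densityMeasure f).map Y = densityMeasure h) :
    ∀ᵐ x, h x ≤ c * f (Y.symm x) := by
  have hYm : Measurable Y := Y.continuous.measurable
  have hZm : Measurable Y.symm := Y.symm.continuous.measurable
  have hfZ : Measurable fun x => ENNReal.ofReal (f (Y.symm x)) :=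
    (hf.measurable.comp hZm).ennreal_ofReal
  have : ∀ᵐ x, ENNReal.ofReal (h x) ≤ ENNReal.ofReal c * ENNReal.ofReal (f (Y.symm x)) := by
    refine ae_le_of_forall_setLIntegral_le_of_sigmaFinite hh.measurable.ennreal_ofReal
      fun s hs _ => ?_
    calc ∫⁻ x in s, ENNReal.ofReal (h x) = densityMeasure h s := (withDensity_apply _ hs).symm
      _ = ∫⁻ x in Y ⁻¹' s, ENNReal.ofReal (f (Y.symm (Y x))) := by
          rw [← e, Measure.map_apply hYm hs, densityMeasure, withDensity_apply _ (hYm hs)]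
          simp
      _ = ∫⁻ x in s, ENNReal.ofReal (f (Y.symm x)) ∂(volume.map Y) :=
          (setLIntegral_map hs hfZ hYm).symm
      _ ≤ ∫⁻ x in s, ENNReal.ofReal (f (Y.symm x)) ∂(ENNReal.ofReal c • volume) :=
          lintegral_mono' (Measure.restrict_mono le_rfl (map_volume_le Y hc hY)) le_rfl
      _ = ∫⁻ x in s, ENNReal.ofReal c * ENNReal.ofReal (f (Y.symm x)) := by
          rw [Measure.restrict_smul, lintegral_smul_measure, lintegral_const_mul _ hfZ,
            smul_eq_mul]
  filter_upwards [this] with x hx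
  rw [← ENNReal.ofReal_mul hc] at hx
  exact (ENNReal.ofReal_le_ofReal_iff (mul_nonneg hc (hf.nonneg _))).1 hx

theorem IsDensity.abs_sub_comp_le_of_map (hf : IsDensity K f) (hh : IsDensity K' h) (Y : ℝ ≃o ℝ)
    (hc : 1 ≤ c) (hY : ∀ a b, a ≤ b → b - a ≤ c * (Y b - Y a))
    (hY' : ∀ a b, a ≤ b → Y b - Y a ≤ c * (b - a))
    (e : (densityMeasure f).map Y = densityMeasure h) :
    ∀ᵐ x, |h x - f (Y.symm x)| ≤ (c - 1) * c * f (Y.symm x) := by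
  have hc0 : 0 ≤ c := zero_le_one.trans hc
  have hYm : Measurable Y := Y.continuous.measurable
  have hZm : Measurable Y.symm := Y.symm.continuous.measurable
  have e' : (densityMeasure h).map Y.symm = densityMeasure f := by
    rw [← e, Measure.map_map hZm hYm, show Y.symm ∘ Y = id from funext fun x => by simp,
      Measure.map_id]
  have hYs : ∀ a b, a ≤ b → b - a ≤ c * (Y.symm b - Y.symm a) := fun a b hab => by
    simpa using hY' _ _ (Y.symm.monotone hab)
  have h1 := hf.ae_le_of_map hh Y hc0 hY e
  have h2 := hh.ae_le_of_map hf Y.symm hc0 hYs e'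
  have hac : volume.map Y.symm ≪ volume :=
    (Measure.absolutelyContinuous_of_le (map_volume_le Y.symm hc0 hYs)).trans
      Measure.smul_absolutelyContinuous
  have h3 : ∀ᵐ x, f (Y.symm x) ≤ c * h x := by
    have := ae_of_ae_map hZm.aemeasurable (hac.ae_le h2)
    filter_upwards [this] with x hx
    simpa using hx
  filter_upwards [h1, h3] with x h1 h3
  have hfx := hf.nonneg (Y.symm x)
  have hhx := hh.nonneg x
  have hc1 : 0 ≤ c - 1 := sub_nonneg.2 hc
  have h4 := mul_le_mul_of_nonneg_left h1 hc1
  have h5 : (c - 1) * f (Y.symm x) ≤ (c - 1) * c * f (Y.symm x) :=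
    mul_le_mul_of_nonneg_right (le_mul_of_one_le_right hc1 hc) hfx
  rw [abs_le]
  constructor <;> nlinarith

theorem eLpNorm_comp_le {p : ℝ≥0∞} (hp : p ≠ ∞) {Z : ℝ → ℝ} (hZ : Measurable Z)
    (hZc : volume.map Z ≤ ENNReal.ofReal c • volume) (hf : AEStronglyMeasurable f) :
    eLpNorm (fun x => f (Z x)) p volume ≤
      ENNReal.ofReal c ^ (1 / p).toReal * eLpNorm f p volume := by
  have hac : volume.map Z ≪ volume :=
    (Measure.absolutelyContinuous_of_le hZc).trans Measure.smul_absolutelyContinuous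
  have e : eLpNorm (fun x => f (Z x)) p volume = eLpNorm f p (volume.map Z) :=
    (eLpNorm_map_measure (hf.mono_ac hac) hZ.aemeasurable).symm
  rw [e, ← smul_eq_mul, ← eLpNorm_smul_measure_of_ne_top hp]
  exact eLpNorm_mono_measure _ hZc

theorem memLp_comp {p : ℝ≥0∞} {Z : ℝ → ℝ} (hZ : Measurable Z)
    (hZc : volume.map Z ≤ ENNReal.ofReal c • volume) (hf : MemLp f p volume) :
    MemLp (fun x => f (Z x)) p volume :=
  (hf.of_measure_le_smul ENNReal.ofReal_ne_top hZc).comp_of_map hZ.aemeasurable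

/-- Composition with maps close to the identity is continuous in `L^p`. -/
theorem exists_eLpNorm_comp_sub_le {p : ℝ≥0∞} (hp1 : 1 ≤ p) (hp : p ≠ ∞) (hf : MemLp f p volume)
    (hc : 1 ≤ c) {ε : ℝ≥0∞} (hε : ε ≠ 0) :
    ∃ δ > 0, ∀ Z : ℝ → ℝ, Measurable Z → (∀ x, |Z x - x| ≤ δ) →
      volume.map Z ≤ ENNReal.ofReal c • volume →
      eLpNorm (fun x => f (Z x) - f x) p volume ≤ ε := by
  set k := ENNReal.ofReal c ^ (1 / p).toReal with hk
  have hk1 : 1 ≤ k := by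
    have := ENNReal.rpow_le_rpow (ENNReal.one_le_ofReal.2 hc)
      (ENNReal.toReal_nonneg (a := 1 / p))
    rwa [ENNReal.one_rpow] at this
  have hkt : k ≠ ∞ := ENNReal.rpow_ne_top_of_nonneg ENNReal.toReal_nonneg ENNReal.ofReal_ne_top
  have hε3 : ε / 3 ≠ 0 := by simp [hε]
  have hη : ε / 3 / k ≠ 0 := by simp [ENNReal.div_eq_zero_iff, hε, hkt]
  obtain ⟨g, hgs, hfg, hgc, hgm⟩ := hf.exists_hasCompactSupport_eLpNorm_sub_le hp hη
  have hfg' : eLpNorm (f - g) p volume ≤ ε / 3 :=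
    hfg.trans (ENNReal.div_le_of_le_mul (by
      calc ε / 3 = ε / 3 * 1 := (mul_one _).symm
        _ ≤ ε / 3 * k := by gcongr))
  set S := Metric.cthickening 1 (tsupport g) with hS
  have hSc : IsCompact S := hgs.isCompact.cthickening
  have hSm : volume S ≠ ∞ := hSc.measure_lt_top.ne
  set m := (volume S) ^ p.toReal⁻¹ with hm
  have hmt : m ≠ ∞ := ENNReal.rpow_ne_top_of_nonneg (by simp) hSm
  obtain ⟨w, hw0, hw⟩ : ∃ w > 0, m * ENNReal.ofReal w ≤ ε / 3 := by
    have h1 : Tendsto (fun w => m * ENNReal.ofReal w) (𝓝[>] 0) (𝓝 0) := by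
      have : Tendsto (fun w => m * ENNReal.ofReal w) (𝓝 0) (𝓝 (m * ENNReal.ofReal 0)) :=
        ENNReal.Tendsto.const_mul (ENNReal.continuous_ofReal.tendsto 0) (Or.inr hmt)
      simp only [ENNReal.ofReal_zero, mul_zero] at this
      exact this.mono_left nhdsWithin_le_nhds
    obtain ⟨w, hw1, hw2⟩ := ((h1.eventually (ge_mem_nhds (pos_iff_ne_zero.2 hε3))).and
      self_mem_nhdsWithin).exists
    exact ⟨w, hw2, hw1⟩
  have huc := hgc.uniformContinuous_of_tendsto_cocompact
    (hgs.is_zero_at_infty)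
  obtain ⟨δ, hδ0, hδ⟩ := Metric.uniformContinuous_iff.1 huc w hw0
  refine ⟨min 1 (δ / 2), by positivity, fun Z hZ hZx hZc => ?_⟩
  have hZ1 : ∀ x, |Z x - x| ≤ 1 := fun x => (hZx x).trans (min_le_left _ _)
  have hZ2 : ∀ x, |Z x - x| < δ := fun x =>
    ((hZx x).trans (min_le_right _ _)).trans_lt (half_lt_self hδ0)
  have hfgm : AEStronglyMeasurable (f - g) := (hf.sub hgm).1
  have hac : volume.map Z ≪ volume :=
    (Measure.absolutelyContinuous_of_le hZc).trans Measure.smul_absolutelyContinuous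
  have m1 : AEStronglyMeasurable fun x => (f - g) (Z x) :=
    (hfgm.mono_ac hac).comp_aemeasurable hZ.aemeasurable
  have m2 : AEStronglyMeasurable fun x => g (Z x) - g x :=
    ((hgc.measurable.comp hZ).sub hgc.measurable).aestronglyMeasurable
  have b1 : eLpNorm (fun x => (f - g) (Z x)) p volume ≤ ε / 3 := by
    refine (eLpNorm_comp_le hp hZ hZc hfgm).trans ?_
    calc k * eLpNorm (f - g) p volume ≤ k * (ε / 3 / k) := by gcongr
      _ ≤ ε / 3 := ENNReal.mul_div_le
  have b2 : eLpNorm (fun x => g (Z x) - g x) p volume ≤ ε / 3 := by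
    have hsupp : Function.support (fun x => g (Z x) - g x) ⊆ S := by
      intro x hx
      by_contra hxS
      have h1 : x ∉ tsupport g := fun h => hxS (Metric.self_subset_cthickening _ h)
      have h2 : Z x ∉ tsupport g := fun h => hxS
        (Metric.mem_cthickening_of_dist_le x (Z x) 1 _ h (by
          rw [dist_comm, Real.dist_eq]; exact hZ1 x))
      exact hx (by simp [image_eq_zero_of_notMem_tsupport h1, image_eq_zero_of_notMem_tsupport h2])
    rw [← eLpNorm_restrict_eq_of_support_subset hsupp]
    refine (eLpNorm_le_of_ae_bound (C := w) (Eventually.of_forall fun x => ?_)).trans ?_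
    · rw [← dist_eq_norm]
      exact (hδ (by rw [Real.dist_eq]; exact hZ2 x)).le
    · rwa [Measure.restrict_apply_univ]
  have e : (fun x => f (Z x) - f x) =
      ((fun x => (f - g) (Z x)) + fun x => g (Z x) - g x) - (f - g) := by
    ext x
    simp
  rw [e]
  calc _ ≤ eLpNorm ((fun x => (f - g) (Z x)) + fun x => g (Z x) - g x) p volume +
        eLpNorm (f - g) p volume := eLpNorm_sub_le (m1.add m2) hfgm hp1
    _ ≤ (ε / 3 + ε / 3) + ε / 3 := by
        gcongr
        exact (eLpNorm_add_le m1 m2 hp1).trans (add_le_add b1 b2)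
    _ = ε := by
        rw [← ENNReal.add_div, ← ENNReal.add_div, show ε + ε + ε = ε * 3 by ring,
          ENNReal.mul_div_cancel_right (by norm_num) (by norm_num)]

end change

/-- The weak solution transported by a Lagrangian flow. -/
noncomputable def transported (K : ℝ) (q : ℝ → ℝ) (X : ℝ → ℝ → ℝ) (t : ℝ) : ℝ → ℝ :=
  densityOf K ((densityMeasure q).map (X t))

section flow

variable {T L l K : ℝ} {q V g : ℝ → ℝ} {X : ℝ → ℝ → ℝ}

theorem IsLagrangianFlow.transported_spec (hX : IsLagrangianFlow T L l K q V g X) (hl : 0 ≤ l)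
    (hq : IsDensity K q) {t : ℝ} (ht : t ∈ Icc 0 T) :
    IsDensity K (transported K q X t) ∧
      densityMeasure (transported K q X t) = (densityMeasure q).map (X t) :=
  densityOf_spec hq.bound_nonneg ((hX.isTransport hl ht).map_le hq)

theorem IsLagrangianFlow.transported_zero (hX : IsLagrangianFlow T L l K q V g X) (hl : 0 ≤ l)
    (hq : IsDensity K q) (hT : 0 ≤ T) : transported K q X 0 =ᵐ[volume] q := by
  obtain ⟨h1, h2⟩ := hX.transported_spec hl hq (t := 0) ⟨le_rfl, hT⟩
  refine h1.ae_eq hq ?_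
  rw [h2, show X 0 = id from funext hX.init, Measure.map_id]

/-- The transition maps of a flow. -/
theorem IsLagrangianFlow.exists_transition (hX : IsLagrangianFlow T L l K q V g X) (hl : 0 ≤ l)
    (hq : IsDensity K q) {s t : ℝ} (hs : s ∈ Icc 0 T) (ht : t ∈ Icc 0 T) :
    ∃ Z : ℝ → ℝ, Measurable Z ∧ (∀ x, |Z x - x| ≤ L * |s - t|) ∧
      volume.map Z ≤ ENNReal.ofReal (Real.exp (l * |s - t|)) • volume ∧
      ∀ᵐ x, |transported K q X s x - transported K q X t (Z x)| ≤
        (Real.exp (l * |s - t|) - 1) * Real.exp (l * |s - t|) * transported K q X t (Z x) := by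
  have hs' := hX.isTransport hl hs
  have ht' := hX.isTransport hl ht
  set A := hs'.orderIso with hA
  set B := ht'.orderIso with hB
  have eA : ∀ x, X s x = A x := fun x => by rw [hA, hs'.coe_orderIso]
  have eB : ∀ x, X t x = B x := fun x => by rw [hB, ht'.coe_orderIso]
  set Y : ℝ ≃o ℝ := B.symm.trans A with hYdef
  have hexp : 1 ≤ Real.exp (l * |s - t|) := Real.one_le_exp (mul_nonneg hl (abs_nonneg _))
  have hY : ∀ a b, a ≤ b → b - a ≤ Real.exp (l * |s - t|) * (Y b - Y a) := fun a b hab => by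
    have := hX.space t ht s hs _ _ (B.symm.monotone hab)
    rw [abs_sub_comm t s] at this
    simpa [eA, eB, hYdef] using this
  have hY' : ∀ a b, a ≤ b → Y b - Y a ≤ Real.exp (l * |s - t|) * (b - a) := fun a b hab => by
    simpa [eA, eB, hYdef] using hX.space s hs t ht _ _ (B.symm.monotone hab)
  obtain ⟨f1, f2⟩ := hX.transported_spec hl hq ht
  obtain ⟨h1, h2⟩ := hX.transported_spec hl hq hs
  refine ⟨Y.symm, Y.symm.continuous.measurable, fun x => ?_, ?_, ?_⟩
  · have := hX.time t ht s hs (A.symm x)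
    rw [abs_sub_comm t s] at this
    simpa [eA, eB, hYdef] using this
  · refine map_volume_le Y.symm (Real.exp_pos _).le fun a b hab => ?_
    simpa using hY' _ _ (Y.symm.monotone hab)
  · refine f1.abs_sub_comp_le_of_map h1 Y hexp hY hY' ?_
    rw [f2, h2, Measure.map_map Y.continuous.measurable ht'.measurable]
    congr 1
    ext x
    simp [hYdef, eA, eB]

theorem IsLagrangianFlow.tendsto_transported (hX : IsLagrangianFlow T L l K q V g X) (hl : 0 ≤ l)
    (hq : IsDensity K q) {p : ℝ≥0∞} (hp1 : 1 ≤ p) (hp : p ≠ ∞) {S S' : Set ℝ}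
    (hS : MeasurableSet S) (hSS' : ∃ δ > 0, ∀ x ∈ S, ∀ y, |y - x| ≤ δ → y ∈ S') {t : ℝ}
    (ht : t ∈ Icc 0 T) (hm : MemLp (S'.indicator (transported K q X t)) p volume) :
    Tendsto (fun s => eLpNorm (fun x => transported K q X s x - transported K q X t x) p
      (volume.restrict S)) (𝓝[Icc 0 T] t) (𝓝 0) := by
  obtain ⟨δ, hδ0, hδ⟩ := hSS'
  set f := S'.indicator (transported K q X t) with hf
  set N := eLpNorm f p volume with hN
  have hNt : N ≠ ∞ := hm.2.ne
  let r : ℝ → ℝ := fun s => (Real.exp (l * |s - t|) - 1) * Real.exp (l * |s - t|)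
  have hr : ∀ s, 0 ≤ r s := fun s => mul_nonneg
    (sub_nonneg.2 (Real.one_le_exp (mul_nonneg hl (abs_nonneg _)))) (Real.exp_pos _).le
  have hrt : Tendsto (fun s => ENNReal.ofReal (r s)) (𝓝[Icc 0 T] t) (𝓝 0) := by
    have h1 : Continuous r := by fun_prop
    have h2 : r t = 0 := by simp [r]
    have h3 := (ENNReal.continuous_ofReal.comp h1).tendsto t
    simp only [Function.comp, h2, ENNReal.ofReal_zero] at h3
    exact h3.mono_left nhdsWithin_le_nhds
  rw [ENNReal.tendsto_nhds_zero]
  intro ε hε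
  have hε2 : ε / 2 ≠ 0 := by simp [hε.ne']
  set η := min 1 (ε / 2) with hη
  have hη0 : η ≠ 0 := (lt_min one_pos (pos_iff_ne_zero.2 hε2)).ne'
  obtain ⟨δ', hδ'0, hδ'⟩ := exists_eLpNorm_comp_sub_le hp1 hp hm
    (Real.one_le_exp (mul_nonneg hl (ht.1.trans ht.2))) hη0
  have ev1 : ∀ᶠ s in 𝓝[Icc 0 T] t, L * |s - t| < min δ δ' := by
    have h1 : Continuous fun s => L * |s - t| := by fun_prop
    have h2 := h1.tendsto t
    simp only [sub_self, abs_zero, mul_zero] at h2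
    exact (h2.mono_left nhdsWithin_le_nhds).eventually (gt_mem_nhds (lt_min hδ0 hδ'0))
  have ev2 : ∀ᶠ s in 𝓝[Icc 0 T] t, ENNReal.ofReal (r s) * (1 + N) ≤ ε / 2 := by
    have h1 := ENNReal.Tendsto.mul_const hrt (b := 1 + N) (Or.inr (by simp [hNt]))
    rw [zero_mul] at h1
    exact h1.eventually (ge_mem_nhds (pos_iff_ne_zero.2 hε2))
  filter_upwards [ev1, ev2, self_mem_nhdsWithin] with s hs1 hs2 hs
  obtain ⟨Z, hZm, hZx, hZc, hZ⟩ := hX.exists_transition hl hq hs ht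
  have hsT : |s - t| ≤ T := abs_le.2 ⟨by linarith [hs.1, ht.2], by linarith [hs.2, ht.1]⟩
  have hZx1 : ∀ x, |Z x - x| ≤ δ := fun x => (hZx x).trans (hs1.le.trans (min_le_left _ _))
  have hZx2 : ∀ x, |Z x - x| ≤ δ' := fun x => (hZx x).trans (hs1.le.trans (min_le_right _ _))
  have hZc' : volume.map Z ≤ ENNReal.ofReal (Real.exp (l * T)) • volume := by
    refine hZc.trans fun A => ?_
    simp only [Measure.smul_apply, smul_eq_mul]
    gcongr
  have hD := hδ' Z hZm hZx2 hZc'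
  have hfZ := memLp_comp hZm hZc hm
  have hZS : ∀ x ∈ S, f (Z x) = transported K q X t (Z x) := fun x hx =>
    indicator_of_mem (hδ x hx _ (hZx1 x)) _
  have hxS : ∀ x ∈ S, f x = transported K q X t x := fun x hx =>
    indicator_of_mem (hδ x hx _ (by simpa using hδ0.le)) _
  obtain ⟨h1, -⟩ := hX.transported_spec hl hq hs
  have m1 : AEStronglyMeasurable (fun x => transported K q X s x - f (Z x))
      (volume.restrict S) :=
    (h1.measurable.aestronglyMeasurable.sub hfZ.1).restrict
  have m2 : AEStronglyMeasurable (fun x => f (Z x) - f x) (volume.restrict S) :=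
    (hfZ.1.sub hm.1).restrict
  have b1 : eLpNorm (fun x => transported K q X s x - f (Z x)) p (volume.restrict S) ≤
      ENNReal.ofReal (r s) * (1 + N) := by
    have hle : ∀ᵐ x ∂(volume.restrict S), ‖transported K q X s x - f (Z x)‖ ≤
        r s * ‖f (Z x)‖ := by
      rw [ae_restrict_iff' hS]
      filter_upwards [hZ] with x hx hxS
      rw [hZS x hxS, Real.norm_eq_abs]
      exact hx.trans (mul_le_mul_of_nonneg_left (le_abs_self _) (hr s))
    refine (eLpNorm_le_mul_eLpNorm_of_ae_le_mul hle p).trans ?_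
    gcongr
    calc eLpNorm (fun x => f (Z x)) p (volume.restrict S)
        ≤ eLpNorm (fun x => f (Z x)) p volume := eLpNorm_mono_measure _ Measure.restrict_le_self
      _ = eLpNorm ((fun x => f (Z x) - f x) + f) p volume := by
          congr 1; ext x; simp
      _ ≤ eLpNorm (fun x => f (Z x) - f x) p volume + N :=
          eLpNorm_add_le (hfZ.1.sub hm.1) hm.1 hp1
      _ ≤ 1 + N := by gcongr; exact hD.trans (min_le_left _ _)
  have b2 : eLpNorm (fun x => f (Z x) - f x) p (volume.restrict S) ≤ ε / 2 :=
    (eLpNorm_mono_measure _ Measure.restrict_le_self).trans (hD.trans (min_le_right _ _))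
  have e : eLpNorm (fun x => transported K q X s x - transported K q X t x) p
      (volume.restrict S) = eLpNorm ((fun x => transported K q X s x - f (Z x)) +
        fun x => f (Z x) - f x) p (volume.restrict S) := by
    refine eLpNorm_congr_ae ?_
    filter_upwards [ae_restrict_mem hS] with x hx
    simp [hxS x hx]
  rw [e]
  calc _ ≤ _ := eLpNorm_add_le m1 m2 hp1
    _ ≤ ε / 2 + ε / 2 := add_le_add (b1.trans hs2) b2
    _ = ε := ENNReal.add_halves ε

theorem IsLagrangianFlow.isContinuousInLp_loc (hX : IsLagrangianFlow T L l K q V g X) (hl : 0 ≤ l)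
    (hq : IsDensity K q) (r : ℝ) :
    IsContinuousInLp T 1 (volume.restrict (Icc (-r) r)) (transported K q X) := by
  intro t ht
  obtain ⟨h1, -⟩ := hX.transported_spec hl hq ht
  have hb : ∀ r, MemLp (transported K q X t) 1 (volume.restrict (Icc (-r) r)) := fun r => by
    refine memLp_one_iff_integrable.2 (Measure.integrableOn_of_bounded (M := K) (by simp)
      h1.measurable.aestronglyMeasurable (Eventually.of_forall fun x => ?_))
    rw [Real.norm_of_nonneg (h1.nonneg x)]
    exact h1.le x
  refine ⟨hb r, hX.tendsto_transported hl hq le_rfl ENNReal.one_ne_top measurableSet_Icc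
    (S' := Icc (-(r + 1)) (r + 1)) ⟨1, one_pos, fun x hx y hy => ?_⟩ ht
    ((memLp_indicator_iff_restrict measurableSet_Icc).2 (hb (r + 1)))⟩
  rw [abs_le] at hy
  exact ⟨by linarith [hx.1, hy.1], by linarith [hx.2, hy.2]⟩

theorem IsLagrangianFlow.isContinuousInLp_two (hX : IsLagrangianFlow T L l K q V g X) (hl : 0 ≤ l)
    (hq : IsDensity K q) (hq2 : MemLp q 2 volume) :
    IsContinuousInLp T 2 volume (transported K q X) := by
  intro t ht
  have h0 : (0 : ℝ) ∈ Icc 0 T := ⟨le_rfl, ht.1.trans ht.2⟩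
  obtain ⟨h1, -⟩ := hX.transported_spec hl hq ht
  have hm0 : MemLp (transported K q X 0) 2 volume :=
    (memLp_congr_ae (hX.transported_zero hl hq h0.2)).2 hq2
  have hm : MemLp (transported K q X t) 2 volume := by
    obtain ⟨Z, hZm, hZx, hZc, hZ⟩ := hX.exists_transition hl hq ht h0
    have h2 := memLp_comp hZm hZc hm0
    have h3 : MemLp (fun x => transported K q X t x - transported K q X 0 (Z x)) 2 volume := by
      refine (h2.const_mul ((Real.exp (l * |t - 0|) - 1) * Real.exp (l * |t - 0|))).mono
        (h1.measurable.aestronglyMeasurable.sub h2.1) ?_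
      filter_upwards [hZ] with x hx
      exact hx.trans (le_abs_self _)
    refine (memLp_congr_ae (Eventually.of_forall fun x => ?_)).1 (h3.add h2)
    simp
  have := hX.tendsto_transported hl hq (p := 2) (by norm_num) (by norm_num) MeasurableSet.univ
    (S' := univ) ⟨1, one_pos, fun _ _ _ _ => mem_univ _⟩ ht (by rwa [indicator_univ])
  rw [Measure.restrict_univ] at this
  exact ⟨hm, this⟩

end flow


/-- The nonlocal term in Eulerian coordinates of the transported density. -/
noncomputable def eulerianTerm (g q X : ℝ → ℝ) (x : ℝ) : ℝ :=
  ∫ y, forward g (X y - x) ∂(densityMeasure q)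

theorem nonlocalTerm_eq {γ g : ℝ → ℝ} (hγ : γ =ᵐ[volume.restrict (Ioi 0)] g) (p : ℝ → ℝ → ℝ)
    (t x : ℝ) : nonlocalTerm γ p t x = ∫ y, p t y * forward g (y - x) := by
  rw [nonlocalTerm, ← integral_indicator measurableSet_Ioi]
  refine integral_congr_ae ?_
  have h1 := (ae_restrict_iff' measurableSet_Ioi).1 hγ
  have h2 := (measurePreserving_sub_right volume x).quasiMeasurePreserving.ae h1
  filter_upwards [h2] with y hy
  by_cases hxy : x < y
  · rw [indicator_of_mem (mem_Ioi.2 hxy), forward_of_pos (sub_pos.2 hxy),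
      hy (mem_Ioi.2 (sub_pos.2 hxy)), mul_comm]
  · rw [indicator_of_notMem (by simpa using hxy), forward_of_nonpos (by linarith), mul_zero]

section weak

variable {T C L K : ℝ} {q V g γ q₀ : ℝ → ℝ} {X : ℝ → ℝ → ℝ}

theorem integral_transported_mul {l : ℝ} (hX : IsLagrangianFlow T L l K q V g X) (hl : 0 ≤ l)
    (hq : IsDensity K q) {t : ℝ} (ht : t ∈ Icc 0 T) {f : ℝ → ℝ} (hf : Measurable f) :
    ∫ x, transported K q X t x * f x = ∫ y, f (X t y) ∂(densityMeasure q) := by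
  obtain ⟨h1, h2⟩ := hX.transported_spec hl hq ht
  rw [← h1.integral_densityMeasure, h2,
    integral_map (hX.isTransport hl ht).measurable.aemeasurable hf.aestronglyMeasurable]

theorem nonlocalTerm_transported {l : ℝ} (hX : IsLagrangianFlow T L l K q V g X) (hl : 0 ≤ l)
    (hq : IsDensity K q) (hg : IsMonotoneKernel C g) (hγ : γ =ᵐ[volume.restrict (Ioi 0)] g)
    {t : ℝ} (ht : t ∈ Icc 0 T) (x : ℝ) :
    nonlocalTerm γ (transported K q X) t x = eulerianTerm g q (X t) x := by
  rw [nonlocalTerm_eq hγ]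
  exact integral_transported_mul hX hl hq ht
    (hg.measurable_forward.comp (measurable_id.sub_const x))

variable (h : IsData T C L K q V g) (hX : IsLagrangianFlow T L (rate C L K) K q V g X)
include h hX

theorem IsData.eulerianTerm_mem {t : ℝ} (ht : t ∈ Icc 0 T) (x : ℝ) :
    eulerianTerm g q (X t) x ∈ Icc 0 K := by
  have hXt := hX.isTransport h.rate_nonneg ht
  exact ⟨h.kernel.integral_comp_nonneg, h.kernel.integral_comp_le h.density.bound_nonneg
    (hXt.measurable.sub_const _) (map_sub_const_le hXt.measurable (hXt.map_le h.density) _)⟩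

theorem IsData.abs_eulerianTerm_sub_le {s t : ℝ} (hs : s ∈ Icc 0 T) (ht : t ∈ Icc 0 T)
    (x y : ℝ) : |eulerianTerm g q (X s) x - eulerianTerm g q (X t) y| ≤
      4 * K * C * (L * |s - t| + |x - y|) := by
  have hXs := hX.isTransport h.rate_nonneg hs
  have hXt := hX.isTransport h.rate_nonneg ht
  have hL := h.bound_pos
  refine (h.kernel.abs_integral_sub_le h.density.bound_nonneg (hXs.measurable.sub_const _)
    (hXt.measurable.sub_const _) (map_sub_const_le hXs.measurable (hXs.map_le h.density) _)
    (η := L * |s - t| + |x - y|) (by positivity) fun z => ?_).trans (le_of_eq (by ring))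
  have h1 := abs_le.1 (hX.time s hs t ht z)
  rw [sub_sub_sub_comm]
  exact (abs_sub _ _).trans (add_le_add (hX.time s hs t ht z) le_rfl)

theorem IsData.abs_eulerianSpeed_sub_le {s t : ℝ} (hs : s ∈ Icc 0 T) (ht : t ∈ Icc 0 T)
    (x y : ℝ) : |V (eulerianTerm g q (X s) x) - V (eulerianTerm g q (X t) y)| ≤
      rate C L K * (L * |s - t| + |x - y|) := by
  refine (h.velocity.lipschitz _ (h.eulerianTerm_mem hX hs x) _
    (h.eulerianTerm_mem hX ht y)).trans ?_
  refine (mul_le_mul_of_nonneg_left (h.abs_eulerianTerm_sub_le hX hs ht x y)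
    h.bound_pos).trans (le_of_eq ?_)
  rw [rate]
  ring

theorem IsData.continuous_eulerianSpeed :
    Continuous fun p : ℝ × ℝ => V (eulerianTerm g q (X (clamp T p.1)) p.2) := by
  have hT := h.time_pos.le
  have hl := h.rate_nonneg
  have hL := h.bound_pos
  have hK : 0 ≤ rate C L K * (L + 1) := by positivity
  refine (LipschitzWith.of_dist_le_mul (K := (rate C L K * (L + 1)).toNNReal)
    fun p p' => ?_).continuous
  rw [Real.dist_eq, Real.coe_toNNReal _ hK]
  refine (h.abs_eulerianSpeed_sub_le hX (clamp_mem hT _) (clamp_mem hT _) _ _).trans ?_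
  rw [mul_assoc]
  refine mul_le_mul_of_nonneg_left ?_ hl
  have h1 : |clamp T p.1 - clamp T p'.1| ≤ dist p p' :=
    (abs_clamp_sub_le _ _ _).trans ((Real.dist_eq _ _).symm.le.trans (le_max_left _ _))
  have h2 : |p.2 - p'.2| ≤ dist p p' := (Real.dist_eq _ _).symm.le.trans (le_max_right _ _)
  have := mul_le_mul_of_nonneg_left h1 hL
  linarith

theorem IsData.continuous_flow : Continuous fun p : ℝ × ℝ => X (clamp T p.1) p.2 := by
  have hT := h.time_pos.le
  have hL := h.bound_pos
  set b := Real.exp (rate C L K * T)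
  have hb : 0 < b := Real.exp_pos _
  refine (LipschitzWith.of_dist_le_mul (K := (L + b).toNNReal) fun p p' => ?_).continuous
  rw [Real.dist_eq, Real.coe_toNNReal _ (by positivity)]
  have h1 : |clamp T p.1 - clamp T p'.1| ≤ dist p p' :=
    (abs_clamp_sub_le _ _ _).trans ((Real.dist_eq _ _).symm.le.trans (le_max_left _ _))
  have h2 : |p.2 - p'.2| ≤ dist p p' := (Real.dist_eq _ _).symm.le.trans (le_max_right _ _)
  have h3 := hX.time _ (clamp_mem hT p.1) _ (clamp_mem hT p'.1) p.2
  have h4 := (hX.isTransport h.rate_nonneg (clamp_mem hT p'.1)).abs_sub_le p'.2 p.2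
  have h5 := mul_le_mul_of_nonneg_left h1 hL
  have h6 := mul_le_mul_of_nonneg_left h2 hb.le
  refine (abs_sub_le _ (X (clamp T p'.1) p.2) _).trans ?_
  linarith

theorem IsData.weak_form {φ : ℝ × ℝ → ℝ} (hφ : ContDiff ℝ 1 φ) (hφc : HasCompactSupport φ)
    (hφT : tsupport φ ⊆ Iio T ×ˢ univ) :
    (∫ t in (0 : ℝ)..T, ∫ x, transported K q X t x * (deriv (fun s => φ (s, x)) t +
        V (eulerianTerm g q (X t) x) * deriv (fun y => φ (t, y)) x))
      + ∫ x, q x * φ (0, x) = 0 := by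
  have hT := h.time_pos
  have hdiff := hφ.differentiable one_ne_zero
  have hcd : Continuous (fderiv ℝ φ) := hφ.continuous_fderiv one_ne_zero
  have d1 : ∀ t x, deriv (fun s => φ (s, x)) t = fderiv ℝ φ (t, x) (1, 0) := fun t x =>
    ((hdiff (t, x)).hasFDerivAt.comp_hasDerivAt t
      ((hasDerivAt_id t).prodMk (hasDerivAt_const t x))).deriv
  have d2 : ∀ t x, deriv (fun y => φ (t, y)) x = fderiv ℝ φ (t, x) (0, 1) := fun t x =>
    ((hdiff (t, x)).hasFDerivAt.comp_hasDerivAt x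
      ((hasDerivAt_const x t).prodMk (hasDerivAt_id x))).deriv
  have d3 : ∀ (t x w : ℝ), fderiv ℝ φ (t, x) (1, 0) + w * fderiv ℝ φ (t, x) (0, 1) =
      fderiv ℝ φ (t, x) (1, w) := fun t x w => by
    rw [← smul_eq_mul, ← map_smul, ← map_add]
    simp
  let G : ℝ → ℝ → ℝ := fun t y => fderiv ℝ φ (clamp T t, X (clamp T t) y)
    (1, V (eulerianTerm g q (X (clamp T t)) (X (clamp T t) y)))
  have hflow := h.continuous_flow hX
  have hGc : Continuous fun p : ℝ × ℝ => G p.1 p.2 := by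
    have h1 : Continuous fun p : ℝ × ℝ => (clamp T p.1, X (clamp T p.1) p.2) :=
      ((continuous_clamp T).comp continuous_fst).prodMk hflow
    have h2 : Continuous fun p : ℝ × ℝ =>
        V (eulerianTerm g q (X (clamp T p.1)) (X (clamp T p.1) p.2)) :=
      (h.continuous_eulerianSpeed hX).comp (continuous_fst.prodMk hflow)
    exact (hcd.comp h1).clm_apply (continuous_const.prodMk h2)
  obtain ⟨r, hr⟩ : ∃ r, ∀ p : ℝ × ℝ, r < ‖p‖ → fderiv ℝ φ p = 0 := by
    obtain ⟨r, hr⟩ := (hφc.isCompact).isBounded.subset_closedBall 0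
    refine ⟨r, fun p hp => ?_⟩
    have : p ∉ tsupport φ := fun hp' => by
      have := hr hp'
      rw [mem_closedBall_zero_iff] at this
      linarith
    exact image_eq_zero_of_notMem_tsupport fun h => this (tsupport_fderiv_subset ℝ h)
  have hG0 : ∀ t y, r + L * T < |y| → G t y = 0 := fun t y hy => by
    have hc := clamp_mem hT.le t
    have h1 := hX.time 0 ⟨le_rfl, hT.le⟩ _ hc y
    rw [hX.init, zero_sub, abs_neg, abs_of_nonneg hc.1] at h1
    have h2 := mul_le_mul_of_nonneg_left hc.2 h.bound_pos
    have h3 := abs_sub_abs_le_abs_sub y (X (clamp T t) y)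
    have h4 : |X (clamp T t) y| ≤ ‖(clamp T t, X (clamp T t) y)‖ := le_max_right _ _
    simp only [G]
    rw [hr _ (by linarith)]
    rfl
  have hinner : ∀ t ∈ Icc 0 T, ∫ x, transported K q X t x * (deriv (fun s => φ (s, x)) t +
        V (eulerianTerm g q (X t) x) * deriv (fun y => φ (t, y)) x) =
      ∫ y, q y * G t y := fun t ht => by
    have hm : Measurable fun x => fderiv ℝ φ (t, x) (1, V (eulerianTerm g q (X t) x)) := by
      have h1 : Continuous fun x => V (eulerianTerm g q (X t) x) := by
        have := (h.continuous_eulerianSpeed hX).comp (Continuous.prodMk_right t)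
        simpa only [Function.comp_def, clamp_of_mem ht] using this
      exact ((hcd.comp (Continuous.prodMk_right t)).clm_apply
        (continuous_const.prodMk h1)).measurable
    simp_rw [d1, d2, d3]
    rw [integral_transported_mul hX h.rate_nonneg h.density ht hm,
      h.density.integral_densityMeasure]
    simp only [G, clamp_of_mem ht]
  have hint : Integrable (Function.uncurry fun t y => q y * G t y)
      ((volume.restrict (Ioc 0 T)).prod volume) := by
    have h1 : IntegrableOn (fun p : ℝ × ℝ => G p.1 p.2)
        (Ioc 0 T ×ˢ Icc (-(r + L * T)) (r + L * T)) :=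
      (hGc.continuousOn.integrableOn_compact (isCompact_Icc.prod isCompact_Icc)).mono_set
        (prod_mono Ioc_subset_Icc_self subset_rfl)
    have h2 : IntegrableOn (fun p : ℝ × ℝ => G p.1 p.2) (Ioc 0 T ×ˢ univ) := by
      refine h1.of_forall_sdiff_eq_zero (measurableSet_Ioc.prod MeasurableSet.univ)
        fun p hp => hG0 _ _ ?_
      by_contra! hle
      exact hp.2 ⟨hp.1.1, abs_le.1 hle⟩
    rw [IntegrableOn, Measure.volume_eq_prod, ← Measure.prod_restrict,
      Measure.restrict_univ] at h2
    refine h2.bdd_mul (c := K) (h.density.measurable.comp measurable_snd).aestronglyMeasurable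
      (Eventually.of_forall fun p => ?_)
    rw [Real.norm_of_nonneg (h.density.nonneg p.2)]
    exact h.density.le p.2
  have hφzero : ∀ x, φ (T, x) = 0 := fun x =>
    image_eq_zero_of_notMem_tsupport fun hx => lt_irrefl T (hφT hx).1
  have hftc : ∀ y, ∫ t in (0 : ℝ)..T, q y * G t y = q y * (-φ (0, y)) := fun y => by
    rw [intervalIntegral.integral_const_mul]
    congr 1
    have hd : ∀ t ∈ Icc 0 T, HasDerivWithinAt (fun t => φ (t, X t y)) (G t y) (Icc 0 T) t := by
      intro t ht
      have h1 := (hasDerivAt_id t).hasDerivWithinAt (s := Icc 0 T) |>.prodMk (hX.deriv t ht y)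
      have h2 := (hdiff (t, X t y)).hasFDerivAt.comp_hasDerivWithinAt t h1
      simp only [G, clamp_of_mem ht]
      exact h2
    rw [intervalIntegral.integral_eq_sub_of_hasDeriv_right_of_le hT.le
      (f := fun t => φ (t, X t y))
      (fun t ht => (hd t ht).continuousWithinAt)
      (fun t ht => ((hd t (Ioo_subset_Icc_self ht)).hasDerivAt
        (Icc_mem_nhds ht.1 ht.2)).hasDerivWithinAt)
      ((hGc.comp (Continuous.prodMk_left y)).intervalIntegrable _ _), hφzero, hX.init, zero_sub]
  have hcongr : ∫ t in (0 : ℝ)..T, ∫ x, transported K q X t x * (deriv (fun s => φ (s, x)) t +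
        V (eulerianTerm g q (X t) x) * deriv (fun y => φ (t, y)) x) =
      ∫ t in (0 : ℝ)..T, ∫ y, q y * G t y :=
    intervalIntegral.integral_congr fun t ht => hinner t (by rwa [uIcc_of_le hT.le] at ht)
  rw [hcongr, intervalIntegral.integral_of_le hT.le, integral_integral_swap hint]
  simp_rw [← intervalIntegral.integral_of_le hT.le, hftc, mul_neg]
  rw [integral_neg]
  ring

theorem IsData.isWeakSolution (hγ : γ =ᵐ[volume.restrict (Ioi 0)] g)
    (hq₀ : q₀ =ᵐ[volume] q) : IsWeakSolution T K q₀ V γ (transported K q X) := by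
  have hl := h.rate_nonneg
  have hW : ∀ t ∈ Icc 0 T, ∀ x, nonlocalTerm γ (transported K q X) t x =
      eulerianTerm g q (X t) x := fun t ht x =>
    nonlocalTerm_transported hX hl h.density h.kernel hγ ht x
  refine ⟨hX.isContinuousInLp_loc hl h.density, ⟨K, fun t ht => ?_⟩, fun t ht x => ?_,
    fun φ hφ hφc hφT => ?_⟩
  · obtain ⟨h1, -⟩ := hX.transported_spec hl h.density ht
    exact Eventually.of_forall fun x => by
      rw [abs_of_nonneg (h1.nonneg x)]
      exact h1.le x
  · rw [hW t ht]
    exact h.eulerianTerm_mem hX ht x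
  · have e : ∫ x, q₀ x * φ (0, x) = ∫ x, q x * φ (0, x) := by
      refine integral_congr_ae ?_
      filter_upwards [hq₀] with x hx
      rw [hx]
    have e' : (∫ t in (0 : ℝ)..T, ∫ x, transported K q X t x * (deriv (fun s => φ (s, x)) t +
        V (nonlocalTerm γ (transported K q X) t x) * deriv (fun y => φ (t, y)) x)) =
        ∫ t in (0 : ℝ)..T, ∫ x, transported K q X t x * (deriv (fun s => φ (s, x)) t +
        V (eulerianTerm g q (X t) x) * deriv (fun y => φ (t, y)) x) := by
      refine intervalIntegral.integral_congr fun t ht => ?_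
      rw [uIcc_of_le h.time_pos.le] at ht
      simp only [hW t ht]
    rw [e, e', h.weak_form hX hφ hφc hφT]

end weak


section continuity

variable {T M : ℝ} {p : ℝ → ℝ → ℝ}

theorem aestronglyMeasurable_of_isContinuousInLp
    (hp : ∀ r : ℝ, IsContinuousInLp T 1 (volume.restrict (Icc (-r) r)) p) {t : ℝ}
    (ht : t ∈ Icc 0 T) : AEStronglyMeasurable (p t) volume := by
  have h1 : AEStronglyMeasurable (p t) (volume.restrict (⋃ n : ℕ, Icc (-(n : ℝ)) n)) :=
    aestronglyMeasurable_iUnion_iff.2 fun n => ((hp n) t ht).1.1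
  rwa [show (⋃ n : ℕ, Icc (-(n : ℝ)) n) = univ from eq_univ_of_forall fun x => by
    obtain ⟨n, hn⟩ := exists_nat_ge |x|
    exact mem_iUnion.2 ⟨n, abs_le.1 hn⟩, Measure.restrict_univ] at h1

variable (hp : ∀ r : ℝ, IsContinuousInLp T 1 (volume.restrict (Icc (-r) r)) p)
  (hM : ∀ t ∈ Icc 0 T, ∀ᵐ x, |p t x| ≤ M)

include hp hM

theorem integrable_mul_of_bounded {t : ℝ} (ht : t ∈ Icc 0 T) {ψ : ℝ → ℝ} (hψ : Integrable ψ) :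
    Integrable fun x => p t x * ψ x :=
  hψ.bdd_mul (aestronglyMeasurable_of_isContinuousInLp hp ht) (hM t ht)

theorem abs_integral_mul_le {t : ℝ} (ht : t ∈ Icc 0 T) {ψ : ℝ → ℝ} (hψ : Integrable ψ) :
    |∫ x, p t x * ψ x| ≤ M * ∫ x, |ψ x| := by
  rw [← integral_const_mul]
  refine abs_integral_le_integral_abs.trans (integral_mono_ae
    (integrable_mul_of_bounded hp hM ht hψ).abs (hψ.abs.const_mul M) ?_)
  filter_upwards [hM t ht] with x hx
  rw [abs_mul]
  exact mul_le_mul_of_nonneg_right hx (abs_nonneg _)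

theorem tendsto_integral_mul {t : ℝ} (ht : t ∈ Icc 0 T) {ψ : ℝ → ℝ → ℝ}
    (hψ : ∀ s ∈ Icc 0 T, Integrable (ψ s)) {B : ℝ} (hB : ∀ x, |ψ t x| ≤ B)
    (hψt : Tendsto (fun s => ∫ x, |ψ s x - ψ t x|) (𝓝[Icc 0 T] t) (𝓝 0)) :
    Tendsto (fun s => ∫ x, p s x * ψ s x) (𝓝[Icc 0 T] t) (𝓝 (∫ x, p t x * ψ t x)) := by
  have hB0 : 0 ≤ B := (abs_nonneg _).trans (hB 0)
  rw [Metric.tendsto_nhds]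
  intro ε hε
  have htail : Tendsto (fun n : ℕ => ∫ x in (Icc (-(n : ℝ)) n)ᶜ, |ψ t x|) atTop (𝓝 0) := by
    have h1 := tendsto_setIntegral_of_antitone (μ := volume) (f := fun x => |ψ t x|)
      (s := fun n : ℕ => (Icc (-(n : ℝ)) n)ᶜ) (fun n => measurableSet_Icc.compl)
      (fun m n hmn => compl_subset_compl.2 (by
        have : (m : ℝ) ≤ n := by exact_mod_cast hmn
        exact Icc_subset_Icc (by linarith) this))
      ⟨0, (hψ t ht).abs.integrableOn⟩
    have h2 : ⋂ n : ℕ, (Icc (-(n : ℝ)) n)ᶜ = ∅ := by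
      rw [← compl_iUnion, compl_empty_iff]
      exact eq_univ_of_forall fun x => by
        obtain ⟨n, hn⟩ := exists_nat_ge |x|
        exact mem_iUnion.2 ⟨n, abs_le.1 hn⟩
    rw [h2] at h1
    simpa using h1
  obtain ⟨n, hn⟩ := ((htail.const_mul (2 * M)).eventually
    (gt_mem_nhds (show 2 * M * 0 < ε / 3 by rw [mul_zero]; positivity))).exists
  set S := Icc (-(n : ℝ)) n with hS
  have hloc : Tendsto (fun s => B * ∫ x in S, |p s x - p t x|) (𝓝[Icc 0 T] t) (𝓝 0) := by
    have h1 := (ENNReal.tendsto_toReal ENNReal.zero_ne_top).comp (hp n t ht).2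
    have h2 : (fun s => B * ∫ x in S, |p s x - p t x|) =ᶠ[𝓝[Icc 0 T] t]
        fun s => B * (eLpNorm (fun x => p s x - p t x) 1 (volume.restrict S)).toReal := by
      filter_upwards [self_mem_nhdsWithin] with s hs
      have h3 := integral_norm_eq_lintegral_enorm
        (((hp n) s hs).1.1.sub ((hp n) t ht).1.1)
      simp only [Pi.sub_apply, Real.norm_eq_abs] at h3
      rw [eLpNorm_one_eq_lintegral_enorm, h3]
    refine Tendsto.congr' h2.symm ?_
    have h3 := h1.const_mul B
    simpa using h3
  have e1 := (hψt.const_mul M).eventually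
    (gt_mem_nhds (show M * 0 < ε / 3 by rw [mul_zero]; positivity))
  have e2 := hloc.eventually (gt_mem_nhds (show 0 < ε / 3 by positivity))
  filter_upwards [e1, e2, self_mem_nhdsWithin] with s h1 h2 hs
  have hps := aestronglyMeasurable_of_isContinuousInLp hp hs
  have hpt := aestronglyMeasurable_of_isContinuousInLp hp ht
  have i1 := integrable_mul_of_bounded hp hM hs (hψ s hs)
  have i2 := integrable_mul_of_bounded hp hM ht (hψ t ht)
  have i3 := integrable_mul_of_bounded hp hM hs (hψ t ht)
  have i4 : Integrable fun x => (p s x - p t x) * ψ t x := by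
    refine (i3.sub i2).congr (Eventually.of_forall fun x => ?_)
    simp only [Pi.sub_apply]
    ring
  have e3 : ∫ x, p s x * ψ s x - p t x * ψ t x =
      (∫ x, p s x * (ψ s x - ψ t x)) + ∫ x, (p s x - p t x) * ψ t x := by
    have h3 := integral_add (integrable_mul_of_bounded hp hM hs ((hψ s hs).sub (hψ t ht))) i4
    simp only [Pi.sub_apply] at h3
    rw [← h3]
    refine integral_congr_ae (Eventually.of_forall fun x => ?_)
    simp only
    ring
  have b1 := abs_integral_mul_le hp hM hs ((hψ s hs).sub (hψ t ht))
  simp only [Pi.sub_apply] at b1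
  have b2 : |∫ x, (p s x - p t x) * ψ t x| ≤ (B * ∫ x in S, |p s x - p t x|) +
      2 * M * ∫ x in Sᶜ, |ψ t x| := by
    refine abs_integral_le_integral_abs.trans ?_
    rw [← integral_add_compl measurableSet_Icc i4.abs, ← integral_const_mul, ← integral_const_mul]
    refine add_le_add (integral_mono_ae i4.abs.integrableOn ?_ ?_)
      (integral_mono_ae i4.abs.integrableOn ((hψ t ht).abs.integrableOn.const_mul _) ?_)
    · exact ((memLp_one_iff_integrable.1 ((hp n) s hs).1).sub
        (memLp_one_iff_integrable.1 ((hp n) t ht).1)).abs.const_mul B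
    · refine Eventually.of_forall fun x => ?_
      simp only
      rw [abs_mul, mul_comm]
      exact mul_le_mul_of_nonneg_right (hB x) (abs_nonneg _)
    · filter_upwards [ae_restrict_of_ae (hM s hs), ae_restrict_of_ae (hM t ht)] with x h1 h2
      rw [abs_mul]
      refine mul_le_mul_of_nonneg_right ((abs_sub _ _).trans ?_) (abs_nonneg _)
      linarith
  rw [Real.dist_eq, ← integral_sub i1 i2, e3]
  refine (abs_add_le _ _).trans_lt ?_
  linarith

theorem continuousOn_integral_mul_const {ψ : ℝ → ℝ} (hψ : Integrable ψ) {B : ℝ}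
    (hB : ∀ x, |ψ x| ≤ B) : ContinuousOn (fun t => ∫ x, p t x * ψ x) (Icc 0 T) := fun t ht =>
  tendsto_integral_mul hp hM ht (ψ := fun _ => ψ) (fun _ _ => hψ) hB (by
    simpa using tendsto_const_nhds)

theorem continuousOn_integral_mul {E : ℝ → ℝ → ℝ}
    (hE : Continuous fun x : ℝ × ℝ => E x.1 x.2) {r : ℝ} (hr : ∀ t x, r < |x| → E t x = 0) :
    ContinuousOn (fun t => ∫ x, p t x * E t x) (Icc 0 T) := by
  intro t ht
  have hEt : ∀ s, Continuous (E s) := fun s => hE.comp (Continuous.prodMk_right s)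
  have hcs : ∀ s, HasCompactSupport (E s) := fun s =>
    HasCompactSupport.intro (isCompact_Icc (a := -r) (b := r)) fun x hx => hr s x (by
      by_contra! h
      exact hx (abs_le.1 h))
  obtain ⟨B, hB⟩ := (hcs t).exists_bound_of_continuous (hEt t)
  refine tendsto_integral_mul hp hM ht
    (fun s _ => (hEt s).integrable_of_hasCompactSupport (hcs s)) hB ?_
  have h1 : Continuous fun s => ∫ x in Icc (-r) r, |E s x - E t x| := by
    refine continuous_parametric_integral_of_continuous (f := fun s x => |E s x - E t x|)
      ?_ isCompact_Icc
    exact (hE.sub ((hEt t).comp continuous_snd)).abs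
  have h2 : (fun s => ∫ x in Icc (-r) r, |E s x - E t x|) = fun s => ∫ x, |E s x - E t x| := by
    ext s
    refine setIntegral_eq_integral_of_forall_compl_eq_zero fun x hx => ?_
    have hx' : r < |x| := by
      by_contra! h
      exact hx (abs_le.1 h)
    rw [hr s x hx', hr t x hx', sub_zero, abs_zero]
  rw [h2] at h1
  have h3 := h1.tendsto t
  simp only [sub_self, abs_zero, integral_zero] at h3
  exact h3.mono_left nhdsWithin_le_nhds

end continuity

section ode

/-- Global solutions of scalar differential equations with bounded Lipschitz right-hand side,
continued with constant speed outside `[0, T]`. -/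
theorem exists_flow {T L κ : ℝ} (hT : 0 ≤ T) (hL : 0 ≤ L) (hκ : 0 ≤ κ) {w : ℝ → ℝ → ℝ}
    (hwt : ∀ x, ContinuousOn (fun t => w t x) (Icc 0 T))
    (hwx : ∀ t ∈ Icc 0 T, ∀ x y, |w t x - w t y| ≤ κ * |x - y|)
    (hw : ∀ t ∈ Icc 0 T, ∀ x, |w t x| ≤ L) :
    ∃ X : ℝ → ℝ → ℝ, (∀ z, X 0 z = z) ∧
      (∀ z, Continuous fun t => w (clamp T t) (X (clamp T t) z)) ∧
      ∀ t z, HasDerivAt (fun t => X t z) (w (clamp T t) (X (clamp T t) z)) t := by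
  have hwc : Continuous fun x : ℝ × ℝ => w (clamp T x.1) x.2 := by
    refine continuous_prod_of_continuous_lipschitzWith' _ κ.toNNReal (fun t => ?_) fun x =>
      (hwt x).comp_continuous (continuous_clamp T) (clamp_mem hT)
    refine LipschitzWith.of_dist_le_mul fun x y => ?_
    rw [Real.coe_toNNReal _ hκ]
    exact hwx _ (clamp_mem hT t) x y
  have hex : ∀ z, ∃ α : ℝ → ℝ, α 0 = z ∧
      ∀ t ∈ Icc 0 T, HasDerivWithinAt α (w t (α t)) (Icc 0 T) t := fun z => by
    have hPL : IsPicardLindelof w (tmin := 0) (tmax := T) ⟨0, le_rfl, hT⟩ z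
        (L * T).toNNReal 0 L.toNNReal κ.toNNReal := by
      refine ⟨fun t ht => LipschitzOnWith.of_dist_le_mul fun x _ y _ => ?_,
        fun x _ => hwt x, fun t ht x _ => ?_, ?_⟩
      · rw [Real.coe_toNNReal _ hκ]
        exact hwx t ht x y
      · rw [Real.coe_toNNReal _ hL]
        exact hw t ht x
      · rw [Real.coe_toNNReal _ hL, Real.coe_toNNReal _ (by positivity)]
        simp [hT]
    exact hPL.exists_eq_forall_mem_Icc_hasDerivWithinAt₀
  choose α hα0 hα using hex
  have hαc : ∀ z, Continuous fun t => w (clamp T t) (α z (clamp T t)) := fun z => by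
    have h1 : Continuous fun t => α z (clamp T t) := by
      have h2 : ContinuousOn (α z) (Icc 0 T) := fun t ht => (hα z t ht).continuousWithinAt
      exact h2.comp_continuous (continuous_clamp T) (clamp_mem hT)
    exact hwc.comp (continuous_id.prodMk h1)
  let X : ℝ → ℝ → ℝ := fun t z => z + ∫ s in (0 : ℝ)..t, w (clamp T s) (α z (clamp T s))
  have hXα : ∀ t ∈ Icc 0 T, ∀ z, X t z = α z t := fun t ht z => by
    have hsub : Icc 0 t ⊆ Icc 0 T := Icc_subset_Icc_right ht.2
    have := intervalIntegral.integral_eq_sub_of_hasDeriv_right_of_le ht.1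
      (f := α z) (f' := fun s => w (clamp T s) (α z (clamp T s)))
      (fun s hs => ((hα z s (hsub hs)).continuousWithinAt).mono hsub)
      (fun s hs => by
        rw [clamp_of_mem (hsub (Ioo_subset_Icc_self hs))]
        exact ((hα z s (hsub (Ioo_subset_Icc_self hs))).hasDerivAt
          (Icc_mem_nhds hs.1 (hs.2.trans_le ht.2))).hasDerivWithinAt)
      ((hαc z).intervalIntegrable _ _)
    simp only [X]
    rw [this, hα0]
    ring
  refine ⟨X, fun z => by simp [X], fun z => ?_, fun t z => ?_⟩
  · simpa only [hXα _ (clamp_mem hT _)] using hαc z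
  · rw [hXα _ (clamp_mem hT _)]
    exact ((hαc z).integral_hasStrictDerivAt 0 t).hasDerivAt.const_add z

end ode


section cutoff

theorem exists_abs_deriv_smoothTransition_le :
    ∃ c, 0 ≤ c ∧ ∀ x, |deriv Real.smoothTransition x| ≤ c := by
  have hc : Continuous (deriv Real.smoothTransition) :=
    (Real.smoothTransition.contDiff (n := 1)).continuous_deriv le_rfl
  obtain ⟨c, hc⟩ := isCompact_Icc.exists_bound_of_continuousOn (s := Icc (0 : ℝ) 1)
    hc.continuousOn
  refine ⟨max c 0, le_max_right _ _, fun x => ?_⟩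
  by_cases hx : x ∈ Icc (0 : ℝ) 1
  · exact (hc x hx).trans (le_max_left _ _)
  · have : deriv Real.smoothTransition x = 0 := by
      rw [mem_Icc, not_and_or, not_le, not_le] at hx
      rcases hx with hx | hx
      · have : Real.smoothTransition =ᶠ[𝓝 x] fun _ => 0 := by
          filter_upwards [Iio_mem_nhds hx] with y hy
          exact Real.smoothTransition.zero_of_nonpos (le_of_lt hy)
        rw [this.deriv_eq, deriv_const]
      · have : Real.smoothTransition =ᶠ[𝓝 x] fun _ => 1 := by
          filter_upwards [Ioi_mem_nhds hx] with y hy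
          exact Real.smoothTransition.one_of_one_le (le_of_lt hy)
        rw [this.deriv_eq, deriv_const]
    rw [this, abs_zero]
    exact le_max_right _ _

theorem deriv_smoothTransition_eq_zero {x : ℝ} (hx : x ∉ Icc (0 : ℝ) 1) :
    deriv Real.smoothTransition x = 0 := by
  rw [mem_Icc, not_and_or, not_le, not_le] at hx
  rcases hx with hx | hx
  · have : Real.smoothTransition =ᶠ[𝓝 x] fun _ => 0 := by
      filter_upwards [Iio_mem_nhds hx] with y hy
      exact Real.smoothTransition.zero_of_nonpos (le_of_lt hy)
    rw [this.deriv_eq, deriv_const]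
  · have : Real.smoothTransition =ᶠ[𝓝 x] fun _ => 1 := by
      filter_upwards [Ioi_mem_nhds hx] with y hy
      exact Real.smoothTransition.one_of_one_le (le_of_lt hy)
    rw [this.deriv_eq, deriv_const]

/-- The smooth step of width `ε` at `a`. -/
noncomputable def step (ε a x : ℝ) : ℝ := Real.smoothTransition ((x - a) / ε)

/-- The derivative of the smooth step of width `ε` at `a`. -/
noncomputable def stepDeriv (ε a x : ℝ) : ℝ := deriv Real.smoothTransition ((x - a) / ε) / ε

variable {ε a : ℝ}

theorem step_of_le (hε : 0 < ε) {x : ℝ} (h : x ≤ a) : step ε a x = 0 :=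
  Real.smoothTransition.zero_of_nonpos (div_nonpos_of_nonpos_of_nonneg (by linarith) hε.le)

theorem step_of_ge (hε : 0 < ε) {x : ℝ} (h : a + ε ≤ x) : step ε a x = 1 :=
  Real.smoothTransition.one_of_one_le ((one_le_div hε).2 (by linarith))

theorem stepDeriv_of_notMem (hε : 0 < ε) {x : ℝ} (h : x ∉ Icc a (a + ε)) :
    stepDeriv ε a x = 0 := by
  rw [stepDeriv, deriv_smoothTransition_eq_zero, zero_div]
  rintro ⟨h1, h2⟩
  refine h ⟨?_, ?_⟩
  · have := (le_div_iff₀ hε).1 h1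
    linarith
  · have := (div_le_iff₀ hε).1 h2
    linarith

theorem abs_step_sub_le (hε : 0 < ε) (x : ℝ) :
    |step ε a x - (Ioi a).indicator 1 x| ≤ (Icc a (a + ε)).indicator 1 x := by
  by_cases hx : x ∈ Icc a (a + ε)
  · rw [indicator_of_mem hx, Pi.one_apply]
    have h1 : 0 ≤ step ε a x := Real.smoothTransition.nonneg _
    have h2 : step ε a x ≤ 1 := Real.smoothTransition.le_one _
    by_cases hx' : x ∈ Ioi a
    · rw [indicator_of_mem hx', Pi.one_apply, abs_le]
      constructor <;> linarith
    · rw [indicator_of_notMem hx', abs_le]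
      constructor <;> linarith
  · rw [indicator_of_notMem hx]
    rw [mem_Icc, not_and_or, not_le, not_le] at hx
    rcases hx with hx | hx
    · rw [step_of_le hε hx.le, indicator_of_notMem (by simp [hx.le])]
      simp
    · rw [step_of_ge hε hx.le, indicator_of_mem (by simp; linarith)]
      simp

theorem abs_stepDeriv_mul_le {c κ : ℝ} (hc : ∀ x, |deriv Real.smoothTransition x| ≤ c)
    (hc0 : 0 ≤ c) (hε : 0 < ε) {v : ℝ → ℝ} (hκ : 0 ≤ κ) (hv : ∀ x y, |v x - v y| ≤ κ * |x - y|)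
    (x : ℝ) : |stepDeriv ε a x * (v x - v a)| ≤ c * κ * (Icc a (a + ε)).indicator 1 x := by
  by_cases hx : x ∈ Icc a (a + ε)
  · rw [indicator_of_mem hx, Pi.one_apply, mul_one, abs_mul, stepDeriv, abs_div, abs_of_pos hε]
    have h1 : |v x - v a| ≤ κ * ε := (hv x a).trans (mul_le_mul_of_nonneg_left
      (abs_le.2 ⟨by linarith [hx.1], by linarith [hx.2]⟩) hκ)
    calc _ ≤ c / ε * (κ * ε) := by
          gcongr
          exact hc _
      _ = c * κ := by field_simp
  · rw [stepDeriv_of_notMem hε hx, indicator_of_notMem hx]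
    simp

theorem contDiff_step {α : ℝ → ℝ} (hα : ContDiff ℝ 1 α) :
    ContDiff ℝ 1 fun x : ℝ × ℝ => step ε (α x.1) x.2 :=
  Real.smoothTransition.contDiff.comp
    ((contDiff_snd.sub (hα.comp contDiff_fst)).div_const ε)

theorem continuous_stepDeriv {α : ℝ → ℝ} (hα : Continuous α) :
    Continuous fun x : ℝ × ℝ => stepDeriv ε (α x.1) x.2 := by
  have hc : Continuous (deriv Real.smoothTransition) :=
    (Real.smoothTransition.contDiff (n := 1)).continuous_deriv le_rfl
  exact (hc.comp ((continuous_snd.sub (hα.comp continuous_fst)).div_const ε)).div_const ε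

theorem hasDerivAt_smoothTransition (x : ℝ) :
    HasDerivAt Real.smoothTransition (deriv Real.smoothTransition x) x :=
  ((Real.smoothTransition.contDiff (n := 1)).differentiable one_ne_zero x).hasDerivAt

theorem hasDerivAt_step_right (x : ℝ) : HasDerivAt (step ε a) (stepDeriv ε a x) x := by
  have h1 := ((hasDerivAt_id x).sub_const a).div_const ε
  have := (hasDerivAt_smoothTransition ((x - a) / ε)).comp x h1
  refine this.congr_deriv ?_
  rw [stepDeriv]
  ring

theorem hasDerivAt_step_left {α : ℝ → ℝ} {α' t : ℝ} (hα : HasDerivAt α α' t) (x : ℝ) :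
    HasDerivAt (fun t => step ε (α t) x) (-(stepDeriv ε (α t) x * α')) t := by
  have h1 := (hα.const_sub x).div_const ε
  have := (hasDerivAt_smoothTransition ((x - α t) / ε)).comp t h1
  refine this.congr_deriv ?_
  rw [stepDeriv]
  ring

end cutoff

section conservation

variable {T M K κ : ℝ} {p v : ℝ → ℝ → ℝ} {q₀ α β α' β' : ℝ → ℝ}

theorem indicator_Ioc_eq_sub {a b : ℝ} (h : a ≤ b) (x : ℝ) :
    (Ioc a b).indicator (1 : ℝ → ℝ) x = (Ioi a).indicator 1 x - (Ioi b).indicator 1 x := by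
  simp only [indicator_apply, mem_Ioc, mem_Ioi, Pi.one_apply]
  split_ifs <;> first | (exfalso; grind) | norm_num

theorem indicator_uIoc_eq_abs (a b x : ℝ) :
    (uIoc a b).indicator (1 : ℝ → ℝ) x = |(Ioi a).indicator 1 x - (Ioi b).indicator 1 x| := by
  rcases le_total a b with h | h
  · rw [uIoc_of_le h, indicator_Ioc_eq_sub h, abs_of_nonneg]
    rw [← indicator_Ioc_eq_sub h]
    exact indicator_nonneg (fun _ _ => zero_le_one) x
  · rw [uIoc_of_ge h, indicator_Ioc_eq_sub h, abs_sub_comm, abs_of_nonneg]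
    rw [← indicator_Ioc_eq_sub h]
    exact indicator_nonneg (fun _ _ => zero_le_one) x

theorem tendsto_integral_indicator_sub {α β : ℝ → ℝ} (hα : Continuous α) (hβ : Continuous β)
    (t : ℝ) (hαβ : ∀ s, α s ≤ β s) :
    Tendsto (fun s => ∫ x, |(Ioc (α s) (β s)).indicator (1 : ℝ → ℝ) x -
      (Ioc (α t) (β t)).indicator 1 x|) (𝓝 t) (𝓝 0) := by
  have hind : ∀ a b : ℝ, Integrable ((uIoc a b).indicator (1 : ℝ → ℝ)) := fun a b =>
    (integrable_indicator_iff measurableSet_uIoc).2 (integrableOn_const (by simp [uIoc]))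
  have hpt : ∀ s x, |(Ioc (α s) (β s)).indicator (1 : ℝ → ℝ) x -
      (Ioc (α t) (β t)).indicator 1 x| ≤ (uIoc (α s) (α t)).indicator 1 x +
        (uIoc (β s) (β t)).indicator 1 x := by
    intro s x
    rw [indicator_Ioc_eq_sub (hαβ s), indicator_Ioc_eq_sub (hαβ t), indicator_uIoc_eq_abs,
      indicator_uIoc_eq_abs, sub_sub_sub_comm]
    exact abs_sub _ _
  have hb : ∀ s, ∫ x, |(Ioc (α s) (β s)).indicator (1 : ℝ → ℝ) x -
      (Ioc (α t) (β t)).indicator 1 x| ≤ |α t - α s| + |β t - β s| := fun s => by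
    refine (integral_mono_of_nonneg (Eventually.of_forall fun x => abs_nonneg _)
      ((hind _ _).add (hind _ _)) (Eventually.of_forall (hpt s))).trans (le_of_eq ?_)
    simp only [Pi.add_apply]
    rw [integral_add (hind _ _) (hind _ _), integral_indicator_one measurableSet_uIoc,
      integral_indicator_one measurableSet_uIoc]
    simp [measureReal_def, Real.volume_uIoc]
  refine squeeze_zero (fun s => integral_nonneg fun x => abs_nonneg _) hb ?_
  have h1 : Continuous fun s => |α t - α s| + |β t - β s| := by fun_prop
  have h2 := h1.tendsto t
  simpa using h2

/-- The multiplier of the solution in the weak formulation for the test function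
`θ(t) (step (α t) x - step (β t) x)`. -/
noncomputable def multiplier (ε : ℝ) (θ α β α' β' : ℝ → ℝ) (v : ℝ → ℝ → ℝ) (t x : ℝ) : ℝ :=
  deriv θ t * (step ε (α t) x - step ε (β t) x) +
    θ t * (stepDeriv ε (α t) x * (v t x - α' t) - stepDeriv ε (β t) x * (v t x - β' t))

variable (hp : ∀ r : ℝ, IsContinuousInLp T 1 (volume.restrict (Icc (-r) r)) p)
  (hM : ∀ t ∈ Icc 0 T, ∀ᵐ x, |p t x| ≤ M) (hM0 : 0 ≤ M) (hκ : 0 ≤ κ)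
  (hv : ∀ t ∈ Icc 0 T, ∀ x y, |v t x - v t y| ≤ κ * |x - y|)
  (hvc : Continuous fun x : ℝ × ℝ => v (clamp T x.1) x.2)
  (hαd : ∀ t, HasDerivAt α (α' t) t) (hα'c : Continuous α')
  (hβd : ∀ t, HasDerivAt β (β' t) t) (hβ'c : Continuous β')
  (hα : ∀ t ∈ Icc 0 T, α' t = v t (α t)) (hβ : ∀ t ∈ Icc 0 T, β' t = v t (β t))
  (hαβ : ∀ t ∈ Icc 0 T, α t ≤ β t)

theorem integrable_indicator_Icc (a b : ℝ) :
    Integrable ((Icc a b).indicator (1 : ℝ → ℝ)) :=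
  (integrable_indicator_iff measurableSet_Icc).2 (integrableOn_const (by simp))

theorem integrable_indicator_Ioc (a b : ℝ) :
    Integrable ((Ioc a b).indicator (1 : ℝ → ℝ)) :=
  (integrable_indicator_iff measurableSet_Ioc).2 (integrableOn_const (by simp))

include hv hκ hα hβ hαβ in
theorem abs_multiplier_sub_le {c ε : ℝ} (hc : ∀ x, |deriv Real.smoothTransition x| ≤ c)
    (hc0 : 0 ≤ c) (hε : 0 < ε) (θ : ℝ → ℝ) {t : ℝ} (ht : t ∈ Icc 0 T) (x : ℝ) :
    |multiplier ε θ α β α' β' v t x - deriv θ t * (Ioc (α t) (β t)).indicator 1 x| ≤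
      (|deriv θ t| + |θ t| * (c * κ)) * ((Icc (α t) (α t + ε)).indicator 1 x +
        (Icc (β t) (β t + ε)).indicator 1 x) := by
  rw [multiplier, hα t ht, hβ t ht, indicator_Ioc_eq_sub (hαβ t ht)]
  have a1 := abs_step_sub_le (a := α t) hε x
  have b1 := abs_step_sub_le (a := β t) hε x
  have a2 := abs_stepDeriv_mul_le (a := α t) hc hc0 hε hκ (hv t ht) x
  have b2 := abs_stepDeriv_mul_le (a := β t) hc hc0 hε hκ (hv t ht) x
  set A := (Icc (α t) (α t + ε)).indicator (1 : ℝ → ℝ) x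
  set B := (Icc (β t) (β t + ε)).indicator (1 : ℝ → ℝ) x
  set A' := (Ioi (α t)).indicator (1 : ℝ → ℝ) x
  set B' := (Ioi (β t)).indicator (1 : ℝ → ℝ) x
  set u := step ε (α t) x
  set w := step ε (β t) x
  set P := stepDeriv ε (α t) x * (v t x - v t (α t))
  set Q := stepDeriv ε (β t) x * (v t x - v t (β t))
  have e : deriv θ t * (u - w) + θ t * (P - Q) - deriv θ t * (A' - B') =
      deriv θ t * ((u - A') - (w - B')) + θ t * (P - Q) := by ring
  rw [e]
  have h1 : |(u - A') - (w - B')| ≤ A + B := (abs_sub _ _).trans (add_le_add a1 b1)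
  have h2 : |P - Q| ≤ c * κ * (A + B) := (abs_sub _ _).trans ((add_le_add a2 b2).trans
    (le_of_eq (by ring)))
  calc _ ≤ |deriv θ t| * |(u - A') - (w - B')| + |θ t| * |P - Q| := by
        rw [← abs_mul, ← abs_mul]; exact abs_add_le _ _
    _ ≤ |deriv θ t| * (A + B) + |θ t| * (c * κ * (A + B)) := by gcongr
    _ = _ := by ring

end conservation


/-- Trajectories of the velocity field `v` on `[0, T]`, continued with constant speed. -/
structure IsTrajectory (T : ℝ) (v : ℝ → ℝ → ℝ) (α α' : ℝ → ℝ) : Prop where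
  continuous : Continuous α'
  hasDerivAt : ∀ t, HasDerivAt α (α' t) t
  eq : ∀ t ∈ Icc 0 T, α' t = v t (α t)

section testFunction

variable {T : ℝ} {v : ℝ → ℝ → ℝ} {α β α' β' θ : ℝ → ℝ} {ε : ℝ}

theorem IsTrajectory.contDiff (hα : IsTrajectory T v α α') : ContDiff ℝ 1 α := by
  rw [contDiff_one_iff_deriv]
  refine ⟨fun t => (hα.hasDerivAt t).differentiableAt, ?_⟩
  rw [show deriv α = α' from funext fun t => (hα.hasDerivAt t).deriv]
  exact hα.continuous

/-- A test function approximating `θ(t)` times the indicator of `(α t, β t]`. -/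
noncomputable def stripTest (ε : ℝ) (θ α β : ℝ → ℝ) (x : ℝ × ℝ) : ℝ :=
  θ x.1 * (step ε (α x.1) x.2 - step ε (β x.1) x.2)

theorem contDiff_stripTest (hθ : ContDiff ℝ 1 θ) (hα : ContDiff ℝ 1 α) (hβ : ContDiff ℝ 1 β) :
    ContDiff ℝ 1 (stripTest ε θ α β) :=
  (hθ.comp contDiff_fst).mul ((contDiff_step hα).sub (contDiff_step hβ))

theorem exists_strip_bound (hθ : HasCompactSupport θ) (hα : Continuous α) (hβ : Continuous β)
    (hε : 0 < ε) : ∃ r, ∀ t ∈ tsupport θ, ∀ x, r < |x| →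
      (step ε (α t) x = step ε (β t) x ∧ stepDeriv ε (α t) x = 0 ∧ stepDeriv ε (β t) x = 0) := by
  obtain ⟨a, ha⟩ := hθ.isCompact.exists_bound_of_continuousOn hα.continuousOn
  obtain ⟨b, hb⟩ := hθ.isCompact.exists_bound_of_continuousOn hβ.continuousOn
  refine ⟨max a b + ε, fun t ht x hx => ?_⟩
  have h1 := abs_le.1 ((ha t ht).trans (le_max_left a b))
  have h2 := abs_le.1 ((hb t ht).trans (le_max_right a b))
  rcases lt_abs.1 hx with h | h
  · refine ⟨?_, stepDeriv_of_notMem hε fun h' => ?_, stepDeriv_of_notMem hε fun h' => ?_⟩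
    · rw [step_of_ge hε (by linarith [h1.2]), step_of_ge hε (by linarith [h2.2])]
    · linarith [h'.2, h1.2]
    · linarith [h'.2, h2.2]
  · refine ⟨?_, stepDeriv_of_notMem hε fun h' => ?_, stepDeriv_of_notMem hε fun h' => ?_⟩
    · rw [step_of_le hε (by linarith [h1.1]), step_of_le hε (by linarith [h2.1])]
    · linarith [h'.1, h1.1]
    · linarith [h'.1, h2.1]

theorem support_stripTest (hθ : HasCompactSupport θ) (hα : Continuous α) (hβ : Continuous β)
    (hε : 0 < ε) :
    HasCompactSupport (stripTest ε θ α β) ∧ tsupport (stripTest ε θ α β) ⊆ tsupport θ ×ˢ univ := by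
  obtain ⟨r, hr⟩ := exists_strip_bound hθ hα hβ hε
  constructor
  · refine HasCompactSupport.intro (hθ.isCompact.prod (isCompact_Icc (a := -r) (b := r)))
      fun x hx => ?_
    rw [stripTest]
    by_cases ht : x.1 ∈ tsupport θ
    · have hx2 : r < |x.2| := by
        by_contra! h
        exact hx ⟨ht, abs_le.1 h⟩
      rw [(hr _ ht _ hx2).1, sub_self, mul_zero]
    · rw [image_eq_zero_of_notMem_tsupport ht, zero_mul]
  · refine closure_minimal (fun x hx => ⟨?_, mem_univ _⟩)
      ((isClosed_tsupport θ).prod isClosed_univ)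
    by_contra h
    exact hx (by rw [stripTest, image_eq_zero_of_notMem_tsupport h, zero_mul])

theorem deriv_stripTest (hθ : ContDiff ℝ 1 θ) (hα : IsTrajectory T v α α')
    (hβ : IsTrajectory T v β β') (t x : ℝ) :
    deriv (fun s => stripTest ε θ α β (s, x)) t +
      v t x * deriv (fun y => stripTest ε θ α β (t, y)) x = multiplier ε θ α β α' β' v t x := by
  have h1 : HasDerivAt θ (deriv θ t) t := (hθ.differentiable one_ne_zero t).hasDerivAt
  have h2 := h1.mul ((hasDerivAt_step_left (ε := ε) (hα.hasDerivAt t) x).sub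
    (hasDerivAt_step_left (ε := ε) (hβ.hasDerivAt t) x))
  have h3 := ((hasDerivAt_step_right (ε := ε) (a := α t) x).sub
    (hasDerivAt_step_right (ε := ε) (a := β t) x)).const_mul (θ t)
  have e1 : deriv (fun s => stripTest ε θ α β (s, x)) t = _ := h2.deriv
  have e2 : deriv (fun y => stripTest ε θ α β (t, y)) x = _ := h3.deriv
  rw [e1, e2, multiplier]
  simp only [Pi.sub_apply]
  ring

theorem multiplier_eq_zero (hθ : HasCompactSupport θ) (hα : Continuous α) (hβ : Continuous β)
    (hε : 0 < ε) : ∃ r, ∀ (w : ℝ → ℝ → ℝ) (t x : ℝ), r < |x| →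
      multiplier ε θ α β α' β' w t x = 0 := by
  obtain ⟨r, hr⟩ := exists_strip_bound hθ hα hβ hε
  refine ⟨r, fun w t x hx => ?_⟩
  rw [multiplier]
  by_cases ht : t ∈ tsupport θ
  · obtain ⟨h1, h2, h3⟩ := hr t ht x hx
    rw [h1, h2, h3]
    ring
  · rw [image_eq_zero_of_notMem_tsupport ht, image_eq_zero_of_notMem_tsupport fun h =>
      ht (tsupport_deriv_subset h)]
    ring

theorem continuous_multiplier (hθ : ContDiff ℝ 1 θ) (hα : IsTrajectory T v α α')
    (hβ : IsTrajectory T v β β') {w : ℝ → ℝ → ℝ} (hw : Continuous fun x : ℝ × ℝ => w x.1 x.2) :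
    Continuous fun x : ℝ × ℝ => multiplier ε θ α β α' β' w x.1 x.2 := by
  have h1 := (hθ.continuous_deriv le_rfl).comp (continuous_fst (X := ℝ) (Y := ℝ))
  have h2 := hθ.continuous.comp (continuous_fst (X := ℝ) (Y := ℝ))
  have h3 := (contDiff_step (ε := ε) hα.contDiff).continuous
  have h4 := (contDiff_step (ε := ε) hβ.contDiff).continuous
  have h5 := continuous_stepDeriv (ε := ε) hα.contDiff.continuous
  have h6 := continuous_stepDeriv (ε := ε) hβ.contDiff.continuous
  have h7 := hα.continuous.comp (continuous_fst (X := ℝ) (Y := ℝ))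
  have h8 := hβ.continuous.comp (continuous_fst (X := ℝ) (Y := ℝ))
  exact (h1.mul (h3.sub h4)).add (h2.mul ((h5.mul (hw.sub h7)).sub (h6.mul (hw.sub h8))))

end testFunction

section conservation

variable {T M K κ : ℝ} {p v : ℝ → ℝ → ℝ} {q₀ : ℝ → ℝ}

/-- A bounded weak solution of the linear continuity equation `∂ₜ p + ∂ₓ (p v) = 0` with a
velocity field that is continuous, and Lipschitz in space. -/
structure IsLinearSolution (T M K κ : ℝ) (v : ℝ → ℝ → ℝ) (q₀ : ℝ → ℝ) (p : ℝ → ℝ → ℝ) :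
    Prop where
  time_pos : 0 < T
  bound_nonneg : 0 ≤ M
  rate_nonneg : 0 ≤ κ
  continuous_L1_loc : ∀ r : ℝ, IsContinuousInLp T 1 (volume.restrict (Icc (-r) r)) p
  bounded : ∀ t ∈ Icc 0 T, ∀ᵐ x, |p t x| ≤ M
  speed_lipschitz : ∀ t ∈ Icc 0 T, ∀ x y, |v t x - v t y| ≤ κ * |x - y|
  speed_continuous : Continuous fun x : ℝ × ℝ => v (clamp T x.1) x.2
  datum : IsDensity K q₀
  weak_form : ∀ φ : ℝ × ℝ → ℝ, ContDiff ℝ 1 φ → HasCompactSupport φ →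
    tsupport φ ⊆ Iio T ×ˢ univ →
    (∫ t in (0 : ℝ)..T, ∫ x, p t x * (deriv (fun s => φ (s, x)) t +
        v t x * deriv (fun y => φ (t, y)) x))
      + ∫ x, q₀ x * φ (0, x) = 0

variable {α β α' β' θ : ℝ → ℝ} (h : IsLinearSolution T M K κ v q₀ p)
  (hα : IsTrajectory T v α α') (hβ : IsTrajectory T v β β')
  (hαβ : ∀ t ∈ Icc 0 T, α t ≤ β t)

include h hα hβ hαβ

theorem IsLinearSolution.continuousOn_mass :
    ContinuousOn (fun t => ∫ x in α t..β t, p t x) (Icc 0 T) := by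
  intro t ht
  have hT := h.time_pos.le
  have h1 := tendsto_integral_mul h.continuous_L1_loc h.bounded ht
    (ψ := fun s => (Ioc (α (clamp T s)) (β (clamp T s))).indicator 1)
    (fun s _ => integrable_indicator_Ioc _ _) (B := 1) (fun x => by
      simp only [indicator_apply, Pi.one_apply]
      split_ifs <;> simp)
    ((tendsto_integral_indicator_sub (hα.contDiff.continuous.comp (continuous_clamp T))
      (hβ.contDiff.continuous.comp (continuous_clamp T)) t
      fun s => hαβ _ (clamp_mem hT s)).mono_left nhdsWithin_le_nhds)
  have e : ∀ s ∈ Icc 0 T, ∫ x in α s..β s, p s x =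
      ∫ x, p s x * (Ioc (α (clamp T s)) (β (clamp T s))).indicator 1 x := fun s hs => by
    rw [clamp_of_mem hs, intervalIntegral.integral_of_le (hαβ s hs),
      ← integral_indicator measurableSet_Ioc]
    refine integral_congr_ae (Eventually.of_forall fun x => ?_)
    simp [indicator_apply]
  rw [ContinuousWithinAt, e t ht]
  refine h1.congr' ?_
  filter_upwards [self_mem_nhdsWithin] with s hs using (e s hs).symm

theorem IsLinearSolution.abs_integral_multiplier_sub_le {c ε B : ℝ}
    (hc : ∀ x, |deriv Real.smoothTransition x| ≤ c) (hc0 : 0 ≤ c) (hε : 0 < ε)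
    (hθ : ContDiff ℝ 1 θ) (hθc : HasCompactSupport θ)
    (hB : ∀ t, |deriv θ t| + |θ t| * (c * κ) ≤ B) {t : ℝ} (ht : t ∈ Icc 0 T) :
    |(∫ x, p t x * multiplier ε θ α β α' β' v t x) - deriv θ t * ∫ x in α t..β t, p t x| ≤
      M * (B * (2 * ε)) := by
  have hM := h.bound_nonneg
  have hT := h.time_pos.le
  set χ := (Ioc (α t) (β t)).indicator (1 : ℝ → ℝ) with hχ
  have hχi : Integrable χ := integrable_indicator_Ioc _ _
  have e1 : deriv θ t * ∫ x in α t..β t, p t x = ∫ x, p t x * (deriv θ t * χ x) := by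
    rw [intervalIntegral.integral_of_le (hαβ t ht), ← integral_indicator measurableSet_Ioc,
      ← integral_const_mul]
    refine integral_congr_ae (Eventually.of_forall fun x => ?_)
    simp only [hχ, indicator_apply]
    split_ifs <;> simp [mul_comm]
  obtain ⟨r, hr⟩ := multiplier_eq_zero (α' := α') (β' := β') hθc hα.contDiff.continuous
    hβ.contDiff.continuous hε
  have hmi : Integrable fun x => multiplier ε θ α β α' β' v t x := by
    have hcont := (continuous_multiplier (ε := ε) hθ hα hβ (w := fun t => v (clamp T t)) h.speed_continuous).comp
      (Continuous.prodMk_right t)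
    have e2 : ((fun x : ℝ × ℝ => multiplier ε θ α β α' β' (fun t => v (clamp T t)) x.1 x.2) ∘
        fun x => (t, x)) = fun x => multiplier ε θ α β α' β' v t x := by
      ext x
      simp only [Function.comp, multiplier, clamp_of_mem ht]
    rw [e2] at hcont
    refine hcont.integrable_of_hasCompactSupport
      (HasCompactSupport.intro (isCompact_Icc (a := -r) (b := r)) fun x hx => hr v t x ?_)
    by_contra! h'
    exact hx (abs_le.1 h')
  have hdi : Integrable fun x => multiplier ε θ α β α' β' v t x - deriv θ t * χ x :=
    hmi.sub (hχi.const_mul _)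
  have e3 : (∫ x, p t x * multiplier ε θ α β α' β' v t x) - ∫ x, p t x * (deriv θ t * χ x) =
      ∫ x, p t x * (multiplier ε θ α β α' β' v t x - deriv θ t * χ x) := by
    rw [← integral_sub (integrable_mul_of_bounded h.continuous_L1_loc h.bounded ht hmi)
      (integrable_mul_of_bounded h.continuous_L1_loc h.bounded ht (hχi.const_mul _))]
    simp only [mul_sub]
  rw [e1, e3]
  refine (abs_integral_mul_le h.continuous_L1_loc h.bounded ht hdi).trans
    (mul_le_mul_of_nonneg_left ?_ hM)
  have hI := integrable_indicator_Icc (α t) (α t + ε)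
  have hJ := integrable_indicator_Icc (β t) (β t + ε)
  have hB0 : 0 ≤ |deriv θ t| + |θ t| * (c * κ) := by have := h.rate_nonneg; positivity
  refine (integral_mono_ae hdi.abs ((hI.add hJ).const_mul B)
    (Eventually.of_forall fun x => ?_)).trans (le_of_eq ?_)
  · refine (abs_multiplier_sub_le h.rate_nonneg h.speed_lipschitz hα.eq hβ.eq hαβ hc hc0 hε θ ht
      x).trans (mul_le_mul_of_nonneg_right (hB t) (add_nonneg ?_ ?_)) <;>
    exact indicator_nonneg (fun _ _ => zero_le_one) x
  · simp only [Pi.add_apply]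
    rw [integral_const_mul, integral_add hI hJ, integral_indicator_one measurableSet_Icc,
      integral_indicator_one measurableSet_Icc]
    simp only [Real.volume_real_Icc, add_sub_cancel_left, max_eq_left hε.le]
    ring

theorem IsLinearSolution.integral_deriv_mul_mass (hθ : ContDiff ℝ 1 θ)
    (hθc : HasCompactSupport θ) (hθT : tsupport θ ⊆ Iio T) :
    (∫ t in (0 : ℝ)..T, deriv θ t * ∫ x in α t..β t, p t x) +
      θ 0 * ∫ x in α 0..β 0, q₀ x = 0 := by
  have hT := h.time_pos
  have hM := h.bound_nonneg
  have hκ := h.rate_nonneg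
  have hK := h.datum.bound_nonneg
  have h0 : (0 : ℝ) ∈ Icc 0 T := ⟨le_rfl, hT.le⟩
  obtain ⟨c, hc0, hc⟩ := exists_abs_deriv_smoothTransition_le
  obtain ⟨B₁, hB₁⟩ := (hθc.deriv).exists_bound_of_continuous (hθ.continuous_deriv le_rfl)
  obtain ⟨B₂, hB₂⟩ := hθc.exists_bound_of_continuous hθ.continuous
  set B := B₁ + B₂ * (c * κ) with hBdef
  have hB : ∀ t, |deriv θ t| + |θ t| * (c * κ) ≤ B := fun t =>
    add_le_add (hB₁ t) (mul_le_mul_of_nonneg_right (hB₂ t) (by positivity))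
  have hB0 : 0 ≤ B := le_trans (by positivity) (hB 0)
  set m : ℝ → ℝ := fun t => ∫ x in α t..β t, p t x with hm
  have hmc : ContinuousOn m (Icc 0 T) := h.continuousOn_mass hα hβ hαβ
  set R := (∫ t in (0 : ℝ)..T, deriv θ t * m t) + θ 0 * ∫ x in α 0..β 0, q₀ x with hR
  have key : ∀ ε > 0, |R| ≤ (T * (M * (B * 2)) + K * (|θ 0| * 2)) * ε := by
    intro ε hε
    obtain ⟨hsc, hst⟩ := support_stripTest hθc hα.contDiff.continuous hβ.contDiff.continuous hε
    have hw := h.weak_form _ (contDiff_stripTest (ε := ε) hθ hα.contDiff hβ.contDiff) hsc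
      (hst.trans (prod_mono hθT subset_rfl))
    simp only [deriv_stripTest hθ hα hβ] at hw
    obtain ⟨r, hr⟩ := multiplier_eq_zero (α' := α') (β' := β') hθc hα.contDiff.continuous
      hβ.contDiff.continuous hε
    have hFc : ContinuousOn (fun t => ∫ x, p t x * multiplier ε θ α β α' β' v t x)
        (Icc 0 T) := by
      refine (continuousOn_integral_mul h.continuous_L1_loc h.bounded
        (continuous_multiplier (ε := ε) hθ hα hβ (w := fun t => v (clamp T t)) h.speed_continuous)
        (fun t x => hr _ t x)).congr fun t ht => ?_
      simp only [multiplier, clamp_of_mem ht]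
    have i1 : IntervalIntegrable (fun t => ∫ x, p t x * multiplier ε θ α β α' β' v t x)
        volume 0 T := (by rwa [uIcc_of_le hT.le] : ContinuousOn _ (uIcc 0 T)).intervalIntegrable
    have i2 : IntervalIntegrable (fun t => deriv θ t * m t) volume 0 T :=
      (by
        rw [uIcc_of_le hT.le]
        exact (hθ.continuous_deriv le_rfl).continuousOn.mul hmc :
        ContinuousOn _ (uIcc 0 T)).intervalIntegrable
    have b1 : ‖∫ t in (0 : ℝ)..T, ((∫ x, p t x * multiplier ε θ α β α' β' v t x) -
        deriv θ t * m t)‖ ≤ M * (B * (2 * ε)) * |T - 0| := by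
      refine intervalIntegral.norm_integral_le_of_norm_le_const fun t ht => ?_
      rw [uIoc_of_le hT.le] at ht
      exact h.abs_integral_multiplier_sub_le hα hβ hαβ hc hc0 hε hθ hθc hB
        (Ioc_subset_Icc_self ht)
    rw [intervalIntegral.integral_sub i1 i2, sub_zero, abs_of_pos hT, Real.norm_eq_abs] at b1
    have b2 : |(∫ x, q₀ x * stripTest ε θ α β (0, x)) - θ 0 * ∫ x in α 0..β 0, q₀ x| ≤
        K * (|θ 0| * (2 * ε)) := by
      set χ := (Ioc (α 0) (β 0)).indicator (1 : ℝ → ℝ) with hχ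
      have hχi : Integrable χ := integrable_indicator_Ioc _ _
      have hq₀b : ∀ᵐ x, ‖q₀ x‖ ≤ K := Eventually.of_forall fun x => by
        rw [Real.norm_of_nonneg (h.datum.nonneg x)]
        exact h.datum.le x
      have e1 : θ 0 * ∫ x in α 0..β 0, q₀ x = ∫ x, q₀ x * (θ 0 * χ x) := by
        rw [intervalIntegral.integral_of_le (hαβ 0 h0), ← integral_indicator measurableSet_Ioc,
          ← integral_const_mul]
        refine integral_congr_ae (Eventually.of_forall fun x => ?_)
        simp only [hχ, indicator_apply]
        split_ifs <;> simp [mul_comm]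
      have hsi : Integrable fun x => stripTest ε θ α β (0, x) := by
        have h1 := (contDiff_stripTest (ε := ε) hθ hα.contDiff hβ.contDiff).continuous.comp
          (Continuous.prodMk_right 0)
        refine h1.integrable_of_hasCompactSupport ?_
        refine hsc.comp_isClosedEmbedding (Isometry.isClosedEmbedding fun x y => ?_)
        simp [Prod.edist_eq]
      have i3 : Integrable fun x => q₀ x * stripTest ε θ α β (0, x) :=
        hsi.bdd_mul h.datum.measurable.aestronglyMeasurable hq₀b
      have i4 : Integrable fun x => q₀ x * (θ 0 * χ x) :=
        (hχi.const_mul _).bdd_mul h.datum.measurable.aestronglyMeasurable hq₀b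
      have hI := integrable_indicator_Icc (α 0) (α 0 + ε)
      have hJ := integrable_indicator_Icc (β 0) (β 0 + ε)
      rw [e1, ← integral_sub i3 i4]
      refine abs_integral_le_integral_abs.trans ((integral_mono_ae (i3.sub i4).abs
        (((hI.add hJ).const_mul |θ 0|).const_mul K)
        (Eventually.of_forall fun x => ?_)).trans (le_of_eq ?_))
      · simp only [Pi.sub_apply, Pi.add_apply]
        rw [← mul_sub, abs_mul, abs_of_nonneg (h.datum.nonneg x), stripTest, ← mul_sub, abs_mul,
          hχ, indicator_Ioc_eq_sub (hαβ 0 h0), sub_sub_sub_comm]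
        have a1 := abs_step_sub_le (a := α 0) hε x
        have a2 := abs_step_sub_le (a := β 0) hε x
        refine mul_le_mul (h.datum.le x) ?_ (by positivity) hK
        exact mul_le_mul_of_nonneg_left ((abs_sub _ _).trans (add_le_add a1 a2)) (abs_nonneg _)
      · simp only [Pi.add_apply]
        rw [integral_const_mul, integral_const_mul, integral_add hI hJ,
          integral_indicator_one measurableSet_Icc, integral_indicator_one measurableSet_Icc]
        simp only [Real.volume_real_Icc, add_sub_cancel_left, max_eq_left hε.le]
        ring
    have h1 := abs_le.1 b1
    have h2 := abs_le.1 b2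
    rw [abs_le]
    constructor <;> linarith [h1.1, h1.2, h2.1, h2.2]
  have hlim : Tendsto (fun ε => (T * (M * (B * 2)) + K * (|θ 0| * 2)) * ε) (𝓝[>] 0) (𝓝 0) := by
    have : Tendsto (fun ε => (T * (M * (B * 2)) + K * (|θ 0| * 2)) * ε) (𝓝 0)
        (𝓝 ((T * (M * (B * 2)) + K * (|θ 0| * 2)) * 0)) := tendsto_id.const_mul _
    rw [mul_zero] at this
    exact this.mono_left nhdsWithin_le_nhds
  exact abs_nonpos_iff.1 (ge_of_tendsto hlim (by
    filter_upwards [self_mem_nhdsWithin] with ε hε using key ε hε))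

end conservation


section mass

variable {T M K κ : ℝ} {p v : ℝ → ℝ → ℝ} {q₀ α β α' β' : ℝ → ℝ}

theorem stepDeriv_nonneg {ε a x : ℝ} (hε : 0 < ε) : 0 ≤ stepDeriv ε a x :=
  div_nonneg (Real.smoothTransition.monotone.deriv_nonneg) hε.le

theorem IsLinearSolution.mass_eq (h : IsLinearSolution T M K κ v q₀ p)
    (hα : IsTrajectory T v α α') (hβ : IsTrajectory T v β β')
    (hαβ : ∀ t ∈ Icc 0 T, α t ≤ β t) {t : ℝ} (ht : t ∈ Icc 0 T) :
    ∫ x in α t..β t, p t x = ∫ x in α 0..β 0, q₀ x := by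
  have hT := h.time_pos
  set m : ℝ → ℝ := fun t => ∫ x in α t..β t, p t x with hm
  set m₀ := ∫ x in α 0..β 0, q₀ x with hm₀
  have hmc : ContinuousOn m (Icc 0 T) := h.continuousOn_mass hα hβ hαβ
  have key : ∀ t ∈ Ico 0 T, m t = m₀ := by
    intro t ht
    have htI : t ∈ Icc 0 T := Ico_subset_Icc_self ht
    refine eq_of_forall_dist_le fun ε hε => ?_
    obtain ⟨δ₁, hδ₁0, hδ₁⟩ := Metric.continuousOn_iff.1 hmc t htI ε hε
    set δ := min (δ₁ / 2) ((T - t) / 2) with hδ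
    have hδ0 : 0 < δ := lt_min (by positivity) (by linarith [ht.2])
    have hδ1 : δ < δ₁ := (min_le_left _ _).trans_lt (half_lt_self hδ₁0)
    have hδT : t + δ < T := by
      have : δ ≤ (T - t) / 2 := min_le_right _ _
      linarith [ht.2]
    set θ : ℝ → ℝ := fun s => step 1 (-2) s * (1 - step δ t s) with hθ
    have hstep : ∀ ε a, ContDiff ℝ 1 (step ε a) := fun ε a =>
      (contDiff_step (ε := ε) (α := fun _ => a) contDiff_const).comp
        (ContDiff.prodMk (contDiff_const (c := (0 : ℝ))) contDiff_id)
    have hθd : ContDiff ℝ 1 θ := (hstep _ _).mul (contDiff_const.sub (hstep _ _))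
    have hzero : ∀ s, s ∉ Icc (-2) (t + δ) → θ s = 0 := fun s hs => by
      rw [mem_Icc, not_and_or, not_le, not_le] at hs
      rcases hs with hs | hs
      · simp only [hθ]
        rw [step_of_le one_pos hs.le, zero_mul]
      · simp only [hθ]
        rw [step_of_ge hδ0 hs.le, sub_self, mul_zero]
    have hθc : HasCompactSupport θ := HasCompactSupport.intro isCompact_Icc hzero
    have hθT : tsupport θ ⊆ Iio T := by
      refine (closure_minimal (fun s hs => ?_) isClosed_Icc : tsupport θ ⊆ Icc (-2) (t + δ)).trans
        fun s hs => hs.2.trans_lt hδT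
      by_contra h'
      exact hs (hzero s h')
    have hw := h.integral_deriv_mul_mass hα hβ hαβ hθd hθc hθT
    have hθ0 : θ 0 = 1 := by
      simp only [hθ]
      rw [step_of_ge one_pos (by norm_num), step_of_le hδ0 ht.1]
      norm_num
    have hθ' : ∀ s ∈ Icc 0 T, deriv θ s = -stepDeriv δ t s := fun s hs => by
      have h1 : θ =ᶠ[𝓝 s] fun s => 1 - step δ t s := by
        filter_upwards [Ioi_mem_nhds (show (-1 : ℝ) < s by linarith [hs.1])] with r hr
        simp only [hθ]
        rw [step_of_ge one_pos (by linarith [mem_Ioi.1 hr]), one_mul]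
      rw [h1.deriv_eq]
      exact ((hasDerivAt_step_right (ε := δ) (a := t) s).const_sub 1).deriv
    have hsc : Continuous (stepDeriv δ t) :=
      (continuous_stepDeriv (ε := δ) (α := fun _ => t) continuous_const).comp
        (Continuous.prodMk_right 0)
    have hs1 : ∫ s in (0 : ℝ)..T, stepDeriv δ t s = 1 := by
      rw [intervalIntegral.integral_eq_sub_of_hasDerivAt
        (fun s _ => hasDerivAt_step_right (ε := δ) (a := t) s) (hsc.intervalIntegrable _ _),
        step_of_ge hδ0 hδT.le, step_of_le hδ0 ht.1, sub_zero]
    have e1 : (∫ s in (0 : ℝ)..T, deriv θ s * m s) = -∫ s in (0 : ℝ)..T, stepDeriv δ t s * m s := by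
      rw [← intervalIntegral.integral_neg]
      refine intervalIntegral.integral_congr fun s hs => ?_
      rw [uIcc_of_le hT.le] at hs
      simp only [hθ' s hs, neg_mul]
    have i1 : IntervalIntegrable (fun s => stepDeriv δ t s * m s) volume 0 T :=
      (by
        rw [uIcc_of_le hT.le]
        exact hsc.continuousOn.mul hmc : ContinuousOn _ (uIcc 0 T)).intervalIntegrable
    have i2 : IntervalIntegrable (fun s => stepDeriv δ t s * m t) volume 0 T :=
      (hsc.mul continuous_const).intervalIntegrable _ _
    have e2 : m₀ - m t = ∫ s in (0 : ℝ)..T, stepDeriv δ t s * (m s - m t) := by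
      simp only [mul_sub]
      rw [intervalIntegral.integral_sub i1 i2, intervalIntegral.integral_mul_const, hs1]
      rw [hθ0, one_mul] at hw
      change (∫ s in (0 : ℝ)..T, deriv θ s * m s) + m₀ = 0 at hw
      rw [e1] at hw
      linarith
    rw [dist_comm, Real.dist_eq, e2, ← Real.norm_eq_abs]
    have b := intervalIntegral.norm_integral_le_of_norm_le hT.le (μ := volume)
      (f := fun s => stepDeriv δ t s * (m s - m t)) (g := fun s => stepDeriv δ t s * ε)
      (Eventually.of_forall fun s hs => ?_) ((hsc.mul continuous_const).intervalIntegrable _ _)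
    · rwa [intervalIntegral.integral_mul_const, hs1, one_mul] at b
    · by_cases hs' : s ∈ Icc t (t + δ)
      · rw [norm_mul, Real.norm_of_nonneg (stepDeriv_nonneg hδ0)]
        refine mul_le_mul_of_nonneg_left ?_ (stepDeriv_nonneg hδ0)
        refine (hδ₁ s (Ioc_subset_Icc_self hs) ?_).le
        rw [Real.dist_eq, abs_of_nonneg (by linarith [hs'.1])]
        linarith [hs'.2]
      · rw [stepDeriv_of_notMem hδ0 hs']
        simp
  rcases ht.2.lt_or_eq with h1 | h1
  · exact key t ⟨ht.1, h1⟩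
  · have h2 : Tendsto m (𝓝[Ico 0 T] T) (𝓝 (m T)) :=
      (hmc T ⟨hT.le, le_rfl⟩).mono_left (nhdsWithin_mono _ Ico_subset_Icc_self)
    have h3 : Tendsto m (𝓝[Ico 0 T] T) (𝓝 m₀) := by
      refine tendsto_const_nhds.congr' ?_
      filter_upwards [self_mem_nhdsWithin] with s hs using (key s hs).symm
    have := right_nhdsWithin_Ico_neBot hT
    change m t = m₀
    rw [h1]
    exact tendsto_nhds_unique h2 h3

end mass

theorem ae_eq_of_integral_eq {f h : ℝ → ℝ} (hf : LocallyIntegrable f volume)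
    (hh : LocallyIntegrable h volume)
    (e : ∀ a b, a ≤ b → ∫ x in a..b, f x = ∫ x in a..b, h x) : f =ᵐ[volume] h := by
  have e' : (fun x => ∫ t in (0 : ℝ)..x, f t) = fun x => ∫ t in (0 : ℝ)..x, h t := by
    ext x
    rcases le_total 0 x with hx | hx
    · exact e 0 x hx
    · rw [intervalIntegral.integral_symm, intervalIntegral.integral_symm x, e x 0 hx]
  filter_upwards [_root_.LocallyIntegrable.ae_hasDerivAt_integral hf,
    _root_.LocallyIntegrable.ae_hasDerivAt_integral hh] with x h1 h2
  have h3 := h1 0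
  rw [e'] at h3
  exact h3.unique (h2 0)

theorem IsTransport.integral_densityOf {a b K : ℝ} {q X : ℝ → ℝ} (hX : IsTransport a b K q X)
    (hq : IsDensity K q) {z y : ℝ} (h : z ≤ y) :
    ∫ u in X z..X y, densityOf K ((densityMeasure q).map X) u = ∫ x in z..y, q x := by
  obtain ⟨hd, hdν⟩ := densityOf_spec hq.bound_nonneg (hX.map_le hq)
  have hXzy := hX.strictMono.monotone h
  have h1 := hd.densityMeasure_Ioc hXzy
  have h2 : X ⁻¹' Ioc (X z) (X y) = Ioc z y := by
    ext x
    simp [hX.strictMono.lt_iff_lt, hX.strictMono.le_iff_le]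
  rw [hdν, Measure.map_apply hX.measurable measurableSet_Ioc, h2, hq.densityMeasure_Ioc h,
    ENNReal.ofReal_eq_ofReal_iff (hq.integral_nonneg h) (hd.integral_nonneg hXzy)] at h1
  exact h1.symm

theorem IsDensity.mono {K M : ℝ} {q : ℝ → ℝ} (hq : IsDensity K q) (h : K ≤ M) : IsDensity M q :=
  ⟨hq.measurable, hq.nonneg, fun x => (hq.le x).trans h⟩

theorem IsDensity.locallyIntegrable {K : ℝ} {q : ℝ → ℝ} (hq : IsDensity K q) :
    LocallyIntegrable q volume := by
  refine (locallyIntegrable_const K).mono hq.measurable.aestronglyMeasurable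
    (Eventually.of_forall fun x => ?_)
  rw [Real.norm_of_nonneg (hq.nonneg x)]
  exact (hq.le x).trans (le_abs_self K)

section weakSolution

variable {T C L K M : ℝ} {q V g γ q₀ : ℝ → ℝ} {p : ℝ → ℝ → ℝ}

theorem IsLipschitzVelocity.continuousOn (hV : IsLipschitzVelocity K L V) (hL : 0 ≤ L) :
    ContinuousOn V (Icc 0 K) := by
  refine LipschitzOnWith.continuousOn (K := L.toNNReal)
    (LipschitzOnWith.of_dist_le_mul fun x hx y hy => ?_)
  rw [Real.coe_toNNReal _ hL]
  exact hV.lipschitz x hx y hy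

theorem IsMonotoneKernel.abs_nonlocalTerm_sub_le (hg : IsMonotoneKernel C g)
    (hγ : γ =ᵐ[volume.restrict (Ioi 0)] g) (hM0 : 0 ≤ M)
    (hp : ∀ r : ℝ, IsContinuousInLp T 1 (volume.restrict (Icc (-r) r)) p)
    (hM : ∀ t ∈ Icc 0 T, ∀ᵐ x, |p t x| ≤ M) {t : ℝ} (ht : t ∈ Icc 0 T) (x y : ℝ) :
    |nonlocalTerm γ p t x - nonlocalTerm γ p t y| ≤ M * (4 * C * |x - y|) := by
  have i0 : ∀ x, Integrable fun u => forward g (u - x) :=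
    fun x => hg.integrable_forward.comp_sub_right x
  rw [nonlocalTerm_eq hγ, nonlocalTerm_eq hγ,
    ← integral_sub (integrable_mul_of_bounded hp hM ht (i0 x))
      (integrable_mul_of_bounded hp hM ht (i0 y))]
  simp only [← mul_sub]
  refine (abs_integral_mul_le hp hM ht ((i0 x).sub (i0 y))).trans
    (mul_le_mul_of_nonneg_left ?_ hM0)
  have h1 : volume.map (fun u => u - x) ≤ ENNReal.ofReal 1 • (volume : Measure ℝ) := by
    rw [(measurePreserving_sub_right volume x).map_eq, ENNReal.ofReal_one, one_smul]
  have := (hg.integral_abs_sub_le zero_le_one (measurable_id.sub_const x)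
    (measurable_id.sub_const y) h1 (abs_nonneg (x - y)) fun u => by
      simp only [id, sub_sub_sub_cancel_left]
      rw [abs_sub_comm]).2
  rw [one_mul] at this
  exact this

theorem IsData.exists_lagrangianFlow_of_weakSolution (h : IsData T C L K q V g)
    (hγ : γ =ᵐ[volume.restrict (Ioi 0)] g) (hq₀ : q₀ =ᵐ[volume] q)
    (hp : IsWeakSolution T K q₀ V γ p) (hKM : K ≤ M) (hM : ∀ t ∈ Icc 0 T, ∀ᵐ x, |p t x| ≤ M) :
    ∃ X, IsLagrangianFlow T L (rate C L M) M q V g X ∧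
      (∀ t ∈ Icc 0 T, p t =ᵐ[volume] transported M q X t) ∧
      ∀ t ∈ Icc 0 T, ∀ z, lagrangianTerm g q (X t) z ∈ Icc 0 K := by
  have hT := h.time_pos
  have hL := h.bound_pos
  have hC := h.kernel.bound_nonneg
  have hM0 : 0 ≤ M := h.density.bound_nonneg.trans hKM
  have hqM := h.density.mono hKM
  have hpc := hp.continuous_L1_loc
  set κ := rate C L M with hκdef
  have hκ : 0 ≤ κ := by rw [hκdef, rate]; positivity
  set W := nonlocalTerm γ p with hW
  have hWm : ∀ t ∈ Icc 0 T, ∀ x, W t x ∈ Icc 0 K := hp.range_nonlocal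
  have hvx : ∀ t ∈ Icc 0 T, ∀ x y, |V (W t x) - V (W t y)| ≤ κ * |x - y| := by
    intro t ht x y
    refine (h.velocity.lipschitz _ (hWm t ht x) _ (hWm t ht y)).trans ?_
    refine (mul_le_mul_of_nonneg_left
      (h.kernel.abs_nonlocalTerm_sub_le hγ hM0 hpc hM ht x y) hL).trans (le_of_eq ?_)
    rw [hκdef, rate]
    ring
  have hvt : ∀ x, ContinuousOn (fun t => V (W t x)) (Icc 0 T) := fun x => by
    refine (h.velocity.continuousOn hL).comp ?_ fun t ht => hWm t ht x
    refine (continuousOn_integral_mul_const hpc hM (h.kernel.integrable_forward.comp_sub_right x)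
      (B := C) fun y => ?_).congr fun t _ => nonlocalTerm_eq hγ p t x
    rw [abs_of_nonneg (h.kernel.forward_nonneg _)]
    exact h.kernel.forward_le _
  have hvb : ∀ t ∈ Icc 0 T, ∀ x, |V (W t x)| ≤ L := fun t ht x => by
    rw [abs_of_nonneg (h.velocity.nonneg _ (hWm t ht x))]
    exact h.velocity.le _ (hWm t ht x)
  obtain ⟨X, hX0, hXc, hXd⟩ := exists_flow hT.le hL hκ hvt hvx hvb
  have hXd' : ∀ t ∈ Icc 0 T, ∀ z,
      HasDerivWithinAt (fun s => X s z) (V (W t (X t z))) (Icc 0 T) t := fun t ht z => by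
    have := (hXd t z).hasDerivWithinAt (s := Icc 0 T)
    rwa [clamp_of_mem ht] at this
  have hflow : IsLipschitzFlow T L κ X := isLipschitzFlow_of_hasDerivWithinAt hX0 hXd'
    (fun t ht z => hvb t ht _) fun t ht z y => hvx t ht _ _
  have htraj : ∀ z, IsTrajectory T (fun t x => V (W t x)) (fun t => X t z)
      (fun t => V (W (clamp T t) (X (clamp T t) z))) := fun z =>
    ⟨hXc z, fun t => hXd t z, fun t ht => by simp only [clamp_of_mem ht]⟩
  have hlin : IsLinearSolution T M K κ (fun t x => V (W t x)) q p := by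
    refine ⟨hT, hM0, hκ, hpc, hM, hvx, ?_, h.density, fun φ hφ hφc hφT => ?_⟩
    · refine continuous_prod_of_continuous_lipschitzWith' _ κ.toNNReal (fun t => ?_) fun x =>
        (hvt x).comp_continuous (continuous_clamp T) (clamp_mem hT.le)
      refine LipschitzWith.of_dist_le_mul fun x y => ?_
      rw [Real.coe_toNNReal _ hκ]
      exact hvx _ (clamp_mem hT.le t) x y
    · have e : ∫ x, q x * φ (0, x) = ∫ x, q₀ x * φ (0, x) := by
        refine integral_congr_ae ?_
        filter_upwards [hq₀] with x hx
        rw [hx]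
      rw [e]
      exact hp.weak_form φ hφ hφc hφT
  have hmono : ∀ t ∈ Icc 0 T, ∀ z y, z ≤ y → X t z ≤ X t y := fun t ht z y hzy => by
    have h1 := hflow.space 0 ⟨le_rfl, hT.le⟩ t ht z y hzy
    rw [hX0, hX0] at h1
    have h2 := (mul_nonneg_iff_of_pos_left (Real.exp_pos _)).1 ((sub_nonneg.2 hzy).trans h1)
    linarith
  have hmass : ∀ t ∈ Icc 0 T, ∀ z y, z ≤ y →
      ∫ x in X t z..X t y, p t x = ∫ x in z..y, q x := fun t ht z y hzy => by
    have := hlin.mass_eq (htraj z) (htraj y) (fun t ht => hmono t ht z y hzy) ht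
    rwa [hX0, hX0] at this
  have hdens : ∀ t ∈ Icc 0 T, ∀ z y, z ≤ y → ∫ x in z..y, q x ≤ M * (X t y - X t z) := by
    intro t ht z y hzy
    rw [← hmass t ht z y hzy]
    have h1 := intervalIntegral.norm_integral_le_of_norm_le_const_ae (a := X t z) (b := X t y)
      (f := p t) (C := M) (by filter_upwards [hM t ht] with x hx _ using hx)
    rw [abs_of_nonneg (sub_nonneg.2 (hmono t ht z y hzy))] at h1
    exact (le_abs_self _).trans h1
  have hXt : ∀ t ∈ Icc 0 T, IsTransport (Real.exp (-(κ * T))) (Real.exp (κ * T)) M q (X t) :=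
    fun t ht => hflow.isTransport hκ ht (hdens t ht)
  have hpd : ∀ t ∈ Icc 0 T, p t =ᵐ[volume] transported M q X t := by
    intro t ht
    obtain ⟨hd, -⟩ := densityOf_spec hM0 ((hXt t ht).map_le hqM)
    refine ae_eq_of_integral_eq ?_ hd.locallyIntegrable fun a b hab => ?_
    · exact (locallyIntegrable_const M).mono (aestronglyMeasurable_of_isContinuousInLp hpc ht)
        (by filter_upwards [hM t ht] with x hx using hx.trans (le_abs_self M))
    · obtain ⟨z, rfl⟩ := (hXt t ht).surjective a
      obtain ⟨y, rfl⟩ := (hXt t ht).surjective b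
      have hzy := (hXt t ht).strictMono.le_iff_le.1 hab
      rw [hmass t ht z y hzy]
      exact ((hXt t ht).integral_densityOf hqM hzy).symm
  have hWe : ∀ t ∈ Icc 0 T, ∀ z, W t (X t z) = lagrangianTerm g q (X t) z := by
    intro t ht z
    obtain ⟨hd, hdν⟩ := densityOf_spec hM0 ((hXt t ht).map_le hqM)
    have hm : Measurable fun u => forward g (u - X t z) :=
      h.kernel.measurable_forward.comp (measurable_id.sub_const _)
    have e : ∫ y, p t y * forward g (y - X t z) =
        ∫ y, transported M q X t y * forward g (y - X t z) := by
      refine integral_congr_ae ?_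
      filter_upwards [hpd t ht] with y hy
      rw [hy]
    rw [hW, nonlocalTerm_eq hγ, e, transported,
      ← hd.integral_densityMeasure (fun u => forward g (u - X t z)), hdν,
      integral_map (hXt t ht).measurable.aemeasurable hm.aestronglyMeasurable]
    rfl
  refine ⟨X, ⟨hflow, hdens, fun t ht z => ?_⟩, hpd, fun t ht z => ?_⟩
  · rw [← hWe t ht]
    exact hXd' t ht z
  · rw [← hWe t ht]
    exact hWm t ht _

theorem IsData.lagrangianFlow_unique (h : IsData T C L K q V g) (hKM : K ≤ M)
    {X Y : ℝ → ℝ → ℝ} (hX : IsLagrangianFlow T L (rate C L M) M q V g X)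
    (hXK : ∀ t ∈ Icc 0 T, ∀ z, lagrangianTerm g q (X t) z ∈ Icc 0 K)
    (hY : IsLagrangianFlow T L (rate C L M) M q V g Y)
    (hYK : ∀ t ∈ Icc 0 T, ∀ z, lagrangianTerm g q (Y t) z ∈ Icc 0 K) {t : ℝ} (ht : t ∈ Icc 0 T) :
    X t = Y t := by
  have hT := h.time_pos
  have hL := h.bound_pos
  have hC := h.kernel.bound_nonneg
  have hM0 : 0 ≤ M := h.density.bound_nonneg.trans hKM
  have hqM := h.density.mono hKM
  set κ := rate C L M with hκdef
  have hκ : 0 ≤ κ := by rw [hκdef, rate]; positivity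
  set k := 4 * κ + 1 with hk
  have hk0 : 0 < k := by positivity
  have h0 : (0 : ℝ) ∈ Icc 0 T := ⟨le_rfl, hT.le⟩
  have hstep : ∀ A, 0 ≤ A → (∀ t ∈ Icc 0 T, ∀ z, |X t z - Y t z| ≤ A * Real.exp (k * t)) →
      ∀ t ∈ Icc 0 T, ∀ z, |X t z - Y t z| ≤ A / 2 * Real.exp (k * t) := by
    intro A hA hXY t ht z
    have hder : ∀ t ∈ Icc 0 T, HasDerivWithinAt (fun t => X t z - Y t z)
        (V (lagrangianTerm g q (X t) z) - V (lagrangianTerm g q (Y t) z)) (Icc 0 T) t :=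
      fun t ht => (hX.deriv t ht z).sub (hY.deriv t ht z)
    have hB : ∀ t, HasDerivAt (fun t => A / 2 * Real.exp (k * t))
        (A / 2 * (k * Real.exp (k * t))) t := fun t => by
      have := (((hasDerivAt_id t).const_mul k).exp).const_mul (A / 2)
      refine this.congr_deriv ?_
      simp only [id]
      ring
    refine image_norm_le_of_norm_deriv_right_le_deriv_boundary' (a := 0) (b := T)
      (f := fun t => X t z - Y t z) (fun t ht => (hder t ht).continuousWithinAt)
      (fun t ht => (hder t (Ico_subset_Icc_self ht)).mono_of_mem_nhdsWithin
        (Icc_mem_nhdsGE_of_mem ht)) (B := fun t => A / 2 * Real.exp (k * t)) ?_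
      (fun t _ => (hB t).continuousAt.continuousWithinAt)
      (fun t _ => (hB t).hasDerivWithinAt) (fun t ht' => ?_) ht
    · simp only [hX.init, hY.init, sub_self, norm_zero]
      positivity
    · have ht := Ico_subset_Icc_self ht'
      refine (h.velocity.lipschitz _ (hXK t ht z) _ (hYK t ht z)).trans ?_
      have h1 := (hX.isTransport hκ ht).abs_lagrangianTerm_sub_le hqM h.kernel
        (hY.isTransport hκ ht).measurable (z := z) (z' := z) (η := 2 * (A * Real.exp (k * t)))
        (by positivity) fun y => by
          have h1 := abs_le.1 (hXY t ht y)
          have h2 := abs_le.1 (hXY t ht z)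
          rw [abs_le]
          constructor <;> linarith [h1.1, h1.2, h2.1, h2.2]
      refine (mul_le_mul_of_nonneg_left h1 hL).trans ?_
      have e : L * (M * (4 * C * (2 * (A * Real.exp (k * t))))) =
          2 * κ * (A * Real.exp (k * t)) := by rw [hκdef, rate]; ring
      have e' : A / 2 * (k * Real.exp (k * t)) = 2 * κ * (A * Real.exp (k * t)) +
          (A * Real.exp (k * t)) / 2 := by rw [hk]; ring
      rw [e, e']
      have : 0 ≤ A * Real.exp (k * t) := by positivity
      linarith
  have hall : ∀ n : ℕ, ∀ t ∈ Icc 0 T, ∀ z,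
      |X t z - Y t z| ≤ 2 * (L * T) * (1 / 2) ^ n * Real.exp (k * t) := by
    intro n
    induction n with
    | zero =>
      intro t ht z
      have h1 := abs_le.1 (hX.time t ht 0 h0 z)
      have h2 := abs_le.1 (hY.time t ht 0 h0 z)
      rw [hX.init, sub_zero, abs_of_nonneg ht.1] at h1
      rw [hY.init, sub_zero, abs_of_nonneg ht.1] at h2
      have h3 : L * t ≤ L * T := mul_le_mul_of_nonneg_left ht.2 hL
      have h4 : 1 ≤ Real.exp (k * t) := Real.one_le_exp (mul_nonneg hk0.le ht.1)
      have h5 : |X t z - Y t z| ≤ 2 * (L * T) := by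
        rw [abs_le]
        constructor <;> linarith [h1.1, h1.2, h2.1, h2.2]
      rw [pow_zero, mul_one]
      exact h5.trans (le_mul_of_one_le_right (by positivity) h4)
    | succ n ih =>
      intro t ht z
      refine (hstep _ (by positivity) ih t ht z).trans (le_of_eq ?_)
      rw [pow_succ]
      ring
  ext z
  have hlim : Tendsto (fun n : ℕ => 2 * (L * T) * (1 / 2 : ℝ) ^ n * Real.exp (k * t)) atTop
      (𝓝 0) := by
    have := ((tendsto_pow_atTop_nhds_zero_of_lt_one (r := (1 / 2 : ℝ)) (by norm_num)
      (by norm_num)).const_mul (2 * (L * T))).mul_const (Real.exp (k * t))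
    simpa using this
  exact sub_eq_zero.1 (abs_nonpos_iff.1 (ge_of_tendsto' hlim fun n => hall n t ht z))

theorem IsData.weakSolution_unique (h : IsData T C L K q V g)
    (hγ : γ =ᵐ[volume.restrict (Ioi 0)] g) (hq₀ : q₀ =ᵐ[volume] q) {p' : ℝ → ℝ → ℝ}
    (hp : IsWeakSolution T K q₀ V γ p) (hp' : IsWeakSolution T K q₀ V γ p') {t : ℝ}
    (ht : t ∈ Icc 0 T) : p t =ᵐ[volume] p' t := by
  obtain ⟨M₁, hM₁⟩ := hp.bounded
  obtain ⟨M₂, hM₂⟩ := hp'.bounded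
  set M := max K (max M₁ M₂)
  have hKM : K ≤ M := le_max_left _ _
  have h1 : M₁ ≤ M := (le_max_left _ _).trans (le_max_right _ _)
  have h2 : M₂ ≤ M := (le_max_right _ _).trans (le_max_right _ _)
  obtain ⟨X, hX, hpX, hXK⟩ := h.exists_lagrangianFlow_of_weakSolution hγ hq₀ hp hKM
    fun t ht => (hM₁ t ht).mono fun x hx => hx.trans h1
  obtain ⟨Y, hY, hpY, hYK⟩ := h.exists_lagrangianFlow_of_weakSolution hγ hq₀ hp' hKM
    fun t ht => (hM₂ t ht).mono fun x hx => hx.trans h2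
  have := h.lagrangianFlow_unique hKM hX hXK hY hYK ht
  refine (hpX t ht).trans (EventuallyEq.trans ?_ (hpY t ht).symm)
  rw [transported, transported, this]

end weakSolution


theorem exists_mem_Ioo_of_ae {P : ℝ → Prop} {s : Set ℝ} (hP : ∀ᵐ x ∂(volume.restrict s), P x)
    {a b : ℝ} (hab : a < b) (hs : Ioo a b ⊆ s) : ∃ x ∈ Ioo a b, P x := by
  have h1 : ∀ᵐ x ∂(volume.restrict (Ioo a b)), P x := ae_restrict_of_ae_restrict_of_subset hs hP
  have h2 : ∀ᵐ x ∂(volume.restrict (Ioo a b)), x ∈ Ioo a b := ae_restrict_mem measurableSet_Ioo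
  have : NeBot (ae (volume.restrict (Ioo a b))) := by
    rw [ae_neBot, ne_eq, Measure.restrict_eq_zero, Real.volume_Ioo]
    simpa using hab
  exact (h2.and h1).exists

theorem exists_isDensity {K : ℝ} (hK : 0 ≤ K) {q₀ : ℝ → ℝ} (hm : AEStronglyMeasurable q₀ volume)
    (hq₀ : ∀ᵐ x, 0 ≤ q₀ x ∧ q₀ x ≤ K) : ∃ q, IsDensity K q ∧ q₀ =ᵐ[volume] q := by
  refine ⟨fun x => max 0 (min (hm.mk q₀ x) K), ⟨?_, fun x => le_max_left _ _,
    fun x => max_le hK (min_le_right _ _)⟩, ?_⟩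
  · exact measurable_const.max (hm.stronglyMeasurable_mk.measurable.min measurable_const)
  · filter_upwards [hm.ae_eq_mk, hq₀] with x h1 h2
    rw [← h1, min_eq_left h2.2, max_eq_right h2.1]

theorem ae_abs_le_of_eLpNorm_top {f : ℝ → ℝ} {μ : Measure ℝ} {C : ℝ} (hC : 0 ≤ C)
    (h : eLpNorm f ∞ μ ≤ ENNReal.ofReal C) : ∀ᵐ x ∂μ, |f x| ≤ C := by
  rw [eLpNorm_exponent_top] at h
  filter_upwards [enorm_ae_le_eLpNormEssSup f μ] with x hx
  have := hx.trans h
  rwa [Real.enorm_eq_ofReal_abs, ENNReal.ofReal_le_ofReal_iff hC] at this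

section kernel

variable {C R ε : ℝ} {γ g : ℝ → ℝ}

theorem IsKernel.exists_isMonotoneKernel (hC : 0 ≤ C) (hR : 0 ≤ R) (h : IsKernel C R ε γ) :
    ∃ g, IsMonotoneKernel C g ∧ γ =ᵐ[volume.restrict (Ioi 0)] g ∧
      ∀ᵐ x ∂(volume.restrict (Ioi R)), g x ≤ x ^ (-(1 + ε)) := by
  obtain ⟨g₀, hg₀, hγ⟩ := h.nonincreasing
  have hle := ae_abs_le_of_eLpNorm_top hC h.norm_top
  have hb : ∀ᵐ x ∂(volume.restrict (Ioi 0)), 0 ≤ g₀ x ∧ g₀ x ≤ C := by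
    filter_upwards [hγ, h.nonneg, hle] with x h1 h2 h3
    rw [← h1]
    exact ⟨h2, (le_abs_self _).trans h3⟩
  have h0 : ∀ x, 0 < x → 0 ≤ g₀ x := fun x hx => by
    obtain ⟨y, hy, hyb⟩ := exists_mem_Ioo_of_ae hb (lt_add_one x) fun y hy => hx.trans hy.1
    exact hyb.1.trans (hg₀ hx (hx.trans hy.1) hy.1.le)
  have h1 : ∀ x, 0 < x → g₀ x ≤ C := fun x hx => by
    obtain ⟨y, hy, hyb⟩ := exists_mem_Ioo_of_ae hb hx fun y hy => hy.1
    exact (hg₀ hy.1 hx hy.2.le).trans hyb.2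
  set g : ℝ → ℝ := fun x => if 0 < x then g₀ x else C with hg
  have hgg : ∀ x, 0 < x → g x = g₀ x := fun x hx => if_pos hx
  have hgγ : γ =ᵐ[volume.restrict (Ioi 0)] g := by
    filter_upwards [hγ, ae_restrict_mem measurableSet_Ioi] with x hx hx0
    rw [hx, hgg x hx0]
  have hgi : IntegrableOn g (Ioi 0) := h.integrable.congr hgγ
  have hg0 : ∀ x, 0 ≤ g x := fun x => by
    by_cases hx : 0 < x
    · rw [hgg x hx]; exact h0 x hx
    · simp only [hg, if_neg hx]; exact hC
  have hgC : ∀ x, g x ≤ C := fun x => by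
    by_cases hx : 0 < x
    · rw [hgg x hx]; exact h1 x hx
    · simp only [hg, if_neg hx]; exact le_rfl
  refine ⟨g, ⟨fun x y hxy => ?_, hg0, hgC, hgi, ?_⟩, hgγ, ?_⟩
  · by_cases hx : 0 < x
    · rw [hgg x hx, hgg y (hx.trans_le hxy)]
      exact hg₀ hx (hx.trans_le hxy) hxy
    · simp only [hg, if_neg hx]
      exact hgC y
  · have := h.norm_one
    rw [eLpNorm_congr_ae hgγ, eLpNorm_one_eq_lintegral_enorm] at this
    rw [integral_eq_lintegral_of_nonneg_ae (Eventually.of_forall hg0) hgi.1]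
    rw [lintegral_congr fun x => (Real.enorm_of_nonneg (hg0 x)).symm, this, ENNReal.toReal_one]
  · filter_upwards [h.decay, ae_restrict_of_ae_restrict_of_subset (Ioi_subset_Ioi hR) hgγ]
      with x hx hx'
    rwa [← hx']

theorem IsMonotoneKernel.isKernel (hg : IsMonotoneKernel C g)
    (hd : ∀ᵐ x ∂(volume.restrict (Ioi R)), g x ≤ x ^ (-(1 + ε))) : IsKernel C R ε g := by
  refine ⟨hg.integrableOn, Eventually.of_forall hg.nonneg,
    ⟨g, hg.antitone.antitoneOn _, EventuallyEq.rfl⟩, ?_, ?_, hd⟩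
  · rw [eLpNorm_exponent_top]
    refine eLpNormEssSup_le_of_ae_bound (Eventually.of_forall fun x => ?_)
    rw [Real.norm_of_nonneg (hg.nonneg x)]
    exact hg.le x
  · rw [eLpNorm_one_eq_lintegral_enorm, lintegral_congr fun x => Real.enorm_of_nonneg (hg.nonneg x),
      ← ofReal_integral_eq_lintegral_ofReal hg.integrableOn (Eventually.of_forall hg.nonneg),
      hg.integral_eq, ENNReal.ofReal_one]

end kernel

section velocity

variable {qmax C a A : ℝ} {V : ℝ → ℝ}

/-- Nonincreasing velocities with values in `[0, a]` and Lipschitz constant `A` on `[0, qmax]`. -/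
structure IsBoundedVelocity (qmax a A : ℝ) (V : ℝ → ℝ) : Prop where
  nonneg : ∀ u ∈ Icc 0 qmax, 0 ≤ V u
  le : ∀ u ∈ Icc 0 qmax, V u ≤ a
  antitone : AntitoneOn V (Icc 0 qmax)
  lipschitz : ∀ u ∈ Icc 0 qmax, ∀ w ∈ Icc 0 qmax, |V u - V w| ≤ A * |u - w|

theorem IsVelocity.exists_isBoundedVelocity (hq : 0 < qmax) (hC : 0 ≤ C)
    (h : IsVelocity qmax C V) :
    ∃ a A, 0 ≤ a ∧ 0 ≤ A ∧ a + A ≤ C ∧ IsBoundedVelocity qmax a A V := by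
  obtain ⟨V', hm, hV, hneg, hle⟩ := h.exists_weak_deriv
  set μ := volume.restrict (Icc 0 qmax) with hμ
  have ha := ne_top_of_le_ne_top ENNReal.ofReal_ne_top (le_self_add.trans hle)
  have hA := ne_top_of_le_ne_top ENNReal.ofReal_ne_top (le_add_self.trans hle)
  set a := (eLpNorm V ∞ μ).toReal with hadef
  set A := (eLpNorm V' ∞ μ).toReal with hAdef
  have ha0 : 0 ≤ a := ENNReal.toReal_nonneg
  have hA0 : 0 ≤ A := ENNReal.toReal_nonneg
  have haA : a + A ≤ C := by
    rw [hadef, hAdef, ← ENNReal.toReal_add ha hA]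
    exact ENNReal.toReal_le_of_le_ofReal hC hle
  have hVa : ∀ᵐ u ∂μ, |V u| ≤ a := ae_abs_le_of_eLpNorm_top ha0 (ENNReal.ofReal_toReal ha).ge
  have hVA : ∀ᵐ u ∂μ, |V' u| ≤ A := ae_abs_le_of_eLpNorm_top hA0 (ENNReal.ofReal_toReal hA).ge
  have hint : IntegrableOn V' (Icc 0 qmax) := hm.integrable le_top
  have hsub : ∀ u ∈ Icc 0 qmax, ∀ w ∈ Icc 0 qmax, V w - V u = ∫ s in u..w, V' s := by
    intro u hu w hw
    have i : ∀ x ∈ Icc 0 qmax, IntervalIntegrable V' volume 0 x := fun x hx =>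
      (intervalIntegrable_iff_integrableOn_Icc_of_le hx.1).2
        (hint.mono_set (Icc_subset_Icc_right hx.2))
    rw [hV u hu, hV w hw, ← intervalIntegral.integral_interval_sub_left (i w hw) (i u hu)]
    ring
  have hioc : ∀ u ∈ Icc 0 qmax, ∀ w ∈ Icc 0 qmax, uIoc u w ⊆ Icc 0 qmax := fun u hu w hw x hx => by
    rw [uIoc, mem_Ioc] at hx
    exact ⟨(le_min hu.1 hw.1).trans hx.1.le, hx.2.trans (max_le hu.2 hw.2)⟩
  have hlip : ∀ u ∈ Icc 0 qmax, ∀ w ∈ Icc 0 qmax, |V u - V w| ≤ A * |u - w| := by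
    intro u hu w hw
    rw [hsub w hw u hu]
    rw [← Real.norm_eq_abs]
    refine intervalIntegral.norm_integral_le_of_norm_le_const_ae ?_
    exact (ae_restrict_iff' measurableSet_uIoc).1
      (ae_restrict_of_ae_restrict_of_subset (hioc w hw u hu) hVA)
  refine ⟨a, A, ha0, hA0, haA, h.nonneg, fun u hu => ?_, fun u hu w hw huw => ?_, hlip⟩
  · refine le_of_forall_pos_le_add fun η hη => ?_
    set δ := η / (A + 1) with hδ
    have hδ0 : 0 < δ := by positivity
    have hAδ : A * δ ≤ η := by
      rw [hδ, mul_div_assoc', div_le_iff₀ (by positivity)]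
      nlinarith
    obtain ⟨w, hw, hwa⟩ := exists_mem_Ioo_of_ae hVa
      (a := max 0 (u - δ)) (b := min qmax (u + δ))
      (max_lt (lt_min hq (by linarith [hu.1])) (lt_min (by linarith [hu.2]) (by linarith)))
      fun w hw => ⟨(le_max_left _ _).trans hw.1.le, hw.2.le.trans (min_le_left _ _)⟩
    have hw' : w ∈ Icc 0 qmax :=
      ⟨(le_max_left _ _).trans hw.1.le, hw.2.le.trans (min_le_left _ _)⟩
    have h1 : |u - w| ≤ δ := abs_le.2
      ⟨by linarith [hw.2.le.trans (min_le_right _ _)], by linarith [(le_max_right _ _).trans hw.1.le]⟩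
    have h2 := (abs_le.1 (hlip u hu w hw')).2
    have h3 := mul_le_mul_of_nonneg_left h1 hA0
    linarith [(abs_le.1 hwa).2]
  · have h1 := hsub u hu w hw
    have h2 : ∫ s in u..w, V' s ≤ 0 := by
      rw [intervalIntegral.integral_of_le huw]
      refine integral_nonpos_of_ae (ae_restrict_of_ae_restrict_of_subset ?_ hneg)
      exact fun x hx => ⟨hu.1.trans hx.1.le, hx.2.trans hw.2⟩
    linarith

theorem IsBoundedVelocity.isLipschitzVelocity (h : IsBoundedVelocity qmax a A V) (ha : a ≤ C)
    (hA : A ≤ C) : IsLipschitzVelocity qmax C V :=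
  ⟨h.nonneg, fun u hu => (h.le u hu).trans ha, h.antitone, fun u hu w hw =>
    (h.lipschitz u hu w hw).trans (mul_le_mul_of_nonneg_right hA (abs_nonneg _))⟩

theorem IsBoundedVelocity.isVelocity (hq : 0 ≤ qmax) (h : IsBoundedVelocity qmax a A V)
    (ha : 0 ≤ a) (hA : 0 ≤ A) (haA : a + A ≤ C) : IsVelocity qmax C V := by
  set U : ℝ → ℝ := fun u => V (clamp qmax u) with hU
  have hUV : ∀ u ∈ Icc 0 qmax, U u = V u := fun u hu => by simp only [hU]; rw [clamp_of_mem hu]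
  have hUL : LipschitzWith A.toNNReal U := LipschitzWith.of_dist_le_mul fun u w => by
    rw [Real.coe_toNNReal _ hA]
    exact (h.lipschitz _ (clamp_mem hq u) _ (clamp_mem hq w)).trans
      (mul_le_mul_of_nonneg_left (abs_clamp_sub_le _ _ _) hA)
  have hUm : Antitone U := fun u w huw =>
    h.antitone (clamp_mem hq u) (clamp_mem hq w)
      (max_le_max le_rfl (min_le_min le_rfl huw))
  have hU' : ∀ u, |deriv U u| ≤ A := fun u => by
    have := norm_deriv_le_of_lipschitz (x₀ := u) hUL
    rwa [Real.coe_toNNReal _ hA] at this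
  have htop : eLpNorm (deriv U) ∞ (volume.restrict (Icc 0 qmax)) ≤ ENNReal.ofReal A := by
    rw [eLpNorm_exponent_top]
    exact eLpNormEssSup_le_of_ae_bound (Eventually.of_forall hU')
  refine ⟨h.nonneg, deriv U, ⟨(measurable_deriv U).aestronglyMeasurable,
    htop.trans_lt ENNReal.ofReal_lt_top⟩, fun u hu => ?_, Eventually.of_forall fun u => ?_, ?_⟩
  · have hac := (hUL.lipschitzOnWith (s := uIcc 0 u)).absolutelyContinuousOnInterval
    rw [hac.integral_deriv_eq_sub, hUV u hu, hUV 0 ⟨le_rfl, hq⟩]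
    ring
  · exact hUm.deriv_nonpos
  · refine (add_le_add (b := ENNReal.ofReal a) ?_ htop).trans ?_
    · rw [eLpNorm_exponent_top]
      refine eLpNormEssSup_le_of_ae_bound ?_
      filter_upwards [ae_restrict_mem measurableSet_Icc] with u hu
      rw [Real.norm_of_nonneg (h.nonneg u hu)]
      exact h.le u hu
    · rw [← ENNReal.ofReal_add ha hA]
      exact ENNReal.ofReal_le_ofReal haA

end velocity

section characteristics

variable {T C L K : ℝ} {q V g : ℝ → ℝ} {X : ℝ → ℝ → ℝ}

/-- The flow from time `t` to time `s`. -/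
noncomputable def transition (X : ℝ → ℝ → ℝ) (t x s : ℝ) : ℝ :=
  X s (Function.invFun (X t) x)

theorem IsData.isTheCharacteristics (h : IsData T C L K q V g)
    (hX : IsLagrangianFlow T L (rate C L K) K q V g X) {W : ℝ → ℝ → ℝ}
    (hW : ∀ t ∈ Icc 0 T, ∀ x, W t x = eulerianTerm g q (X t) x) :
    IsTheCharacteristics T V W (transition X) := by
  have hl := h.rate_nonneg
  have hsol : SolvesCharacteristics T V W (transition X) := fun t ht x =>
    ⟨Function.rightInverse_invFun (hX.isTransport hl ht).surjective x, fun s hs => by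
      rw [hW s hs]
      exact hX.deriv s hs _⟩
  refine ⟨hsol, fun ζ hζ t ht x s hs => ?_⟩
  obtain ⟨h1, h2⟩ := hsol t ht x
  obtain ⟨h3, h4⟩ := hζ t ht x
  have := abs_le_exp_mul_abs (L := rate C L K) (fun r hr => (h4 r hr).sub (h2 r hr))
    (fun r hr => by
      rw [hW r hr, hW r hr]
      simpa using h.abs_eulerianSpeed_sub_le hX hr hr (ζ t x r) (transition X t x r)) hs ht
  simp only [Pi.sub_apply, h1, h3, sub_self, abs_zero, mul_zero] at this
  exact sub_eq_zero.1 (abs_nonpos_iff.1 this)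

end characteristics


theorem exists_strictMono_tendsto {ι : Type*} [Countable ι] (a : ℕ → ι → ℝ) (B : ι → ℝ)
    (h : ∀ k i, |a k i| ≤ B i) :
    ∃ φ : ℕ → ℕ, StrictMono φ ∧ ∀ i, ∃ l, Tendsto (fun k => a (φ k) i) atTop (𝓝 l) := by
  have hc : IsCompact (univ.pi fun i => Icc (-B i) (B i)) :=
    isCompact_univ_pi fun i => isCompact_Icc
  obtain ⟨l, -, φ, hφ, hl⟩ := hc.tendsto_subseq (x := a) fun k i _ => abs_le.1 (h k i)
  exact ⟨φ, hφ, fun i => ⟨l i, (tendsto_pi_nhds.1 hl) i⟩⟩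

section equilipschitz

variable {E : Type*} [PseudoMetricSpace E] {f : ℕ → E → ℝ} {K : ℝ}

theorem exists_tendsto_of_dense {D : Set E} (hD : Dense D) (hK : 0 ≤ K)
    (hf : ∀ k x y, |f k x - f k y| ≤ K * dist x y)
    (h : ∀ x ∈ D, ∃ l, Tendsto (fun k => f k x) atTop (𝓝 l)) (x : E) :
    ∃ l, Tendsto (fun k => f k x) atTop (𝓝 l) := by
  refine cauchySeq_tendsto_of_complete (Metric.cauchySeq_iff.2 fun ε hε => ?_)
  obtain ⟨y, hyD, hy⟩ := hD.exists_dist_lt x (ε := ε / (3 * (K + 1))) (by positivity)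
  obtain ⟨l, hl⟩ := h y hyD
  obtain ⟨N, hN⟩ := Metric.cauchySeq_iff.1 hl.cauchySeq (ε / 3) (by positivity)
  have hKy : K * dist x y ≤ ε / 3 := by
    have h1 : K * dist x y ≤ (K + 1) * (ε / (3 * (K + 1))) :=
      mul_le_mul (by linarith) hy.le dist_nonneg (by linarith)
    have h2 : (K + 1) * (ε / (3 * (K + 1))) = ε / 3 := by field_simp
    linarith
  refine ⟨N, fun m hm n hn => ?_⟩
  have h1 := abs_le.1 ((hf m x y).trans hKy)
  have h2 := abs_le.1 ((hf n x y).trans hKy)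
  have h3 := hN m hm n hn
  rw [Real.dist_eq, abs_lt] at h3 ⊢
  constructor <;> linarith

theorem tendstoLocallyUniformlyOn_of_lipschitz {S : Set E} {F : E → ℝ} (hK : 0 ≤ K)
    (hf : ∀ k, ∀ x ∈ S, ∀ y ∈ S, |f k x - f k y| ≤ K * dist x y)
    (h : ∀ x ∈ S, Tendsto (fun k => f k x) atTop (𝓝 (F x))) :
    TendstoLocallyUniformlyOn f F atTop S := by
  have hF : ∀ x ∈ S, ∀ y ∈ S, |F x - F y| ≤ K * dist x y := fun x hx y hy =>
    le_of_tendsto ((h x hx).sub (h y hy)).abs (Eventually.of_forall fun k => hf k x hx y hy)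
  rw [Metric.tendstoLocallyUniformlyOn_iff]
  intro ε hε x hx
  refine ⟨Metric.ball x (ε / (3 * (K + 1))) ∩ S,
    inter_mem (mem_nhdsWithin_of_mem_nhds (Metric.ball_mem_nhds _ (by positivity)))
      self_mem_nhdsWithin, ?_⟩
  filter_upwards [Metric.tendsto_nhds.1 (h x hx) (ε / 3) (by positivity)] with k hk y hy
  have hKy : K * dist y x ≤ ε / 3 := by
    have h1 : K * dist y x ≤ (K + 1) * (ε / (3 * (K + 1))) :=
      mul_le_mul (by linarith) (le_of_lt hy.1) dist_nonneg (by linarith)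
    have h2 : (K + 1) * (ε / (3 * (K + 1))) = ε / 3 := by field_simp
    linarith
  have h1 := abs_le.1 ((hf k y hy.2 x hx).trans hKy)
  have h2 := abs_le.1 ((hF y hy.2 x hx).trans hKy)
  rw [Real.dist_eq, abs_lt] at hk ⊢
  constructor <;> linarith

theorem tendsto_apply_of_lipschitz {S : Set E} {F : E → ℝ}
    (hf : ∀ k, ∀ x ∈ S, ∀ y ∈ S, |f k x - f k y| ≤ K * dist x y)
    (h : ∀ x ∈ S, Tendsto (fun k => f k x) atTop (𝓝 (F x))) {u : ℕ → E} {w : E}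
    (hu : ∀ k, u k ∈ S) (hw : w ∈ S) (huw : Tendsto u atTop (𝓝 w)) :
    Tendsto (fun k => f k (u k)) atTop (𝓝 (F w)) := by
  have h1 : Tendsto (fun k => f k (u k) - f k w) atTop (𝓝 0) := by
    refine squeeze_zero_norm (fun k => hf k _ (hu k) _ hw) ?_
    simpa using (tendsto_iff_dist_tendsto_zero.1 huw).const_mul K
  simpa using h1.add (h w hw)

end equilipschitz

section velocity

variable {qmax : ℝ} {a A : ℕ → ℝ} {a' A' : ℝ} {V : ℕ → ℝ → ℝ} {V' : ℝ → ℝ}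

theorem isBoundedVelocity_of_tendsto (hV : ∀ k, IsBoundedVelocity qmax (a k) (A k) (V k))
    (ha : Tendsto a atTop (𝓝 a')) (hA : Tendsto A atTop (𝓝 A'))
    (h : ∀ u ∈ Icc 0 qmax, Tendsto (fun k => V k u) atTop (𝓝 (V' u))) :
    IsBoundedVelocity qmax a' A' V' :=
  ⟨fun u hu => ge_of_tendsto' (h u hu) fun k => (hV k).nonneg u hu,
    fun u hu => le_of_tendsto_of_tendsto' (h u hu) ha fun k => (hV k).le u hu,
    fun u hu w hw huw => le_of_tendsto_of_tendsto' (h w hw) (h u hu) fun k =>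
      (hV k).antitone hu hw huw,
    fun u hu w hw => le_of_tendsto_of_tendsto' ((h u hu).sub (h w hw)).abs (hA.mul_const _)
      fun k => (hV k).lipschitz u hu w hw⟩

end velocity

section kernel

variable {C R ε : ℝ} {g : ℕ → ℝ → ℝ}

theorem exists_limit_kernel (hR : 0 < R) (hε : 0 < ε) (hg : ∀ k, IsMonotoneKernel C (g k))
    (hd : ∀ k, ∀ᵐ x ∂(volume.restrict (Ioi R)), g k x ≤ x ^ (-(1 + ε)))
    (hconv : ∀ r : ℚ, ∃ l, Tendsto (fun k => g k r) atTop (𝓝 l)) :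
    ∃ g', IsMonotoneKernel C g' ∧ (∀ᵐ x ∂(volume.restrict (Ioi R)), g' x ≤ x ^ (-(1 + ε))) ∧
      Tendsto (fun k => ∫ x in Ioi 0, |g k x - g' x|) atTop (𝓝 0) := by
  have hC := (hg 0).bound_nonneg
  set g' : ℝ → ℝ := fun x => limsup (fun k => g k x) atTop with hg'
  have hbd : ∀ x, IsBoundedUnder (· ≤ ·) atTop fun k => g k x := fun x =>
    isBoundedUnder_of ⟨C, fun k => (hg k).le x⟩
  have hbd' : ∀ x, IsBoundedUnder (· ≥ ·) atTop fun k => g k x := fun x =>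
    isBoundedUnder_of ⟨0, fun k => (hg k).nonneg x⟩
  have hanti : Antitone g' := fun x y hxy =>
    limsup_le_limsup (Eventually.of_forall fun k => (hg k).antitone hxy)
      (hbd' y).isCoboundedUnder_le (hbd x)
  have hrat : ∀ r : ℚ, Tendsto (fun k => g k r) atTop (𝓝 (g' r)) := fun r => by
    obtain ⟨l, hl⟩ := hconv r
    have : g' r = l := hl.limsup_eq
    rwa [this]
  have h0 : ∀ x, 0 ≤ g' x := fun x => by
    obtain ⟨r, hr⟩ := exists_rat_gt x
    exact (ge_of_tendsto' (hrat r) fun k => (hg k).nonneg _).trans (hanti hr.le)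
  have h1 : ∀ x, g' x ≤ C := fun x => by
    obtain ⟨r, hr⟩ := exists_rat_lt x
    exact (hanti hr.le).trans (le_of_tendsto' (hrat r) fun k => (hg k).le _)
  have hcont : ∀ x, ContinuousAt g' x → Tendsto (fun k => g k x) atTop (𝓝 (g' x)) := by
    intro x hx
    refine Metric.tendsto_nhds.2 fun η hη => ?_
    obtain ⟨δ, hδ, hδx⟩ := Metric.continuousAt_iff.1 hx η hη
    obtain ⟨r, hr1, hr2⟩ := exists_rat_btwn (show x - δ < x by linarith)
    obtain ⟨s, hs1, hs2⟩ := exists_rat_btwn (show x < x + δ by linarith)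
    have hr := hδx (x := r) (by rw [Real.dist_eq, abs_lt]; constructor <;> linarith)
    have hs := hδx (x := s) (by rw [Real.dist_eq, abs_lt]; constructor <;> linarith)
    rw [Real.dist_eq, abs_lt] at hr hs
    filter_upwards [(hrat r).eventually_lt_const (show g' r < g' x + η by linarith),
      (hrat s).eventually_const_lt (show g' x - η < g' s by linarith)] with k h1 h2
    have h3 := (hg k).antitone hr2.le
    have h4 := (hg k).antitone hs1.le
    rw [Real.dist_eq, abs_lt]
    constructor <;> linarith
  have hae : ∀ᵐ x, Tendsto (fun k => g k x) atTop (𝓝 (g' x)) := by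
    filter_upwards [hanti.countable_not_continuousAt.ae_notMem volume] with x hx
    exact hcont x (by simpa using hx)
  have hsplit : Ioi (0 : ℝ) = Ioc 0 R ∪ Ioi R := (Ioc_union_Ioi_eq_Ioi hR.le).symm
  set b : ℝ → ℝ := fun x => if x ≤ R then C else x ^ (-(1 + ε)) with hb
  have hbi : IntegrableOn b (Ioi 0) := by
    rw [hsplit]
    refine IntegrableOn.union ?_ ?_
    · refine (integrableOn_const (C := C) (s := Ioc 0 R) (by simp)).congr_fun (fun x hx => ?_)
        measurableSet_Ioc
      exact (if_pos hx.2).symm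
    · refine (integrableOn_Ioi_rpow_of_lt (a := -(1 + ε)) (by linarith) hR).congr_fun
        (fun x hx => ?_) measurableSet_Ioi
      exact (if_neg (not_le.2 hx)).symm
  have hkb : ∀ k, ∀ᵐ x ∂(volume.restrict (Ioi 0)), g k x ≤ b x := fun k => by
    have h1 := (ae_restrict_iff' measurableSet_Ioi).1 (hd k)
    filter_upwards [ae_restrict_of_ae h1] with x hx
    by_cases hxR : x ≤ R
    · simp only [hb, if_pos hxR]
      exact (hg k).le x
    · simp only [hb, if_neg hxR]
      exact hx (not_le.1 hxR)
  have hg'b : ∀ᵐ x ∂(volume.restrict (Ioi 0)), g' x ≤ b x := by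
    filter_upwards [ae_restrict_of_ae hae, ae_all_iff.2 hkb] with x hx hxb
    exact le_of_tendsto' hx hxb
  have hg'i : IntegrableOn g' (Ioi 0) := by
    refine Integrable.mono' hbi hanti.measurable.aestronglyMeasurable ?_
    filter_upwards [hg'b] with x hx
    rwa [Real.norm_of_nonneg (h0 x)]
  refine ⟨g', ⟨hanti, h0, h1, hg'i, ?_⟩, ?_, ?_⟩
  · have := tendsto_integral_of_dominated_convergence (μ := volume.restrict (Ioi 0)) b
      (fun k => (hg k).antitone.measurable.aestronglyMeasurable) hbi (F := g) (f := g')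
      (fun k => by
        filter_upwards [hkb k] with x hx
        rwa [Real.norm_of_nonneg ((hg k).nonneg x)]) (ae_restrict_of_ae hae)
    refine tendsto_nhds_unique this ?_
    simp [fun k => (hg k).integral_eq]
  · filter_upwards [ae_restrict_of_ae hae, ae_all_iff.2 hd] with x hx hxb
    exact le_of_tendsto' hx hxb
  · have := tendsto_integral_of_dominated_convergence (μ := volume.restrict (Ioi 0))
      (fun x => b x + b x) (F := fun k x => |g k x - g' x|) (f := fun _ => 0)
      (fun k => ((hg k).antitone.measurable.sub hanti.measurable).abs.aestronglyMeasurable)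
      (hbi.add hbi)
      (fun k => by
        filter_upwards [hkb k, hg'b] with x hx hx'
        rw [Real.norm_eq_abs, abs_abs, abs_le]
        have := (hg k).nonneg x
        have := h0 x
        constructor <;> linarith)
      (by
        filter_upwards [ae_restrict_of_ae hae] with x hx
        simpa using (hx.sub_const (g' x)).abs)
    simpa using this

theorem integral_abs_forward_sub (g g' : ℝ → ℝ) :
    ∫ x, |forward g x - forward g' x| = ∫ x in Ioi 0, |g x - g' x| := by
  rw [← integral_indicator measurableSet_Ioi]
  refine integral_congr_ae (Eventually.of_forall fun x => ?_)
  by_cases hx : 0 < x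
  · simp [forward, hx]
  · simp [forward, hx]

end kernel


section density

variable {K : ℝ} {q : ℕ → ℝ → ℝ} {q' : ℝ → ℝ}

theorem IsDensity.abs_le {q : ℝ → ℝ} (hq : IsDensity K q) (x : ℝ) : |q x| ≤ K := by
  rw [abs_of_nonneg (hq.nonneg x)]
  exact hq.le x

theorem IsDensity.integrable_mul {q : ℝ → ℝ} (hq : IsDensity K q) {f : ℝ → ℝ}
    (hf : Integrable f) : Integrable fun x => q x * f x :=
  hf.bdd_mul hq.measurable.aestronglyMeasurable (Eventually.of_forall hq.abs_le)

theorem IsDensity.abs_integral_mul_le {q : ℝ → ℝ} (hq : IsDensity K q) {f : ℝ → ℝ}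
    (hf : Integrable f) : |∫ x, q x * f x| ≤ K * ∫ x, |f x| := by
  rw [← integral_const_mul]
  refine abs_integral_le_integral_abs.trans (integral_mono (hq.integrable_mul hf).abs
    (hf.abs.const_mul K) fun x => ?_)
  simp only [abs_mul]
  exact mul_le_mul_of_nonneg_right (hq.abs_le x) (abs_nonneg _)

/-- Bounded densities whose primitives converge at a dense set of points have a limit. -/
theorem exists_limit_density (hq : ∀ k, IsDensity K (q k))
    (h : ∀ r : ℚ, ∃ l, Tendsto (fun k => ∫ x in (0 : ℝ)..r, q k x) atTop (𝓝 l)) :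
    ∃ q', IsDensity K q' ∧ ∀ a b, Tendsto (fun k => ∫ x in a..b, q k x) atTop
      (𝓝 (∫ x in a..b, q' x)) := by
  have hK := (hq 0).bound_nonneg
  have hsub : ∀ k a b, ∫ x in a..b, q k x = (∫ x in (0 : ℝ)..b, q k x) - ∫ x in (0 : ℝ)..a, q k x :=
    fun k a b => (intervalIntegral.integral_interval_sub_left ((hq k).intervalIntegrable 0 b)
      ((hq k).intervalIntegrable 0 a)).symm
  have hlip : ∀ k x y, |(∫ u in (0 : ℝ)..x, q k u) - ∫ u in (0 : ℝ)..y, q k u| ≤ K * dist x y := by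
    intro k x y
    rw [← hsub, ← Real.norm_eq_abs, Real.dist_eq]
    refine intervalIntegral.norm_integral_le_of_norm_le_const fun u _ => (hq k).abs_le u
  have hD : Dense (range ((↑) : ℚ → ℝ)) := Rat.denseRange_cast
  choose Q hQ using exists_tendsto_of_dense hD hK hlip (by
    rintro _ ⟨r, rfl⟩
    exact h r)
  have hQL : LipschitzWith K.toNNReal Q := LipschitzWith.of_dist_le_mul fun x y => by
    rw [Real.coe_toNNReal _ hK]
    exact le_of_tendsto' ((hQ x).sub (hQ y)).abs fun k => hlip k x y
  have hQm : Monotone Q := fun x y hxy => by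
    refine le_of_tendsto_of_tendsto' (hQ x) (hQ y) fun k => ?_
    have := hsub k x y
    have := (hq k).integral_nonneg hxy
    linarith
  refine ⟨deriv Q, ⟨measurable_deriv Q, fun x => hQm.deriv_nonneg, fun x => ?_⟩, fun a b => ?_⟩
  · have := norm_deriv_le_of_lipschitz (x₀ := x) hQL
    rw [Real.coe_toNNReal _ hK] at this
    exact (le_abs_self _).trans this
  · have hac := (hQL.lipschitzOnWith (s := uIcc a b)).absolutelyContinuousOnInterval
    rw [hac.integral_deriv_eq_sub]
    exact ((hQ b).sub (hQ a)).congr fun k => (hsub k a b).symm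

theorem tendsto_setIntegral_inter_Ioc (hq : ∀ k, IsDensity K (q k)) (hq' : IsDensity K q')
    (h : ∀ a b, Tendsto (fun k => ∫ x in a..b, q k x) atTop (𝓝 (∫ x in a..b, q' x)))
    {s : Set ℝ} (hs : MeasurableSet s) (c d : ℝ) :
    Tendsto (fun k => ∫ x in s ∩ Ioc c d, q k x) atTop (𝓝 (∫ x in s ∩ Ioc c d, q' x)) := by
  have hI : ∀ a b, Tendsto (fun k => ∫ x in Ioc a b, q k x) atTop (𝓝 (∫ x in Ioc a b, q' x)) := by
    intro a b
    rcases le_total a b with hab | hab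
    · simpa only [intervalIntegral.integral_of_le hab] using h a b
    · simp [Ioc_eq_empty (not_lt.2 hab)]
  have hint : ∀ {f : ℝ → ℝ}, IsDensity K f → IntegrableOn f (Ioc c d) := fun {f} hf =>
    Measure.integrableOn_of_bounded (M := K) (by simp) hf.measurable.aestronglyMeasurable
      (Eventually.of_forall hf.abs_le)
  induction s, hs using MeasurableSpace.induction_on_inter (borel_eq_generateFrom_Ioc ℝ)
    (isPiSystem_Ioc id id) with
  | empty => simp
  | basic t ht =>
    obtain ⟨a, b, -, rfl⟩ := ht
    simp only [Ioc_inter_Ioc]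
    exact hI _ _
  | compl t ht ih =>
    have e : ∀ {f : ℝ → ℝ}, IsDensity K f →
        ∫ x in tᶜ ∩ Ioc c d, f x = (∫ x in Ioc c d, f x) - ∫ x in t ∩ Ioc c d, f x := fun {f} hf => by
      have h1 := integral_inter_add_sdiff ht (hint hf)
      rw [← h1, inter_comm t, inter_comm tᶜ, sdiff_eq]
      ring
    rw [e hq']
    simp only [fun k => e (hq k)]
    exact (hI c d).sub ih
  | iUnion t hd ht ih =>
    have hm : ∀ i, MeasurableSet (t i ∩ Ioc c d) := fun i => (ht i).inter measurableSet_Ioc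
    have hd' : Pairwise (Function.onFun Disjoint fun i => t i ∩ Ioc c d) := fun i j hij =>
      (hd hij).mono inter_subset_left inter_subset_left
    have e : ∀ {f : ℝ → ℝ}, IsDensity K f →
        ∫ x in (⋃ i, t i) ∩ Ioc c d, f x = ∑' i, ∫ x in t i ∩ Ioc c d, f x := fun {f} hf => by
      rw [iUnion_inter]
      exact integral_iUnion hm hd' ((hint hf).mono_set (iUnion_subset fun i => inter_subset_right))
    rw [e hq']
    simp only [fun k => e (hq k)]
    have hfin : ∑' i, volume (t i ∩ Ioc c d) ≠ ∞ := by
      rw [← measure_iUnion hd' hm]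
      exact ((measure_mono (iUnion_subset fun i => inter_subset_right)).trans_lt
        (by simp : volume (Ioc c d) < ∞)).ne
    refine tendsto_tsum_of_dominated_convergence (bound := fun i => K * volume.real (t i ∩ Ioc c d))
      ((ENNReal.summable_toReal hfin).mul_left K) ih (Eventually.of_forall fun k i => ?_)
    refine norm_setIntegral_le_of_norm_le_const ?_ fun x _ => (hq k).abs_le x
    exact (measure_mono inter_subset_right).trans_lt (by simp)

/-- Bounded densities converge weakly-* if their integrals over intervals converge. -/
theorem tendsto_integral_mul_of_tendsto_intervalIntegral (hq : ∀ k, IsDensity K (q k))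
    (hq' : IsDensity K q')
    (h : ∀ a b, Tendsto (fun k => ∫ x in a..b, q k x) atTop (𝓝 (∫ x in a..b, q' x)))
    {f : ℝ → ℝ} (hf : Integrable f) :
    Tendsto (fun k => ∫ x, q k x * f x) atTop (𝓝 (∫ x, q' x * f x)) := by
  have hK := hq'.bound_nonneg
  have hclose : ∀ {f : ℝ → ℝ}, Integrable f → (∀ ε > 0, ∃ g : ℝ → ℝ, Integrable g ∧
      ∫ x, |f x - g x| ≤ ε ∧
      Tendsto (fun k => ∫ x, q k x * g x) atTop (𝓝 (∫ x, q' x * g x))) →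
      Tendsto (fun k => ∫ x, q k x * f x) atTop (𝓝 (∫ x, q' x * f x)) := by
    intro f hf H
    refine Metric.tendsto_nhds.2 fun ε hε => ?_
    obtain ⟨g, hg, hfg, hgt⟩ := H (ε / (3 * (K + 1))) (by positivity)
    have hKe : K * ∫ x, |f x - g x| ≤ ε / 3 := by
      have h0 : 0 ≤ ∫ x, |f x - g x| := integral_nonneg fun x => abs_nonneg _
      have h1 : K * ∫ x, |f x - g x| ≤ (K + 1) * (ε / (3 * (K + 1))) :=
        mul_le_mul (by linarith) hfg h0 (by linarith)
      have h2 : (K + 1) * (ε / (3 * (K + 1))) = ε / 3 := by field_simp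
      linarith
    have key : ∀ {p : ℝ → ℝ}, IsDensity K p →
        |(∫ x, p x * f x) - ∫ x, p x * g x| ≤ ε / 3 := fun {p} hp => by
      rw [← integral_sub (hp.integrable_mul hf) (hp.integrable_mul hg)]
      simp only [← mul_sub]
      exact (hp.abs_integral_mul_le (hf.sub hg)).trans hKe
    filter_upwards [Metric.tendsto_nhds.1 hgt (ε / 3) (by positivity)] with k hk
    have h1 := abs_le.1 (key (hq k))
    have h2 := abs_le.1 (key hq')
    rw [Real.dist_eq, abs_lt] at hk ⊢
    constructor <;> linarith
  have hloc : ∀ (n : ℕ), Tendsto (fun k => ∫ x, q k x * (Ioc (-(n : ℝ)) n).indicator f x) atTop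
      (𝓝 (∫ x, q' x * (Ioc (-(n : ℝ)) n).indicator f x)) := by
    intro n
    refine Integrable.induction (P := fun f => Tendsto
      (fun k => ∫ x, q k x * (Ioc (-(n : ℝ)) n).indicator f x) atTop
      (𝓝 (∫ x, q' x * (Ioc (-(n : ℝ)) n).indicator f x))) ?_ ?_ ?_ ?_ hf
    · intro c s hs _
      have e : ∀ p : ℝ → ℝ, ∫ x, p x * (Ioc (-(n : ℝ)) n).indicator (s.indicator fun _ => c) x =
          (∫ x in s ∩ Ioc (-(n : ℝ)) n, p x) * c := fun p => by
        rw [← integral_mul_const, ← integral_indicator (hs.inter measurableSet_Ioc)]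
        refine integral_congr_ae (Eventually.of_forall fun x => ?_)
        simp only [indicator_indicator]
        rw [inter_comm]
        by_cases hx : x ∈ s ∩ Ioc (-(n : ℝ)) n
        · simp only [indicator_of_mem hx]
        · simp only [indicator_of_notMem hx, mul_zero]
      simp only [e]
      exact (tendsto_setIntegral_inter_Ioc hq hq' h hs _ _).mul_const c
    · intro f g _ hf hg ihf ihg
      have e : ∀ {p : ℝ → ℝ}, IsDensity K p → ∫ x, p x * (Ioc (-(n : ℝ)) n).indicator (f + g) x =
          (∫ x, p x * (Ioc (-(n : ℝ)) n).indicator f x) +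
            ∫ x, p x * (Ioc (-(n : ℝ)) n).indicator g x := fun {p} hp => by
        rw [← integral_add (hp.integrable_mul (hf.indicator measurableSet_Ioc))
          (hp.integrable_mul (hg.indicator measurableSet_Ioc))]
        refine integral_congr_ae (Eventually.of_forall fun x => ?_)
        simp only [indicator_add', Pi.add_apply]
        ring
      rw [e hq']
      simp only [fun k => e (hq k)]
      exact ihf.add ihg
    · refine isClosed_of_closure_subset fun f hf => ?_
      refine hclose ((L1.integrable_coeFn f).indicator measurableSet_Ioc) fun ε hε => ?_
      obtain ⟨g, hg, hfg⟩ := Metric.mem_closure_iff.1 hf ε hε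
      refine ⟨_, (L1.integrable_coeFn g).indicator measurableSet_Ioc, ?_, hg⟩
      rw [L1.dist_eq_integral_dist] at hfg
      refine le_trans (integral_mono_of_nonneg (Eventually.of_forall fun x => abs_nonneg _) ?_
        (Eventually.of_forall fun x => ?_)) hfg.le
      · exact ((L1.integrable_coeFn f).sub (L1.integrable_coeFn g)).norm
      · simp only [Real.dist_eq]
        by_cases hx : x ∈ Ioc (-(n : ℝ)) n
        · simp only [indicator_of_mem hx, le_refl]
        · simp only [indicator_of_notMem hx, sub_self, abs_zero, abs_nonneg]
    · intro f g hfg _ ih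
      have e : ∀ p : ℝ → ℝ, ∫ x, p x * (Ioc (-(n : ℝ)) n).indicator g x =
          ∫ x, p x * (Ioc (-(n : ℝ)) n).indicator f x := fun p => by
        refine integral_congr_ae ?_
        filter_upwards [hfg] with x hx
        simp only [indicator_apply, hx]
      simp only [e]
      exact ih
  refine hclose hf fun ε hε => ?_
  have htail : Tendsto (fun n : ℕ => ∫ x, |f x - (Ioc (-(n : ℝ)) n).indicator f x|) atTop
      (𝓝 (∫ _ : ℝ, (0 : ℝ))) := by
    refine tendsto_integral_of_dominated_convergence (fun x => |f x|) (fun n => ?_) hf.abs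
      (fun n => Eventually.of_forall fun x => ?_) (Eventually.of_forall fun x => ?_)
    · exact (hf.sub (hf.indicator measurableSet_Ioc)).abs.1
    · by_cases hx : x ∈ Ioc (-(n : ℝ)) n
      · simp [indicator_of_mem hx]
      · simp [indicator_of_notMem hx]
    · refine tendsto_const_nhds.congr' ?_
      filter_upwards [eventually_gt_atTop ⌈|x|⌉₊] with n hn
      have hx := abs_lt.1 ((Nat.le_ceil |x|).trans_lt (Nat.cast_lt.2 hn))
      rw [indicator_of_mem (mem_Ioc.2 ⟨hx.1, hx.2.le⟩), sub_self, abs_zero]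
  rw [integral_zero] at htail
  obtain ⟨n, hn⟩ := (htail.eventually_le_const hε).exists
  exact ⟨_, hf.indicator measurableSet_Ioc, hn, hloc n⟩

theorem tendsto_integral_densityMeasure (hq : ∀ k, IsDensity K (q k)) (hq' : IsDensity K q')
    (h : ∀ f : ℝ → ℝ, Integrable f →
      Tendsto (fun k => ∫ x, q k x * f x) atTop (𝓝 (∫ x, q' x * f x)))
    {F : ℕ → ℝ → ℝ} {G : ℝ → ℝ} (hF : ∀ k, Integrable (F k)) (hG : Integrable G)
    (hFG : Tendsto (fun k => ∫ x, |F k x - G x|) atTop (𝓝 0)) :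
    Tendsto (fun k => ∫ x, F k x ∂(densityMeasure (q k))) atTop
      (𝓝 (∫ x, G x ∂(densityMeasure q'))) := by
  rw [hq'.integral_densityMeasure]
  simp only [fun k => (hq k).integral_densityMeasure]
  have h1 : Tendsto (fun k => ∫ x, q k x * (F k x - G x)) atTop (𝓝 0) := by
    refine squeeze_zero_norm (fun k => (hq k).abs_integral_mul_le ((hF k).sub hG)) ?_
    simpa using hFG.const_mul K
  have h2 := h1.add (h G hG)
  rw [zero_add] at h2
  refine h2.congr fun k => ?_
  have hd : Integrable fun x => F k x - G x := (hF k).sub hG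
  rw [← integral_add ((hq k).integrable_mul hd) ((hq k).integrable_mul hG)]
  refine integral_congr_ae (Eventually.of_forall fun x => ?_)
  simp only
  ring

/-- A weak-* limit of densities that are bounded in `L²` is in `L²`. -/
theorem memLp_two_of_tendsto (hq : ∀ k, IsDensity K (q k)) (hq' : IsDensity K q')
    (h : ∀ f : ℝ → ℝ, Integrable f →
      Tendsto (fun k => ∫ x, q k x * f x) atTop (𝓝 (∫ x, q' x * f x)))
    {B : ℝ} (hq2 : ∀ k, Integrable (fun x => q k x ^ 2) ∧ ∫ x, q k x ^ 2 ≤ B) :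
    MemLp q' 2 volume := by
  rw [memLp_two_iff_integrable_sq hq'.measurable.aestronglyMeasurable]
  have hsq : ∀ n : ℕ, IntegrableOn (fun x => q' x ^ 2) (Ioc (-(n : ℝ)) n) := fun n =>
    Measure.integrableOn_of_bounded (M := K ^ 2) (by simp)
      (hq'.measurable.pow_const 2).aestronglyMeasurable (Eventually.of_forall fun x => by
        rw [Real.norm_of_nonneg (sq_nonneg _)]
        exact pow_le_pow_left₀ (hq'.nonneg x) (hq'.le x) 2)
  refine integrable_of_intervalIntegral_norm_bounded (a := fun n : ℕ => -(n : ℝ))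
    (b := fun n : ℕ => (n : ℝ)) (l := atTop) B hsq
    (tendsto_neg_atTop_atBot.comp tendsto_natCast_atTop_atTop) tendsto_natCast_atTop_atTop
    (Eventually.of_forall fun n => ?_)
  rw [intervalIntegral.integral_of_le (by simp)]
  set I := Ioc (-(n : ℝ)) n with hI
  have hfi : Integrable (I.indicator q') := IntegrableOn.integrable_indicator
    (Measure.integrableOn_of_bounded (M := K) (by simp [hI]) hq'.measurable.aestronglyMeasurable
      (Eventually.of_forall hq'.abs_le)) measurableSet_Ioc
  have e1 : ∀ x, q' x * I.indicator q' x = I.indicator (fun x => q' x ^ 2) x := fun x => by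
    by_cases hx : x ∈ I
    · simp only [indicator_of_mem hx, sq]
    · simp only [indicator_of_notMem hx, mul_zero]
  have e2 : ∫ x in I, ‖q' x ^ 2‖ = ∫ x, I.indicator (fun x => q' x ^ 2) x := by
    rw [integral_indicator measurableSet_Ioc]
    simp only [Real.norm_of_nonneg (sq_nonneg _)]
    rfl
  have h1 := h _ hfi
  simp only [e1] at h1
  have hii : Integrable (I.indicator fun x => q' x ^ 2) :=
    IntegrableOn.integrable_indicator (hsq n) measurableSet_Ioc
  have h2 : ∀ k, ∫ x, q k x * I.indicator q' x ≤
      B / 2 + (∫ x, I.indicator (fun x => q' x ^ 2) x) / 2 := fun k => by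
    have h3 : ∫ x, q k x * I.indicator q' x ≤
        ∫ x, (q k x ^ 2 / 2 + I.indicator (fun x => q' x ^ 2) x / 2) := by
      refine integral_mono ((hq k).integrable_mul hfi)
        (((hq2 k).1.div_const 2).add (hii.div_const 2)) fun x => ?_
      by_cases hx : x ∈ I
      · simp only [indicator_of_mem hx]
        nlinarith [sq_nonneg (q k x - q' x)]
      · simp only [indicator_of_notMem hx, mul_zero]
        positivity
    rw [integral_add ((hq2 k).1.div_const 2) (hii.div_const 2), integral_div, integral_div] at h3
    linarith [(hq2 k).2]
  have h3 := le_of_tendsto' h1 h2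
  rw [e2]
  linarith

end density


theorem IsTransport.map_volume_le {a b K : ℝ} {q X : ℝ → ℝ} (hX : IsTransport a b K q X) :
    volume.map X ≤ ENNReal.ofReal a⁻¹ • volume := by
  have h := NonlocalControl.map_volume_le hX.orderIso (inv_nonneg.2 hX.pos.le) fun z y hzy => by
    have h1 : hX.orderIso y - hX.orderIso z = X y - X z := by rw [hX.coe_orderIso]
    rw [h1, inv_mul_eq_div, le_div_iff₀ hX.pos, mul_comm]
    exact hX.lower z y hzy
  rwa [hX.coe_orderIso] at h

theorem integral_comp_le_of_map_le {c : ℝ} (hc : 0 ≤ c) {Y : ℝ → ℝ} (hY : Measurable Y)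
    (h : volume.map Y ≤ ENNReal.ofReal c • volume) {f : ℝ → ℝ} (hf : Integrable f)
    (hfm : Measurable f) (hf0 : ∀ x, 0 ≤ f x) : ∫ y, f (Y y) ≤ c * ∫ u, f u := by
  rw [← integral_map hY.aemeasurable hfm.aestronglyMeasurable]
  refine (integral_mono_measure h (Eventually.of_forall hf0)
    (hf.smul_measure ENNReal.ofReal_ne_top)).trans ?_
  rw [integral_smul_measure, ENNReal.toReal_ofReal hc, smul_eq_mul]

theorem continuousAt_forward {g : ℝ → ℝ} {x : ℝ} (hx : x ≠ 0) (hg : ContinuousAt g x) :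
    ContinuousAt (forward g) x := by
  rcases lt_or_gt_of_ne hx with h | h
  · refine (continuousAt_const (y := (0 : ℝ))).congr ?_
    filter_upwards [Iio_mem_nhds h] with y hy
    exact (forward_of_nonpos (le_of_lt hy)).symm
  · refine hg.congr ?_
    filter_upwards [Ioi_mem_nhds h] with y hy
    exact (forward_of_pos hy).symm

/-- Convergence of data: of the primitives of the densities, of the velocities, and of the kernels
in `L¹`. -/
structure IsDataLimit (T C L K : ℝ) (q V g : ℕ → ℝ → ℝ) (q' V' g' : ℝ → ℝ) : Prop where
  data : ∀ k, IsData T C L K (q k) (V k) (g k)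
  limit : IsData T C L K q' V' g'
  interval : ∀ a b, Tendsto (fun k => ∫ x in a..b, q k x) atTop (𝓝 (∫ x in a..b, q' x))
  velocity : ∀ u ∈ Icc 0 K, Tendsto (fun k => V k u) atTop (𝓝 (V' u))
  kernel : Tendsto (fun k => ∫ x, |forward (g k) x - forward g' x|) atTop (𝓝 0)

section nonlocal

variable {T C L K : ℝ} {q V g : ℕ → ℝ → ℝ} {q' V' g' : ℝ → ℝ}

theorem IsDataLimit.weak (D : IsDataLimit T C L K q V g q' V' g') {f : ℝ → ℝ}
    (hf : Integrable f) :
    Tendsto (fun k => ∫ x, q k x * f x) atTop (𝓝 (∫ x, q' x * f x)) :=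
  tendsto_integral_mul_of_tendsto_intervalIntegral (fun k => (D.data k).density) D.limit.density
    D.interval hf

theorem IsDataLimit.tendsto_integral_forward (D : IsDataLimit T C L K q V g q' V' g') {c B : ℝ}
    (hc : 0 ≤ c) {Y : ℕ → ℝ → ℝ} {Y' : ℝ → ℝ} (hY : ∀ k, Measurable (Y k)) (hY' : Measurable Y')
    (hYc : ∀ k, volume.map (Y k) ≤ ENNReal.ofReal c • volume)
    (hYc' : volume.map Y' ≤ ENNReal.ofReal c • volume) (hinj : Function.Injective Y')
    (hB : ∀ k y, |Y' y - Y k y| ≤ B) (hlim : ∀ y, Tendsto (fun k => Y k y) atTop (𝓝 (Y' y))) :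
    Tendsto (fun k => ∫ y, forward (g k) (Y k y) ∂(densityMeasure (q k))) atTop
      (𝓝 (∫ y, forward g' (Y' y) ∂(densityMeasure q'))) := by
  have hg := fun k => (D.data k).kernel
  have hg' := D.limit.kernel
  have hB0 : 0 ≤ B := (abs_nonneg _).trans (hB 0 0)
  have hF : ∀ k, Integrable fun y => forward (g k) (Y k y) := fun k =>
    integrable_comp_of_map_le (hY k) (hYc k) (hg k).integrable_forward
  have hF' : ∀ k, Integrable fun y => forward g' (Y k y) := fun k =>
    integrable_comp_of_map_le (hY k) (hYc k) hg'.integrable_forward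
  have hG : Integrable fun y => forward g' (Y' y) :=
    integrable_comp_of_map_le hY' hYc' hg'.integrable_forward
  refine tendsto_integral_densityMeasure (fun k => (D.data k).density) D.limit.density
    (fun f hf => D.weak hf) hF hG ?_
  have h1 : Tendsto (fun k => c * ∫ x, |forward (g k) x - forward g' x|) atTop (𝓝 0) := by
    simpa using D.kernel.const_mul c
  have hdisc : {x | ¬ ContinuousAt (forward g') x}.Countable := by
    refine (hg'.antitone.countable_not_continuousAt.insert 0).mono fun x hx => ?_
    by_contra hx'
    rw [mem_insert_iff, not_or, mem_ofPred_eq, not_not] at hx'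
    exact hx (continuousAt_forward hx'.1 hx'.2)
  have h2 : Tendsto (fun k => ∫ y, |forward g' (Y k y) - forward g' (Y' y)|) atTop
      (𝓝 (∫ _ : ℝ, (0 : ℝ))) := by
    refine tendsto_integral_of_dominated_convergence (fun y => oscBound C g' B (Y' y))
      (fun k => ((hF' k).sub hG).abs.1)
      (integrable_comp_of_map_le hY' hYc' (hg'.integral_oscBound hB0).1)
      (fun k => Eventually.of_forall fun y => ?_) ?_
    · rw [Real.norm_eq_abs, abs_abs, abs_sub_comm]
      exact hg'.abs_forward_sub_le (hB k y)
    · filter_upwards [(hdisc.preimage hinj).ae_notMem volume] with y hy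
      simp only [mem_preimage, mem_ofPred_eq, not_not] at hy
      simpa using ((hy.tendsto.comp (hlim y)).sub_const (forward g' (Y' y))).abs
  rw [integral_zero] at h2
  refine squeeze_zero (fun k => integral_nonneg fun y => abs_nonneg _) (fun k => ?_)
    (by simpa using h1.add h2)
  have h3 := integral_comp_le_of_map_le hc (hY k) (hYc k)
    (f := fun x => |forward (g k) x - forward g' x|)
    ((hg k).integrable_forward.sub hg'.integrable_forward).abs
    ((hg k).measurable_forward.sub hg'.measurable_forward).abs fun x => abs_nonneg _
  refine le_trans ?_ (add_le_add_left h3 _)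
  have i1 : Integrable fun y => |forward (g k) (Y k y) - forward g' (Y k y)| :=
    ((hF k).sub (hF' k)).abs
  have i2 : Integrable fun y => |forward g' (Y k y) - forward g' (Y' y)| := ((hF' k).sub hG).abs
  rw [← integral_add i1 i2]
  exact integral_mono ((hF k).sub hG).abs (i1.add i2) fun y => abs_sub_le _ _ _

end nonlocal

section flow

variable {T C L K : ℝ} {q V g : ℕ → ℝ → ℝ} {q' V' g' : ℝ → ℝ}
  {X : ℕ → ℝ → ℝ → ℝ} {X' : ℝ → ℝ → ℝ}

theorem IsLipschitzFlow.abs_sub_init_le {l : ℝ} {X : ℝ → ℝ → ℝ} (hX : IsLipschitzFlow T L l X)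
    {t : ℝ} (ht : t ∈ Icc 0 T) (hL : 0 ≤ L) (z : ℝ) : |X t z - z| ≤ L * T := by
  have h0 : (0 : ℝ) ∈ Icc 0 T := ⟨le_rfl, ht.1.trans ht.2⟩
  have := hX.time t ht 0 h0 z
  rw [hX.init, sub_zero, abs_of_nonneg ht.1] at this
  exact this.trans (mul_le_mul_of_nonneg_left ht.2 hL)

theorem IsData.continuous_lagrangianSpeed {q V g : ℝ → ℝ} (h : IsData T C L K q V g) {l : ℝ}
    (hl : 0 ≤ l) {X : ℝ → ℝ → ℝ} (hX : IsLipschitzFlow T L l X)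
    (hd : ∀ t ∈ Icc 0 T, ∀ z y, z ≤ y → ∫ x in z..y, q x ≤ K * (X t y - X t z)) (z : ℝ) :
    Continuous fun s => V (lagrangianTerm g q (X (clamp T s)) z) := by
  have hT := h.time_pos.le
  have hL := h.bound_pos
  have hK := h.density.bound_nonneg
  have hC := h.kernel.bound_nonneg
  refine (LipschitzWith.of_dist_le_mul (K := (4 * K * C * L * (2 * L)).toNNReal)
    fun s t => ?_).continuous
  have hs' := clamp_mem hT s
  have ht' := clamp_mem hT t
  rw [Real.dist_eq, Real.coe_toNNReal _ (by positivity), Real.dist_eq]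
  refine ((hX.isTransport hl hs' (hd _ hs')).abs_speed_sub_le h.density h.kernel h.velocity hL
    (hX.isTransport hl ht' (hd _ ht')) (η := 2 * L * |s - t|) (by positivity) fun y => ?_).trans
    (le_of_eq (by ring))
  have h1 := abs_clamp_sub_le T s t
  have h2 := abs_le.1 ((hX.time _ hs' _ ht' y).trans (mul_le_mul_of_nonneg_left h1 hL))
  have h3 := abs_le.1 ((hX.time _ hs' _ ht' z).trans (mul_le_mul_of_nonneg_left h1 hL))
  rw [abs_le]
  constructor <;> linarith [h2.1, h2.2, h3.1, h3.2]

theorem IsLagrangianFlow.eq_add_integral {q V g : ℝ → ℝ} (h : IsData T C L K q V g) {l : ℝ}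
    (hl : 0 ≤ l) {X : ℝ → ℝ → ℝ} (hX : IsLagrangianFlow T L l K q V g X) {t : ℝ}
    (ht : t ∈ Icc 0 T) (z : ℝ) :
    X t z = z + ∫ s in (0 : ℝ)..t, V (lagrangianTerm g q (X (clamp T s)) z) := by
  have hc := h.continuous_lagrangianSpeed hl hX.toIsLipschitzFlow hX.density_le z
  have := intervalIntegral.integral_eq_sub_of_hasDerivAt_of_le ht.1 (f := fun s => X s z)
    (fun s hs => ((hX.deriv s ⟨hs.1, hs.2.trans ht.2⟩ z).continuousWithinAt).mono
      (Icc_subset_Icc_right ht.2))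
    (f' := fun s => V (lagrangianTerm g q (X (clamp T s)) z)) (fun s hs => by
      have hs' : s ∈ Icc 0 T := ⟨hs.1.le, hs.2.le.trans ht.2⟩
      rw [clamp_of_mem hs']
      exact (hX.deriv s hs' z).hasDerivAt (Icc_mem_nhds hs.1 (hs.2.trans_le ht.2)))
    (hc.intervalIntegrable _ _)
  rw [this, hX.init]
  ring

theorem isLipschitzFlow_of_tendsto {l : ℝ} (hT : 0 ≤ T) (hX : ∀ k, IsLipschitzFlow T L l (X k))
    (h : ∀ t ∈ Icc 0 T, ∀ z, Tendsto (fun k => X k t z) atTop (𝓝 (X' t z))) :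
    IsLipschitzFlow T L l X' :=
  ⟨fun z => tendsto_nhds_unique (h 0 ⟨le_rfl, hT⟩ z) (by simp [fun k => (hX k).init z]),
    fun s hs t ht z => le_of_tendsto' ((h s hs z).sub (h t ht z)).abs fun k =>
      (hX k).time s hs t ht z,
    fun s hs t ht z y hzy => le_of_tendsto_of_tendsto' ((h s hs y).sub (h s hs z))
      (((h t ht y).sub (h t ht z)).const_mul _) fun k => (hX k).space s hs t ht z y hzy⟩

variable (D : IsDataLimit T C L K q V g q' V' g')
  (hX : ∀ k, IsLagrangianFlow T L (rate C L K) K (q k) (V k) (g k) (X k))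
  (h : ∀ t ∈ Icc 0 T, ∀ z, Tendsto (fun k => X k t z) atTop (𝓝 (X' t z)))
include D hX h

theorem IsDataLimit.density_le {t : ℝ} (ht : t ∈ Icc 0 T) {z y : ℝ} (hzy : z ≤ y) :
    ∫ x in z..y, q' x ≤ K * (X' t y - X' t z) :=
  le_of_tendsto_of_tendsto' (D.interval z y) (((h t ht y).sub (h t ht z)).const_mul K) fun k =>
    (hX k).density_le t ht z y hzy

theorem IsDataLimit.tendsto_eulerianTerm {t : ℝ} (ht : t ∈ Icc 0 T) {x : ℕ → ℝ} {x' : ℝ}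
    (hx : Tendsto x atTop (𝓝 x')) :
    Tendsto (fun k => eulerianTerm (g k) (q k) (X k t) (x k)) atTop
      (𝓝 (eulerianTerm g' q' (X' t) x')) := by
  have hT := D.limit.time_pos
  have hL := D.limit.bound_pos
  have hl := D.limit.rate_nonneg
  have hX' := isLipschitzFlow_of_tendsto hT.le (fun k => (hX k).toIsLipschitzFlow) h
  have hk := fun k => (hX k).isTransport hl ht
  have hk' := hX'.isTransport hl ht (q := q') (K := K) fun z y => D.density_le hX h ht
  obtain ⟨B, hB⟩ := hx.abs.bddAbove_range
  have shift : ∀ {Y : ℝ → ℝ} {c : ℝ}, Measurable Y → volume.map Y ≤ ENNReal.ofReal c • volume →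
      ∀ x, volume.map (fun y => Y y - x) ≤ ENNReal.ofReal c • volume :=
    fun hY hc x => map_sub_const_le hY hc x
  refine D.tendsto_integral_forward (inv_nonneg.2 (hk' ).pos.le) (B := 2 * (L * T) + (B + |x'|))
    (fun k => (hk k).measurable.sub_const _) (hk'.measurable.sub_const _)
    (fun k => shift (hk k).measurable (hk k).map_volume_le _)
    (shift hk'.measurable hk'.map_volume_le _)
    (fun y z hyz => hk'.strictMono.injective (sub_left_injective hyz)) (fun k y => ?_)
    fun y => (h t ht y).sub hx
  have h1 := abs_le.1 (hX'.abs_sub_init_le ht hL y)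
  have h2 := abs_le.1 ((hX k).abs_sub_init_le ht hL y)
  have h3 := abs_le.1 (hB (mem_range_self k))
  have h4 := abs_le.1 (le_refl |x'|)
  rw [abs_le]
  constructor <;> linarith [h1.1, h1.2, h2.1, h2.2, h3.1, h3.2, h4.1, h4.2]

theorem IsDataLimit.isLagrangianFlow : IsLagrangianFlow T L (rate C L K) K q' V' g' X' := by
  have hT := D.limit.time_pos
  have hL := D.limit.bound_pos
  have hl := D.limit.rate_nonneg
  have hX' := isLipschitzFlow_of_tendsto hT.le (fun k => (hX k).toIsLipschitzFlow) h
  have hd : ∀ t ∈ Icc 0 T, ∀ z y, z ≤ y → ∫ x in z..y, q' x ≤ K * (X' t y - X' t z) :=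
    fun t ht z y => D.density_le hX h ht
  have hmem : ∀ k, ∀ s ∈ Icc 0 T, ∀ z, lagrangianTerm (g k) (q k) (X k s) z ∈ Icc 0 K :=
    fun k s hs z => (D.data k).eulerianTerm_mem (hX k) hs _
  have hmem' : ∀ s ∈ Icc 0 T, ∀ z, lagrangianTerm g' q' (X' s) z ∈ Icc 0 K := fun s hs z =>
    (hX'.isTransport hl hs (hd s hs)).lagrangianTerm_mem D.limit.density D.limit.kernel z
  have hspeed : ∀ s ∈ Icc 0 T, ∀ z, Tendsto
      (fun k => V k (lagrangianTerm (g k) (q k) (X k s) z)) atTop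
      (𝓝 (V' (lagrangianTerm g' q' (X' s) z))) := fun s hs z =>
    tendsto_apply_of_lipschitz (fun k => (D.data k).velocity.lipschitz) D.velocity
      (fun k => hmem k s hs z) (hmem' s hs z) (D.tendsto_eulerianTerm hX h hs (h s hs z))
  have hc := D.limit.continuous_lagrangianSpeed hl hX' hd
  have heq : ∀ t ∈ Icc 0 T, ∀ z,
      X' t z = z + ∫ s in (0 : ℝ)..t, V' (lagrangianTerm g' q' (X' (clamp T s)) z) := by
    intro t ht z
    refine tendsto_nhds_unique (h t ht z) ?_
    simp only [fun k => (hX k).eq_add_integral (D.data k) hl ht z]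
    refine tendsto_const_nhds.add
      (intervalIntegral.tendsto_integral_filter_of_dominated_convergence (fun _ => L)
        (Eventually.of_forall fun k => ((D.data k).continuous_lagrangianSpeed hl
          (hX k).toIsLipschitzFlow (hX k).density_le z).aestronglyMeasurable)
        (Eventually.of_forall fun k => Eventually.of_forall fun s _ => ?_)
        intervalIntegrable_const
        (Eventually.of_forall fun s _ => hspeed _ (clamp_mem hT.le s) z))
    have := hmem k _ (clamp_mem hT.le s) z
    rw [Real.norm_of_nonneg ((D.data k).velocity.nonneg _ this)]
    exact (D.data k).velocity.le _ this
  refine ⟨hX', hd, fun t ht z => ?_⟩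
  have h1 := ((hc z).integral_hasStrictDerivAt 0 t).hasDerivAt.const_add z
  rw [clamp_of_mem ht] at h1
  exact h1.hasDerivWithinAt.congr (fun s hs => heq s hs z) (heq t ht z)

end flow


section transition

variable {T L l K : ℝ} {q V g : ℝ → ℝ} {X : ℝ → ℝ → ℝ}

theorem IsLagrangianFlow.abs_transition_sub_le (hX : IsLagrangianFlow T L l K q V g X) (hl : 0 ≤ l)
    {s s' t t' : ℝ} (hs : s ∈ Icc 0 T) (hs' : s' ∈ Icc 0 T) (ht : t ∈ Icc 0 T)
    (ht' : t' ∈ Icc 0 T) (x x' : ℝ) : |transition X t x s - transition X t' x' s'| ≤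
      L * |s - s'| + Real.exp (l * T) * (Real.exp (l * T) * (|x - x'| + L * |t - t'|)) := by
  have hXt := hX.isTransport hl ht
  set z := Function.invFun (X t) x with hz
  set z' := Function.invFun (X t') x' with hz'
  have e : X t z = x := Function.rightInverse_invFun hXt.surjective x
  have e' : X t' z' = x' := Function.rightInverse_invFun (hX.isTransport hl ht').surjective x'
  have h1 : |X s z - X s' z| ≤ L * |s - s'| := hX.time s hs s' hs' z
  have h2 : |X s' z - X s' z'| ≤ Real.exp (l * T) * |z - z'| :=
    (hX.isTransport hl hs').abs_sub_le z' z
  have h3 : |z - z'| ≤ Real.exp (l * T) * (|x - x'| + L * |t - t'|) := by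
    have h4 := hXt.le_abs_sub z' z
    have h5 : |X t z - X t z'| ≤ |x - x'| + L * |t - t'| := by
      have h6 := hX.time t ht t' ht' z'
      rw [abs_sub_comm, e'] at h6
      rw [e]
      exact (abs_sub_le x x' _).trans (add_le_add_right h6 _)
    have h7 : |z - z'| = Real.exp (l * T) * (Real.exp (-(l * T)) * |z - z'|) := by
      rw [← mul_assoc, ← Real.exp_add, add_neg_cancel, Real.exp_zero, one_mul]
    rw [h7]
    exact mul_le_mul_of_nonneg_left (h4.trans h5) (Real.exp_pos _).le
  exact (abs_sub_le _ (X s' z) _).trans (add_le_add h1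
    (h2.trans (mul_le_mul_of_nonneg_left h3 (Real.exp_pos _).le)))

theorem tendsto_transition {q V g : ℕ → ℝ → ℝ} {q' V' g' : ℝ → ℝ} {X : ℕ → ℝ → ℝ → ℝ}
    {X' : ℝ → ℝ → ℝ} (hl : 0 ≤ l) (hX : ∀ k, IsLagrangianFlow T L l K (q k) (V k) (g k) (X k))
    (hX' : IsLagrangianFlow T L l K q' V' g' X')
    (h : ∀ t ∈ Icc 0 T, ∀ z, Tendsto (fun k => X k t z) atTop (𝓝 (X' t z))) {s t : ℝ}
    (hs : s ∈ Icc 0 T) (ht : t ∈ Icc 0 T) (x : ℝ) :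
    Tendsto (fun k => transition (X k) t x s) atTop (𝓝 (transition X' t x s)) := by
  have hk := fun k => (hX k).isTransport hl ht
  set z' := Function.invFun (X' t) x with hz'
  have e' : X' t z' = x := Function.rightInverse_invFun (hX'.isTransport hl ht).surjective x
  have hz : Tendsto (fun k => Function.invFun (X k t) x) atTop (𝓝 z') := by
    rw [tendsto_iff_dist_tendsto_zero]
    have h1 : Tendsto (fun k => Real.exp (l * T) * |x - X k t z'|) atTop (𝓝 0) := by
      have := ((h t ht z').const_sub x).abs.const_mul (Real.exp (l * T))
      rwa [e', sub_self, abs_zero, mul_zero] at this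
    refine squeeze_zero (fun k => dist_nonneg) (fun k => ?_) h1
    have h2 := (hk k).le_abs_sub z' (Function.invFun (X k t) x)
    rw [Function.rightInverse_invFun (hk k).surjective x] at h2
    have h3 := mul_le_mul_of_nonneg_left h2 (Real.exp_pos (l * T)).le
    rwa [← mul_assoc, ← Real.exp_add, add_neg_cancel, Real.exp_zero, one_mul] at h3
  exact tendsto_apply_of_lipschitz (S := univ) (f := fun k => X k s) (F := X' s)
    (K := Real.exp (l * T)) (fun k y _ y' _ => ((hX k).isTransport hl hs).abs_sub_le y' y)
    (fun y _ => h s hs y) (fun k => mem_univ _) (mem_univ _) hz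

end transition

section selection

variable {T C L K R ε : ℝ} {q V g : ℕ → ℝ → ℝ} {a A : ℕ → ℝ} {X : ℕ → ℝ → ℝ → ℝ}

/-- Sequential compactness of the set of admissible data, together with their flows. -/
theorem exists_subsequence (hR : 0 < R) (hε : 0 < ε) (hd : ∀ k, IsData T C L K (q k) (V k) (g k))
    (ha : ∀ k, 0 ≤ a k) (hA : ∀ k, 0 ≤ A k) (haA : ∀ k, a k + A k ≤ L)
    (hV : ∀ k, IsBoundedVelocity K (a k) (A k) (V k))
    (hg : ∀ k, ∀ᵐ x ∂(volume.restrict (Ioi R)), g k x ≤ x ^ (-(1 + ε)))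
    (hX : ∀ k, IsLagrangianFlow T L (rate C L K) K (q k) (V k) (g k) (X k)) :
    ∃ (φ : ℕ → ℕ) (q' V' g' : ℝ → ℝ) (X' : ℝ → ℝ → ℝ), StrictMono φ ∧
      IsDataLimit T C L K (fun k => q (φ k)) (fun k => V (φ k)) (fun k => g (φ k)) q' V' g' ∧
      IsVelocity K L V' ∧ (∀ᵐ x ∂(volume.restrict (Ioi R)), g' x ≤ x ^ (-(1 + ε))) ∧
      ∀ t ∈ Icc 0 T, ∀ z, Tendsto (fun k => X (φ k) t z) atTop (𝓝 (X' t z)) := by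
  have hT := (hd 0).time_pos
  have hL := (hd 0).bound_pos
  have hK := (hd 0).density.bound_nonneg
  have hl := (hd 0).rate_nonneg
  obtain ⟨φ, hφ, hlim⟩ := exists_strictMono_tendsto
    (ι := (ℚ ⊕ ℚ ⊕ ℚ) ⊕ (ℚ × ℚ) ⊕ Bool)
    (fun k => Sum.elim (Sum.elim (fun r => V k (clamp K r)) (Sum.elim (fun r => g k r)
      fun r => ∫ x in (0 : ℝ)..r, q k x)) (Sum.elim (fun p => X k (clamp T p.1) p.2)
        fun b => bif b then a k else A k))
    (Sum.elim (Sum.elim (fun _ => L) (Sum.elim (fun _ => C) fun r => K * |(r : ℝ) - 0|))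
      (Sum.elim (fun p => |(p.2 : ℝ)| + L * T) fun _ => L)) (by
    rintro k ((r | r | r) | p | b) <;> simp only [Sum.elim_inl, Sum.elim_inr]
    · have := clamp_mem hK r
      exact abs_le.2 ⟨by linarith [(hd k).velocity.nonneg _ this], (hd k).velocity.le _ this⟩
    · have := (hd k).kernel.nonneg r
      exact abs_le.2 ⟨by linarith [(hd k).kernel.bound_nonneg], (hd k).kernel.le r⟩
    · rw [← Real.norm_eq_abs]
      exact intervalIntegral.norm_integral_le_of_norm_le_const fun u _ => (hd k).density.abs_le u
    · have h1 := (hX k).abs_sub_init_le (clamp_mem hT.le p.1) hL p.2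
      have h2 := abs_sub_abs_le_abs_sub (X k (clamp T p.1) p.2) p.2
      linarith
    · have h1 := ha k
      have h2 := hA k
      have h3 := haA k
      cases b <;> simp only [cond_false, cond_true, abs_le] <;> constructor <;> linarith)
  obtain ⟨a', ha'⟩ := hlim (Sum.inr (Sum.inr true))
  obtain ⟨A', hA'⟩ := hlim (Sum.inr (Sum.inr false))
  simp only [Sum.elim_inr, cond_true] at ha'
  simp only [Sum.elim_inr, cond_false] at hA'
  have hQ : Dense (range ((↑) : ℚ → ℝ)) := Rat.denseRange_cast
  have hQ2 : Dense (range (Prod.map ((↑) : ℚ → ℝ) ((↑) : ℚ → ℝ))) :=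
    Rat.denseRange_cast.prodMap Rat.denseRange_cast
  choose V' hV' using exists_tendsto_of_dense (f := fun k u => V (φ k) (clamp K u)) hQ hL
    (fun k x y => ((hd _).velocity.lipschitz _ (clamp_mem hK x) _ (clamp_mem hK y)).trans
      (mul_le_mul_of_nonneg_left (abs_clamp_sub_le _ _ _) hL)) (by
    rintro _ ⟨r, rfl⟩
    exact hlim (Sum.inl (Sum.inl r)))
  choose X' hX' using exists_tendsto_of_dense (K := L + Real.exp (rate C L K * T))
    (f := fun k (p : ℝ × ℝ) => X (φ k) (clamp T p.1) p.2)
    hQ2 (by positivity) (fun k p p' => by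
      have h1 := (hX (φ k)).time _ (clamp_mem hT.le p.1) _ (clamp_mem hT.le p'.1) p.2
      have h2 := ((hX (φ k)).isTransport hl (clamp_mem hT.le p'.1)).abs_sub_le p'.2 p.2
      have h3 : |clamp T p.1 - clamp T p'.1| ≤ dist p p' :=
        (abs_clamp_sub_le _ _ _).trans ((Real.dist_eq _ _).symm.le.trans (le_max_left _ _))
      have h4 : |p.2 - p'.2| ≤ dist p p' := (Real.dist_eq _ _).symm.le.trans (le_max_right _ _)
      rw [add_mul]
      exact (abs_sub_le _ (X (φ k) (clamp T p'.1) p.2) _).trans (add_le_add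
        (h1.trans (mul_le_mul_of_nonneg_left h3 hL))
        (h2.trans (mul_le_mul_of_nonneg_left h4 (Real.exp_pos _).le)))) (by
    rintro _ ⟨p, rfl⟩
    exact hlim (Sum.inr (Sum.inl p)))
  obtain ⟨q', hq', hqlim⟩ := exists_limit_density (fun k => (hd (φ k)).density)
    fun r => hlim (Sum.inl (Sum.inr (Sum.inr r)))
  obtain ⟨g', hg', hgd, hglim⟩ := exists_limit_kernel hR hε (fun k => (hd (φ k)).kernel)
    (fun k => hg (φ k)) fun r => hlim (Sum.inl (Sum.inr (Sum.inl r)))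
  have hVlim : ∀ u ∈ Icc 0 K, Tendsto (fun k => V (φ k) u) atTop (𝓝 (V' u)) := fun u hu => by
    have := hV' u
    rwa [clamp_of_mem hu] at this
  have hbV := isBoundedVelocity_of_tendsto (fun k => hV (φ k)) ha' hA' hVlim
  have ha0 : 0 ≤ a' := ge_of_tendsto' ha' fun k => ha _
  have hA0 : 0 ≤ A' := ge_of_tendsto' hA' fun k => hA _
  have haA' : a' + A' ≤ L := le_of_tendsto' (ha'.add hA') fun k => haA _
  refine ⟨φ, q', V', g', fun t z => X' (t, z), hφ, ⟨fun k => hd _, ⟨hT, hL, hq',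
    hbV.isLipschitzVelocity (by linarith) (by linarith), hg'⟩, hqlim, hVlim, ?_⟩,
    hbV.isVelocity hK ha0 hA0 haA', hgd, fun t ht z => ?_⟩
  · simpa only [integral_abs_forward_sub] using hglim
  · have := hX' (t, z)
    simp only at this
    rwa [clamp_of_mem ht] at this

end selection

section conclusion

variable {T C L K : ℝ} {q V g γ q₀ : ℝ → ℝ} {X : ℝ → ℝ → ℝ}

theorem IsData.isTheWeakSolution (h : IsData T C L K q V g)
    (hX : IsLagrangianFlow T L (rate C L K) K q V g X) (hγ : γ =ᵐ[volume.restrict (Ioi 0)] g)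
    (hq₀ : q₀ =ᵐ[volume] q) : IsTheWeakSolution T K q₀ V γ (transported K q X) :=
  have hs := h.isWeakSolution hX hγ hq₀
  ⟨hs, fun _ hp _ ht => h.weakSolution_unique hγ hq₀ hp hs ht⟩

theorem IsData.abs_eulerianTerm_sub_le_dist (h : IsData T C L K q V g)
    (hX : IsLagrangianFlow T L (rate C L K) K q V g X) {p p' : ℝ × ℝ}
    (hp : p ∈ Icc 0 T ×ˢ (univ : Set ℝ)) (hp' : p' ∈ Icc 0 T ×ˢ (univ : Set ℝ)) :
    |eulerianTerm g q (X p.1) p.2 - eulerianTerm g q (X p'.1) p'.2| ≤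
      4 * K * C * (L + 1) * dist p p' := by
  have hL := h.bound_pos
  have hK := h.density.bound_nonneg
  have hC := h.kernel.bound_nonneg
  have h1 : |p.1 - p'.1| ≤ dist p p' := (Real.dist_eq _ _).symm.le.trans (le_max_left _ _)
  have h2 : |p.2 - p'.2| ≤ dist p p' := (Real.dist_eq _ _).symm.le.trans (le_max_right _ _)
  rw [mul_assoc _ (L + 1), add_mul, one_mul]
  exact (h.abs_eulerianTerm_sub_le hX hp.1 hp'.1 _ _).trans (mul_le_mul_of_nonneg_left
    (add_le_add (mul_le_mul_of_nonneg_left h1 hL) h2) (by positivity))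

theorem IsData.isBoundedLipschitz (h : IsData T C L K q V g)
    (hX : IsLagrangianFlow T L (rate C L K) K q V g X) :
    IsBoundedLipschitz T fun t x => eulerianTerm g q (X t) x := by
  have hL := h.bound_pos
  have hK := h.density.bound_nonneg
  have hC := h.kernel.bound_nonneg
  refine ⟨⟨K, fun t ht x => ?_⟩, (4 * K * C * (L + 1)).toNNReal,
    LipschitzOnWith.of_dist_le_mul fun p hp p' hp' => ?_⟩
  · have := h.eulerianTerm_mem hX ht x
    rw [abs_of_nonneg this.1]
    exact this.2
  · rw [Real.coe_toNNReal _ (by positivity)]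
    exact h.abs_eulerianTerm_sub_le_dist hX hp hp'

theorem integral_sq_le_of_eLpNorm_le {f : ℝ → ℝ} {μ : Measure ℝ} {C : ℝ≥0}
    (hf : MemLp f 2 μ) (h : eLpNorm f 2 μ ≤ C) :
    Integrable (fun x => f x ^ 2) μ ∧ ∫ x, f x ^ 2 ∂μ ≤ (C : ℝ) ^ 2 := by
  refine ⟨hf.integrable_sq, ?_⟩
  have h0 : 0 ≤ ∫ x, f x ^ 2 ∂μ := integral_nonneg fun x => sq_nonneg _
  rw [hf.eLpNorm_eq_integral_rpow_norm two_ne_zero ENNReal.ofNat_ne_top,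
    ENNReal.ofReal_le_iff_le_toReal ENNReal.coe_ne_top, ENNReal.coe_toReal] at h
  simp only [ENNReal.toReal_ofNat, Real.rpow_ofNat, Real.norm_eq_abs, sq_abs] at h
  rw [← Real.sqrt_le_left C.coe_nonneg, Real.sqrt_eq_rpow, one_div]
  exact h

end conclusion

end NonlocalControl

theorem mainTheorem3
    (T qmax CV CΓ R ε : ℝ) (hT : 0 < T) (hqmax : 0 < qmax) (hCV : 0 < CV) (hCΓ : 0 < CΓ)
    (hR : 0 < R) (hε : 0 < ε)
    (q₀ V γ : ℕ → ℝ → ℝ)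
    (hq₀ : ∀ k, NonlocalControl.IsInitialDatum qmax (q₀ k))
    (hV : ∀ k, NonlocalControl.IsVelocity qmax CV (V k))
    (hγ : ∀ k, NonlocalControl.IsKernel CΓ R ε (γ k)) :
    -- the solutions `q[q₀ₖ, Vₖ, γₖ]` and the characteristics of their nonlocal terms
    ∃ (q : ℕ → ℝ → ℝ → ℝ) (ξ : ℕ → ℝ → ℝ → ℝ → ℝ),
      (∀ k, NonlocalControl.IsTheWeakSolution T qmax (q₀ k) (V k) (γ k) (q k) ∧
        NonlocalControl.IsContinuousInLp T 2 volume (q k)) ∧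
      (∀ k, NonlocalControl.IsTheCharacteristics T (V k)
        (NonlocalControl.nonlocalTerm (γ k) (q k)) (ξ k)) ∧
      -- the subsequence and the limits
      ∃ (φ : ℕ → ℕ) (q₀' V' γ' : ℝ → ℝ) (q' W' : ℝ → ℝ → ℝ) (ξ' : ℝ → ℝ → ℝ → ℝ),
        StrictMono φ ∧
        -- the limits are admissible
        (AEStronglyMeasurable q₀' volume ∧ ∀ᵐ x, 0 ≤ q₀' x ∧ q₀' x ≤ qmax) ∧
        NonlocalControl.IsVelocity qmax CV V' ∧
        NonlocalControl.IsKernel CΓ R ε γ' ∧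
        NonlocalControl.IsBoundedLipschitz T W' ∧
        ((∃ C : ℝ≥0, ∀ k, eLpNorm (q₀ k) 2 volume ≤ C) →
          NonlocalControl.IsInitialDatum qmax q₀' ∧
          NonlocalControl.IsContinuousInLp T 2 volume q') ∧
        -- convergence of the data: weak-* in `L^∞`, uniform, and in `L¹`
        (∀ f : ℝ → ℝ, Integrable f volume →
          Tendsto (fun k => ∫ x, q₀ (φ k) x * f x) atTop (𝓝 (∫ x, q₀' x * f x))) ∧
        TendstoUniformlyOn (fun k => V (φ k)) V' atTop (Icc 0 qmax) ∧
        Tendsto (fun k => eLpNorm (fun x => γ (φ k) x - γ' x) 1 (volume.restrict (Ioi 0)))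
          atTop (𝓝 0) ∧
        -- convergence of the nonlocal terms in `C([0, T] × ℝ)`
        TendstoLocallyUniformlyOn
          (fun k (p : ℝ × ℝ) => NonlocalControl.nonlocalTerm (γ (φ k)) (q (φ k)) p.1 p.2)
          (fun p => W' p.1 p.2) atTop (Icc 0 T ×ˢ univ) ∧
        -- convergence of the characteristics in `C([0, T] × ℝ × [0, T])`
        TendstoLocallyUniformlyOn
          (fun k (p : ℝ × ℝ × ℝ) => ξ (φ k) p.1 p.2.1 p.2.2)
          (fun p => ξ' p.1 p.2.1 p.2.2) atTop (Icc 0 T ×ˢ univ ×ˢ Icc 0 T) ∧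
        NonlocalControl.IsTheCharacteristics T V' W' ξ' ∧
        -- the limit is the nonlocal term of the solution for the limiting data
        NonlocalControl.IsTheWeakSolution T qmax q₀' V' γ' q' ∧
        (∀ t ∈ Icc 0 T, ∀ x, W' t x = NonlocalControl.nonlocalTerm γ' q' t x) := by
  choose qd hqd hq₀d using fun k =>
    NonlocalControl.exists_isDensity hqmax.le (hq₀ k).memLp_two.1 (hq₀ k).bounds
  choose a A ha hA haA hbV using fun k => (hV k).exists_isBoundedVelocity hqmax hCV.le
  choose g hg hγg hgd using fun k => (hγ k).exists_isMonotoneKernel hCΓ.le hR.le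
  have hd : ∀ k, NonlocalControl.IsData T CΓ CV qmax (qd k) (V k) (g k) := fun k =>
    ⟨hT, hCV.le, hqd k, (hbV k).isLipschitzVelocity (by linarith [hA k, haA k])
      (by linarith [ha k, haA k]), hg k⟩
  choose X hX using fun k => (hd k).exists_lagrangianFlow
  have hl := (hd 0).rate_nonneg
  have hW : ∀ k, ∀ t ∈ Icc 0 T, ∀ x,
      NonlocalControl.nonlocalTerm (γ k) (NonlocalControl.transported qmax (qd k) (X k)) t x =
        NonlocalControl.eulerianTerm (g k) (qd k) (X k t) x := fun k t ht x =>
    NonlocalControl.nonlocalTerm_transported (hX k) hl (hqd k) (hg k) (hγg k) ht x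
  obtain ⟨φ, q', V', g', X', hφ, D, hV', hgd', hXlim⟩ :=
    NonlocalControl.exists_subsequence hR hε hd ha hA haA hbV hgd hX
  have hXφ := fun k => hX (φ k)
  have hX' := D.isLagrangianFlow hXφ hXlim
  have hg' := D.limit.kernel
  have hq' := D.limit.density
  have hW' : ∀ t ∈ Icc 0 T, ∀ x, NonlocalControl.eulerianTerm g' q' (X' t) x =
      NonlocalControl.nonlocalTerm g' (NonlocalControl.transported qmax q' X') t x :=
    fun t ht x => (NonlocalControl.nonlocalTerm_transported hX' hl hq' hg' EventuallyEq.rfl ht x).symm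
  refine ⟨fun k => NonlocalControl.transported qmax (qd k) (X k),
    fun k => NonlocalControl.transition (X k), fun k => ⟨(hd k).isTheWeakSolution (hX k) (hγg k)
      (hq₀d k), (hX k).isContinuousInLp_two hl (hqd k)
        ((memLp_congr_ae (hq₀d k)).1 (hq₀ k).memLp_two)⟩,
    fun k => (hd k).isTheCharacteristics (hX k) (hW k),
    φ, q', V', g', NonlocalControl.transported qmax q' X',
    fun t x => NonlocalControl.eulerianTerm g' q' (X' t) x, NonlocalControl.transition X', hφ,
    ⟨hq'.measurable.aestronglyMeasurable, Eventually.of_forall fun x => ⟨hq'.nonneg x, hq'.le x⟩⟩,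
    hV', hg'.isKernel hgd', D.limit.isBoundedLipschitz hX', ?_, ?_, ?_, ?_, ?_, ?_,
    D.limit.isTheCharacteristics hX' fun _ _ _ => rfl,
    D.limit.isTheWeakSolution hX' EventuallyEq.rfl EventuallyEq.rfl, hW'⟩
  · rintro ⟨C, hC⟩
    have h2 : MemLp q' 2 volume := NonlocalControl.memLp_two_of_tendsto (fun k => hqd (φ k)) hq'
      (fun f hf => D.weak hf) (B := (C : ℝ) ^ 2) fun k =>
        NonlocalControl.integral_sq_le_of_eLpNorm_le
          ((memLp_congr_ae (hq₀d (φ k))).1 (hq₀ (φ k)).memLp_two)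
          ((eLpNorm_congr_ae (hq₀d (φ k))).symm.trans_le (hC (φ k)))
    exact ⟨⟨h2, Eventually.of_forall fun x => ⟨hq'.nonneg x, hq'.le x⟩⟩,
      hX'.isContinuousInLp_two hl hq' h2⟩
  · intro f hf
    refine (D.weak hf).congr fun k => integral_congr_ae ?_
    filter_upwards [hq₀d (φ k)] with x hx
    rw [hx]
  · refine (tendstoLocallyUniformlyOn_iff_tendstoUniformlyOn_of_compact isCompact_Icc).1
      (NonlocalControl.tendstoLocallyUniformlyOn_of_lipschitz hCV.le (fun k u hu w hw => ?_)
        D.velocity)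
    exact (hd (φ k)).velocity.lipschitz u hu w hw
  · have h1 := ENNReal.tendsto_ofReal D.kernel
    rw [ENNReal.ofReal_zero] at h1
    refine h1.congr fun k => ?_
    have h2 : (fun x => γ (φ k) x - g' x) =ᵐ[volume.restrict (Ioi 0)]
        fun x => g (φ k) x - g' x := by
      filter_upwards [hγg (φ k)] with x hx
      rw [hx]
    rw [NonlocalControl.integral_abs_forward_sub, eLpNorm_congr_ae h2,
      eLpNorm_one_eq_lintegral_enorm]
    exact ofReal_integral_norm_eq_lintegral_enorm ((hg (φ k)).integrableOn.sub hg'.integrableOn)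
  · refine NonlocalControl.tendstoLocallyUniformlyOn_of_lipschitz
      (K := 4 * qmax * CΓ * (CV + 1)) (by positivity) (fun k p hp p' hp' => ?_) fun p hp => ?_
    · rw [hW _ _ hp.1, hW _ _ hp'.1]
      exact (hd (φ k)).abs_eulerianTerm_sub_le_dist (hX (φ k)) hp hp'
    · simp only [fun k => hW (φ k) p.1 hp.1]
      exact D.tendsto_eulerianTerm hXφ hXlim hp.1 tendsto_const_nhds
  · set b := Real.exp (NonlocalControl.rate CΓ CV qmax * T)
    have hb : 0 < b := Real.exp_pos _
    refine NonlocalControl.tendstoLocallyUniformlyOn_of_lipschitz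
      (K := CV + b * (b * (1 + CV))) (by positivity) (fun k p hp p' hp' => ?_) fun p hp =>
        NonlocalControl.tendsto_transition hl hXφ hX' hXlim hp.2.2 hp.1 p.2.1
    have h1 : |p.1 - p'.1| ≤ dist p p' := (Real.dist_eq _ _).symm.le.trans (le_max_left _ _)
    have h2 : dist p.2 p'.2 ≤ dist p p' := le_max_right _ _
    have h3 : |p.2.1 - p'.2.1| ≤ dist p p' :=
      ((Real.dist_eq _ _).symm.le.trans (le_max_left _ _)).trans h2
    have h4 : |p.2.2 - p'.2.2| ≤ dist p p' :=
      ((Real.dist_eq _ _).symm.le.trans (le_max_right _ _)).trans h2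
    refine ((hX (φ k)).abs_transition_sub_le hl hp.2.2 hp'.2.2 hp.1 hp'.1 p.2.1 p'.2.1).trans ?_
    have h5 : |p.2.1 - p'.2.1| + CV * |p.1 - p'.1| ≤ (1 + CV) * dist p p' := by
      have := mul_le_mul_of_nonneg_left h1 hCV.le
      linarith
    have h6 := mul_le_mul_of_nonneg_left (mul_le_mul_of_nonneg_left h5 hb.le) hb.le
    have h7 := mul_le_mul_of_nonneg_left h4 hCV.le
    linarith
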